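/- Let $p\in(1,\infty)$, $q\ge 1$ an integer, $\nu\in(0,1]$, $m=\max\{2,p\}$, and let $\alpha>1$ be the adjustment factor of the adaptive method below. There is a constant $c>0$ depending only on $p,q,\nu,\alpha$ (in particular not on the dimension) such that the following holds for all $d$, $L>0$, $T\ge 1$, $R>0$, $x_0\in\mathbb R^d$ and every convex $q$-times differentiable $f:\mathbb R^d\to\mathbb R$ with a minimizer $x^\ast$, $\|x^\ast-x_0\|_p\le R$, whose $q$-th derivative satisfies $\|\nabla^q f(x)-\nabla^q f(y)\|\le L\|x-y\|_p^\nu$ for all $x,y$ (operator norm of multilinear forms with respect to $\|\cdot\|_p$). One may take $R=R_p:=\|x^\ast-x_0\|_p$ if $x_0\ne x^\ast$. **Notation.** $\|\cdot\|=\|\cdot\|_p$ with dual norm $\|\cdot\|_*$; $\sigma=\sigma'=\frac14$, $r_*=\frac r{r-1}$, $C_{\mu,r}=\frac\mu2\big(\frac{r_*(1-\sigma-\sigma')}{1+\sigma^{r_*}}\big)^{r-1}$, $\hat\lambda=\frac{\sigma(q-1)!}{2L}$. The regularizer is $\psi(x)=\frac{2^{p(p-2)/(p-1)}}{p}\|x-x_0\|^p$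 if $p\ge2$ and $\psi(x)=\frac1{2(p-1)}\|x-x_0\|^2$ if $p<2$; $D_\psi(x,y)=\psi(x)-\psi(y)-\langle\nabla\psi(y),x-y\rangle$; $\psi$ is $\delta$-inexact $(\mu,r)$-uniformly convex if it is differentiable and $D_\psi(x,y)\ge\frac\mu r\|x-y\|^r-\delta$ for all $x,y$ ($(\mu,r)$-uniformly convex if $\delta=0$). Let $f_q(y;x)=\sum_{i\le q}\frac1{i!}\nabla^if(x)[y-x]^{\otimes i}$. A *Taylor step* from $x$ is any $y$ with $\|\nabla F(y)\|_*\le\frac L{(q-1)!}\|y-x\|^{q+\nu-1}$, where $F(y)=f_q(y;x)+\frac1{\hat\lambda(q+\nu)}\|y-x\|^{q+\nu}$. A triple $(y,v,\lambda)$ with $\lambda>0$ is an *inexact proximal step* from $x$ with exponent $r$ if for some $0\le\varepsilon\le\frac{\sigma'}\lambda\|x-y\|^r$ one has $f(w)\ge f(y)+\langle v,w-y\rangle-\varepsilon$ for all $w$, and $\|v-\hat v\|_*\le\frac\sigma\lambda\|x-y\|^{r-1}$ with $\hat v$ the gradient of $w\mapsto-\frac1{r\lambda}\|w-x\|^r$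 at $y$. **Method 1.** Let $r=q+\nu$, $\mu=a^{m/r}$ with $a=R^{r(m-r)/m}T^{-r(m-r)/m^2}$, $y_0=z_0=x_0$, $A_0=0$. For $k=1,\dots,T$: $A_k=A_{k-1}+a_k$ with $a_k>0$, $a_k=(C_{\mu,r}A_k^{r-1}\hat\lambda)^{1/r}$; $x_k=\frac{A_{k-1}}{A_k}y_{k-1}+\frac{a_k}{A_k}z_{k-1}$; $y_k$ is a Taylor step from $x_k$; $v_k=\nabla f(y_k)$; $z_k\in\arg\min_z\{\sum_{i\le k}a_i\langle v_i,z\rangle+D_\psi(z,x_0)\}$. Return $y_T$. **Method 2 (adaptive).** Let $r=m$, $y_0=z_0=x_0$, $A_0=0$. For $k=1,\dots,T$: $\hat A_k=A_{k-1}+\hat a_k$ with $\hat a_k>0$, $\hat a_k=(C_{1,r}\hat A_k^{r-1}\hat\lambda_k)^{1/r}$; $x_k=\frac{A_{k-1}}{\hat A_k}y_{k-1}+\frac{\hat a_k}{\hat A_k}z_{k-1}$ (so $x_1=x_0$); $\tilde y_k$ is a Taylor step from $x_k$; if $\tilde y_k=x_k$, stop and return $x_k$; otherwise $v_k=\nabla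 f(\tilde y_k)$, $\lambda_k=\hat\lambda\|\tilde y_k-x_k\|^{r-q-\nu}$ (and $\hat\lambda_1:=\lambda_1$), $\gamma_k=\min\{\lambda_k/\hat\lambda_k,1\}$, $a_k=\gamma_k\hat a_k$, $A_k=A_{k-1}+a_k$; $y_k\in\arg\min\{f(\tilde y_k),f(y_{k-1})\}$ (in all iterations) or $y_k=\frac{(1-\gamma_k)A_{k-1}}{A_k}y_{k-1}+\frac{\gamma_k\hat A_k}{A_k}\tilde y_k$ (in all iterations); $z_k$ as in Method 1; $\hat\lambda_{k+1}=\alpha\hat\lambda_k$ if $\hat\lambda_k\le\lambda_k$ and $\hat\lambda_{k+1}=\alpha^{-1}\hat\lambda_k$ otherwise. Return $y_T$ if all $T$ iterations are completed. **Claim.** Use Method 1 if $q+\nu\le m$ and Method 2 if $q+\nu>m$. Then: 1. $\psi$ is $\delta$-inexact $(\mu,q+\nu)$-uniformly convex for some $\delta\ge0$ (Method 1), respectively $(1,m)$-uniformly convex (Method 2). 2. The method can be carried out, and every point $y$ that it can return for horizon $T$ satisfies $$f(y)-f(x^\ast)\le c\,L\,R^{q+\nu}\,T^{-\frac{(m+1)(q+\nu)-m}{m}}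 .$$ 3. Every step taken, $(y_k,v_k,\hat\lambda)$ in Method 1 and $(\tilde y_k,v_k,\lambda_k)$ in Method 2, is an inexact proximal step from $x_k$ with exponent $r$. 4. Iteration $k$ makes one query to the $q$-th order oracle $x\mapsto(f(x),\nabla f(x),\dots,\nabla^qf(x))$, at $x_k$; besides it, only the value and gradient of $f$ at the trial point ($y_k$, resp. $\tilde y_k$) are used: a sequence of iterations of the method on $f$ is also one on any function $g$ with the same oracle answers at the points $x_k$ and the same values and gradients at the trial points. -/

import Mathlib

open scoped ENNReal

noncomputable section

/-! ### Oracle, Taylor model, regularizer -/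

/-- An answer of the `q`-th order oracle: the derivatives of orders `0, …, q` at one point. -/
abbrev Jet (E : Type*) [NormedAddCommGroup E] [NormedSpace ℝ E] (q : ℕ) : Type _ :=
  (i : Fin (q + 1)) → ContinuousMultilinearMap ℝ (fun _ : Fin (i : ℕ) => E) ℝ

/-- The `q`-th order oracle `O_f(x) = (f(x), ∇f(x), …, ∇^q f(x))`. -/
def qOracle {E : Type*} [NormedAddCommGroup E] [NormedSpace ℝ E]
    (q : ℕ) (f : E → ℝ) (x : E) : Jet E q :=
  fun i => iteratedFDeriv ℝ (i : ℕ) f x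

/-- `∑_{i ≤ q} (1 / i!) J_i [y - x]^{⊗ i}`: the Taylor expansion around `x` built from an oracle
answer `J` at `x`. -/
def taylorModel {E : Type*} [NormedAddCommGroup E] [NormedSpace ℝ E] {q : ℕ}
    (J : Jet E q) (x y : E) : ℝ :=
  ∑ i : Fin (q + 1), (1 / ((i : ℕ).factorial : ℝ)) * J i (fun _ => y - x)

/-- `F(y) = f_q(y; x) + (1 / (lam (q + ν))) ‖y - x‖^(q + ν)`. -/
def regTaylor {E : Type*} [NormedAddCommGroup E] [NormedSpace ℝ E] {q : ℕ}
    (ν lam : ℝ) (J : Jet E q) (x y : E) : ℝ :=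
  taylorModel J x y + 1 / (lam * (q + ν)) * ‖y - x‖ ^ ((q : ℝ) + ν)

/-- `y` is an approximate critical point of the regularized Taylor expansion around `x`:
`‖∇F(y)‖_* ≤ (L / (q - 1)!) ‖y - x‖^(q + ν - 1)`. The dual norm is the operator norm. -/
def IsApproxCritical {E : Type*} [NormedAddCommGroup E] [NormedSpace ℝ E] {q : ℕ}
    (L ν lam : ℝ) (J : Jet E q) (x y : E) : Prop :=
  ∃ g : E →L[ℝ] ℝ, HasFDerivAt (regTaylor ν lam J x) g y ∧
    ‖g‖ ≤ L / ((q - 1).factorial : ℝ) * ‖y - x‖ ^ ((q : ℝ) + ν - 1)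

/-- The proximal parameter `σ (q - 1)! / (2 L)` in the regularized Taylor expansion. -/
def baseLam (q : ℕ) (L σ : ℝ) : ℝ := σ * ((q - 1).factorial : ℝ) / (2 * L)

/-- The `δ`-enlarged subdifferential. Vectors `g` are identified with functionals `⟨g, ·⟩`. -/
def enlargedSubdifferential {E : Type*} [NormedAddCommGroup E] [NormedSpace ℝ E]
    (δ : ℝ) (f : E → ℝ) (y : E) : Set (E →L[ℝ] ℝ) :=
  {g | ∀ z, f y + g (z - y) - δ ≤ f z}

/-- The requirement on an inexact proximal oracle called at `x`, for an answer `y, v` with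
proximal parameter `lam`. The norms used here are differentiable away from `0` and `r > 1`, so the
subdifferential of `w ↦ -(1 / (r lam)) ‖w - x‖^r` at `y` is its gradient `vhat`. -/
def IsInexactProx {E : Type*} [NormedAddCommGroup E] [NormedSpace ℝ E]
    (f : E → ℝ) (r lam σ σ' : ℝ) (x y : E) (v : E →L[ℝ] ℝ) : Prop :=
  0 < lam ∧
  (∃ ε : ℝ, 0 ≤ ε ∧ v ∈ enlargedSubdifferential ε f y ∧ ε ≤ σ' / lam * ‖x - y‖ ^ r) ∧
  ∃ vhat : E →L[ℝ] ℝ, HasFDerivAt (fun w => -(1 / (r * lam)) * ‖w - x‖ ^ r) vhat y ∧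
    ‖v - vhat‖ ≤ σ / lam * ‖x - y‖ ^ (r - 1)

/-- The Bregman divergence `D_ψ(x, y)`. -/
def bregman {E : Type*} [NormedAddCommGroup E] [NormedSpace ℝ E]
    (ψ : E → ℝ) (x y : E) : ℝ :=
  ψ x - ψ y - fderiv ℝ ψ y (x - y)

/-- `ψ` is `δ`-inexact `(μ, r)`-uniformly convex; `δ = 0` is `(μ, r)`-uniform convexity. -/
def IsInexactUniformlyConvex {E : Type*} [NormedAddCommGroup E] [NormedSpace ℝ E]
    (δ μ r : ℝ) (ψ : E → ℝ) : Prop :=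
  Differentiable ℝ ψ ∧ ∀ x y, μ / r * ‖x - y‖ ^ r - δ ≤ bregman ψ x y

/-- The `p`-norm regularizer centred at `x₀`, scaled so as to be `(1, max 2 p)`-uniformly convex:
a multiple of `‖x - x₀‖_p ^ p` for `p ≥ 2`, and `‖x - x₀‖_p ^ 2 / (2 (p - 1))` for `p < 2`. -/
def pReg {E : Type*} [NormedAddCommGroup E] (p : ℝ) (x₀ x : E) : ℝ :=
  if 2 ≤ p then (2 : ℝ) ^ (p * (p - 2) / (p - 1)) / p * ‖x - x₀‖ ^ p
  else 1 / (2 * (p - 1)) * ‖x - x₀‖ ^ (2 : ℕ)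

/-- `C = (μ / 2) (r_* (1 - σ - σ') / (1 + σ^{r_*}))^(r - 1)` with `r_* = r / (r - 1)`. -/
def stepConst (μ r σ σ' : ℝ) : ℝ :=
  μ / 2 * (r / (r - 1) * (1 - σ - σ') / (1 + σ ^ (r / (r - 1)))) ^ (r - 1)

/-! ### The accelerated inexact proximal point method -/

/-- The quantities produced by the method; index `k` is iteration `k`. -/
structure Alg1Data (E : Type*) [NormedAddCommGroup E] [NormedSpace ℝ E] where
  x : ℕ → E
  y : ℕ → E
  z : ℕ → E
  v : ℕ → (E →L[ℝ] ℝ)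
  a : ℕ → ℝ
  A : ℕ → ℝ

/-- `s` records `K` iterations of the accelerated inexact proximal point method on `f`, with
regularizer `ψ`, exponent `r`, constant proximal parameter `lam`, where the proximal oracle is
implemented through the regularized Taylor expansion around `x_k`. -/
structure IsAlg1Run {E : Type*} [NormedAddCommGroup E] [NormedSpace ℝ E]
    (q : ℕ) (ν L r μ σ σ' : ℝ) (ψ : E → ℝ) (x₀ : E) (f : E → ℝ) (K : ℕ)
    (s : Alg1Data E) : Prop where
  y_zero : s.y 0 = x₀
  z_zero : s.z 0 = x₀
  A_zero : s.A 0 = 0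
  A_succ : ∀ k < K, s.A (k + 1) = s.a (k + 1) + s.A k
  a_pos : ∀ k < K, 0 < s.a (k + 1)
  a_eq : ∀ k < K, s.a (k + 1) =
    (stepConst μ r σ σ' * s.A (k + 1) ^ (r - 1) * baseLam q L σ) ^ (1 / r)
  x_succ : ∀ k < K, s.x (k + 1) =
    (s.A k / s.A (k + 1)) • s.y k + (s.a (k + 1) / s.A (k + 1)) • s.z k
  y_succ : ∀ k < K, IsApproxCritical L ν (baseLam q L σ)
    (qOracle q f (s.x (k + 1))) (s.x (k + 1)) (s.y (k + 1))
  v_succ : ∀ k < K, s.v (k + 1) = fderiv ℝ f (s.y (k + 1))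
  z_succ : ∀ k < K, ∀ w,
    (∑ i ∈ Finset.Icc 1 (k + 1), s.a i * s.v i (s.z (k + 1))) + bregman ψ (s.z (k + 1)) x₀ ≤
      (∑ i ∈ Finset.Icc 1 (k + 1), s.a i * s.v i w) + bregman ψ w x₀

/-- For `r ≤ m`, the constant `μ = a^(m / r)` for which a `(1, m)`-uniformly convex function is
used as an inexact `(μ, r)`-uniformly convex one, where
`a = R^(r (m - r) / m) T^(-r (m - r) / m ^ 2)`. -/
def inexactMu (m r R T : ℝ) : ℝ :=
  (R ^ (r * (m - r) / m) * T ^ (-(r * (m - r) / m ^ 2))) ^ (m / r)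

/-! ### The adaptive method -/

/-- The quantities produced by the adaptive method; index `k` is iteration `k`. -/
structure Alg2Data (E : Type*) [NormedAddCommGroup E] [NormedSpace ℝ E] where
  x : ℕ → E
  y : ℕ → E
  yt : ℕ → E
  z : ℕ → E
  v : ℕ → (E →L[ℝ] ℝ)
  lam : ℕ → ℝ
  lamHat : ℕ → ℝ
  a : ℕ → ℝ
  aHat : ℕ → ℝ
  A : ℕ → ℝ
  AHat : ℕ → ℝ
  γ : ℕ → ℝ

/-- The first half of iteration `k + 1`: the point `x_{k+1}`. For `k = 0` it is `x₀`, whatever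
the value of `lamHat 1 > 0`. -/
structure Alg2Extrapolate {E : Type*} [NormedAddCommGroup E] [NormedSpace ℝ E]
    (C r : ℝ) (s : Alg2Data E) (k : ℕ) : Prop where
  AHat_eq : s.AHat (k + 1) = s.aHat (k + 1) + s.A k
  aHat_pos : 0 < s.aHat (k + 1)
  aHat_eq : s.aHat (k + 1) = (C * s.AHat (k + 1) ^ (r - 1) * s.lamHat (k + 1)) ^ (1 / r)
  x_eq : s.x (k + 1) =
    (s.A k / s.AHat (k + 1)) • s.y k + (s.aHat (k + 1) / s.AHat (k + 1)) • s.z k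

/-- The two rules for `y_{k+1}`: `true` takes the better of `ỹ_{k+1}` and `y_k`, `false` takes
a convex combination. -/
def Alg2YRule {E : Type*} [NormedAddCommGroup E] [NormedSpace ℝ E]
    (b : Bool) (f : E → ℝ) (s : Alg2Data E) (k : ℕ) : Prop :=
  if b = true then
    (s.y (k + 1) = s.yt (k + 1) ∨ s.y (k + 1) = s.y k) ∧
      f (s.y (k + 1)) ≤ f (s.yt (k + 1)) ∧ f (s.y (k + 1)) ≤ f (s.y k)
  else
    s.y (k + 1) = ((1 - s.γ (k + 1)) * s.A k / s.A (k + 1)) • s.y k +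
      (s.γ (k + 1) * s.AHat (k + 1) / s.A (k + 1)) • s.yt (k + 1)

/-- `s` records `K` complete iterations of the adaptive method on `f`, with regularizer `ψ` and
exponent `r`, where the proximal oracle is implemented through the regularized Taylor expansion
around `x_k` and returns `ỹ_k`, `v_k = ∇f(ỹ_k)` and `lam_k = baseLam * ‖ỹ_k - x_k‖^(r - q - ν)`. -/
structure IsAlg2Run {E : Type*} [NormedAddCommGroup E] [NormedSpace ℝ E]
    (q : ℕ) (ν L r σ σ' α : ℝ) (b : Bool) (ψ : E → ℝ) (x₀ : E) (f : E → ℝ) (K : ℕ)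
    (s : Alg2Data E) : Prop where
  y_zero : s.y 0 = x₀
  z_zero : s.z 0 = x₀
  A_zero : s.A 0 = 0
  lamHat_one : 0 < K → s.lamHat 1 = s.lam 1
  extrapolate : ∀ k < K, Alg2Extrapolate (stepConst 1 r σ σ') r s k
  yt_succ : ∀ k < K, IsApproxCritical L ν (baseLam q L σ)
    (qOracle q f (s.x (k + 1))) (s.x (k + 1)) (s.yt (k + 1))
  yt_ne : ∀ k < K, s.yt (k + 1) ≠ s.x (k + 1)
  v_succ : ∀ k < K, s.v (k + 1) = fderiv ℝ f (s.yt (k + 1))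
  lam_succ : ∀ k < K, s.lam (k + 1) =
    baseLam q L σ * ‖s.yt (k + 1) - s.x (k + 1)‖ ^ (r - ((q : ℝ) + ν))
  γ_succ : ∀ k < K, s.γ (k + 1) = min (s.lam (k + 1) / s.lamHat (k + 1)) 1
  a_succ : ∀ k < K, s.a (k + 1) = s.γ (k + 1) * s.aHat (k + 1)
  A_succ : ∀ k < K, s.A (k + 1) = s.a (k + 1) + s.A k
  y_succ : ∀ k < K, Alg2YRule b f s k
  z_succ : ∀ k < K, ∀ w,
    (∑ i ∈ Finset.Icc 1 (k + 1), s.a i * s.v i (s.z (k + 1))) + bregman ψ (s.z (k + 1)) x₀ ≤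
      (∑ i ∈ Finset.Icc 1 (k + 1), s.a i * s.v i w) + bregman ψ w x₀
  lamHat_succ : ∀ k < K, s.lamHat (k + 2) =
    if s.lamHat (k + 1) ≤ s.lam (k + 1) then α * s.lamHat (k + 1) else α⁻¹ * s.lamHat (k + 1)

/-- The adaptive method with horizon `T` halts in iteration `N` and returns `out`: either all `T`
iterations are completed and `out = y_T`, or in iteration `N ≤ T` the point `ỹ_N` coincides with
`x_N` (so that `lam_N` would be infinite), and `out = x_N`. -/
def Alg2Halts {E : Type*} [NormedAddCommGroup E] [NormedSpace ℝ E]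
    (q : ℕ) (ν L r σ σ' α : ℝ) (b : Bool) (ψ : E → ℝ) (x₀ : E) (f : E → ℝ) (T N : ℕ)
    (s : Alg2Data E) (out : E) : Prop :=
  (N = T ∧ IsAlg2Run q ν L r σ σ' α b ψ x₀ f T s ∧ out = s.y T) ∨
  (∃ K < T, N = K + 1 ∧ IsAlg2Run q ν L r σ σ' α b ψ x₀ f K s ∧
    Alg2Extrapolate (stepConst 1 r σ σ') r s K ∧
    IsApproxCritical L ν (baseLam q L σ)
      (qOracle q f (s.x (K + 1))) (s.x (K + 1)) (s.yt (K + 1)) ∧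
    s.yt (K + 1) = s.x (K + 1) ∧ out = s.x (K + 1))

/-- In iterations `1, …, N`, the functions `f` and `g` give the same answer to one `q`-th order
query per iteration, at `X k`, and have the same value and gradient at the trial point `Y k`. -/
def SameAnswers {E : Type*} [NormedAddCommGroup E] [NormedSpace ℝ E]
    (q : ℕ) (f g : E → ℝ) (X Y : ℕ → E) (N : ℕ) : Prop :=
  ∀ k < N, qOracle q g (X (k + 1)) = qOracle q f (X (k + 1)) ∧
    g (Y (k + 1)) = f (Y (k + 1)) ∧ fderiv ℝ g (Y (k + 1)) = fderiv ℝ f (Y (k + 1))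

end

/-!
Throughout, `t = q + ν`, `m = max 2 p`, and `L`, `R` are as in the theorem. The norm enters through
two properties only: it is differentiable away from the origin (`PiLp.differentiableAt_norm`), and
the regularizer is uniformly convex with an exponent and a constant that do not depend on the
dimension. Everything between these two facts and the theorem is proved in a normed space with a
smooth norm.

*A Taylor step is an inexact proximal step.* Taylor's theorem applied to the gradient gives
`‖∇f(y) - ∇f_q(y; x)‖ ≤ L / (q - 1)! ‖y - x‖ ^ (t - 1)`, where the symmetry of higher derivatives
identifies the gradient of the Taylor polynomial with the Taylor polynomial of the gradient
(`norm_fderiv_sub_fderiv_taylorModel_le`). A Taylor step makes an error of the same size, so that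
`∇f(y)` differs from the gradient of `-‖· - x‖ ^ t / (t lam)` at `y` by at most a quarter of its
length (`IsApproxCritical.norm_fderiv_add_le`). If the parameter is multiplied by
`‖y - x‖ ^ (m - t)`, the same inequality describes a step with exponent `m`. Taylor steps
exist because the regularized Taylor polynomial is coercive and minimizers are critical points.

*Uniform convexity of the regularizer* (`PiLp.isInexactUniformlyConvex_pReg`). For `p ≥ 2` the
Bregman divergence splits into coordinates, and the inequality is one about `|s| ^ p`. For `p < 2`
the two-point inequality of Ball, Carlen and Lieb passes from numbers to vectors by Minkowski's
inequality, and iterating the resulting midpoint inequality gives the Bregman form.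

*The estimate sequence* (`IsAccelProxRun.bound`). Both methods are instances of one scheme with
tentative weights damped by factors `γ ≤ 1`. The lower models of `f` at the trial points, the
extrapolation rule and Young's inequality give, for a `δ`-inexact uniformly convex regularizer,
`A_T (f(y_T) - f(xs)) + ∑ γ_k Â_k ‖ỹ_k - x_k‖ ^ r / (8 lam_k) ≤ D_ψ(xs, x₀) + (T + 1) δ`.
It remains to bound `A_T` from below.

*Constant parameter, `t ≤ m`.* By Young's inequality the regularizer is inexactly uniformly convex
with exponent `t` and `δ` of order `R ^ m / T` (`IsInexactUniformlyConvex.of_exponent_le`), and the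
step-size rule makes `A ^ (1 / t)` grow linearly (`IsAlg1Run.le_A`).

*Adaptive parameter, `t > m`.* Here `δ = 0`, and the sum above is bounded. Since `lam_k` is a
negative power of `‖ỹ_k - x_k‖`, this reads `∑ γ_k Â_k lam_k ^ (-e) ≤ B` with `e = t / (t - m)`.
Call an iteration good if it is the first one or if the tentative parameter `lamHat` exceeds `lam`.
In a good iteration the `k`-th summand is at least `A_k lamHat_k ^ (-e)`. On the other hand
`A_k ^ (1 / m)` is at least a multiple of `X_k = ∑_{i ≤ k} lamHat_i ^ (1 / m)`: it grows by the
corresponding amount whenever `lamHat` is not an overestimate, and runs of overestimates form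
geometric series (`IsAlg2Run.sumRoot_le`). If at least a quarter of the iterations are good, then
`∑ X_k ^ m lamHat_k ^ (-e)` over the good `k` is bounded, and a reverse Hölder inequality forces
`X_T` to be large (`mul_rpow_le_sum_rpow`). Otherwise `lamHat` increases in most iterations and hence
exponentially, starting from a value bounded below by the contribution of the first iteration
(`IsAlg2Run.lamHat_ge`). If a Taylor step does not move, then the gradient vanishes there, and the
point that is returned is a minimizer.
-/

noncomputable section

/-! ### Powers of a smooth norm, convexity, and minimizers -/

section SmoothNorm

variable {E : Type*} [NormedAddCommGroup E] [NormedSpace ℝ E]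

lemma norm_fderiv_norm_le_one (x : E) : ‖fderiv ℝ (‖·‖) x‖ ≤ 1 :=
  NNReal.coe_one ▸ norm_fderiv_le_of_lipschitz ℝ lipschitzWith_one_norm

lemma fderiv_norm_apply_self (hsm : ∀ x : E, x ≠ 0 → DifferentiableAt ℝ (‖·‖) x) (x : E) :
    fderiv ℝ (‖·‖) x x = ‖x‖ := by
  rcases eq_or_ne x 0 with rfl | hx
  · simp
  · exact (hsm x hx).fderiv_norm_self

/-- The gradient of `‖·‖ ^ r` for `r > 1`. At `0`, where the norm is not differentiable and `fderiv`
takes its default value, the coefficient vanishes. -/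
lemma hasFDerivAt_norm_rpow_of_smooth (hsm : ∀ x : E, x ≠ 0 → DifferentiableAt ℝ (‖·‖) x)
    {r : ℝ} (hr : 1 < r) (x : E) :
    HasFDerivAt (fun w : E => ‖w‖ ^ r) ((r * ‖x‖ ^ (r - 1)) • fderiv ℝ (‖·‖) x) x := by
  rcases eq_or_ne x 0 with rfl | hx
  · have h0 : ((r * ‖(0 : E)‖ ^ (r - 1)) • fderiv ℝ (‖·‖) (0 : E) : E →L[ℝ] ℝ) = 0 := by
      rw [norm_zero, Real.zero_rpow (by linarith)]; simp
    rw [h0]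
    refine HasFDerivAt.of_isLittleO ?_
    simp only [norm_zero, sub_zero]
    rw [Real.zero_rpow (by linarith)]
    simp only [zero_apply, sub_zero]
    rw [Asymptotics.isLittleO_iff]
    intro c hc
    have hcont : Filter.Tendsto (fun w : E => ‖w‖ ^ (r - 1)) (nhds 0) (nhds 0) := by
      have h1 : Continuous (fun w : E => ‖w‖ ^ (r - 1)) :=
        continuous_norm.rpow_const (fun _ => Or.inr (by linarith))
      have h2 := h1.tendsto (0 : E)
      simpa [Real.zero_rpow (by linarith : r - 1 ≠ 0)] using h2
    filter_upwards [hcont.eventually (gt_mem_nhds hc)] with w hw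
    have h3 : ‖w‖ ^ r = ‖w‖ ^ (r - 1) * ‖w‖ := by
      rcases eq_or_ne w 0 with rfl | hw0
      · simp [Real.zero_rpow (by linarith : r ≠ 0)]
      · rw [← Real.rpow_add_one (norm_ne_zero_iff.2 hw0)]; ring_nf
    rw [Real.norm_of_nonneg (by positivity), h3]
    exact mul_le_mul_of_nonneg_right hw.le (norm_nonneg _)
  · have h := (hsm x hx).hasFDerivAt.rpow_const (p := r) (Or.inl (norm_ne_zero_iff.2 hx))
    exact h

lemma hasFDerivAt_norm_sub_rpow_of_smooth (hsm : ∀ x : E, x ≠ 0 → DifferentiableAt ℝ (‖·‖) x)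
    {r : ℝ} (hr : 1 < r) (x₀ x : E) :
    HasFDerivAt (fun w : E => ‖w - x₀‖ ^ r)
      ((r * ‖x - x₀‖ ^ (r - 1)) • fderiv ℝ (‖·‖) (x - x₀)) x := by
  have h := hasFDerivAt_norm_rpow_of_smooth hsm hr (x - x₀)
  have h2 := h.comp x ((hasFDerivAt_id x).sub_const x₀)
  rw [ContinuousLinearMap.comp_id] at h2
  exact h2

/-- The first-order characterization of convexity, at one point. -/
lemma ConvexOn.add_fderiv_le {f : E → ℝ} (hf : ConvexOn ℝ Set.univ f) {y : E}
    (hd : DifferentiableAt ℝ f y) (z : E) : f y + fderiv ℝ f y (z - y) ≤ f z := by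
  let l : ℝ → ℝ := fun t => f (y + t • (z - y))
  have hl : ConvexOn ℝ Set.univ l := by
    refine ⟨convex_univ, fun a _ b _ α β hα hβ hαβ => ?_⟩
    have h := hf.2 (Set.mem_univ (y + a • (z - y))) (Set.mem_univ (y + b • (z - y))) hα hβ hαβ
    have h2 : α • (y + a • (z - y)) + β • (y + b • (z - y)) =
        y + (α • a + β • b) • (z - y) := by
      obtain rfl : β = 1 - α := by linarith
      simp only [smul_eq_mul]
      module
    rw [h2] at h
    exact h
  have hl' : HasDerivAt l (fderiv ℝ f y (z - y)) 0 := by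
    have h1 : HasDerivAt (fun t : ℝ => y + t • (z - y)) (z - y) 0 := by
      simpa using ((hasDerivAt_id (0 : ℝ)).smul_const (z - y)).const_add y
    have h2 : HasFDerivAt f (fderiv ℝ f y) (y + (0 : ℝ) • (z - y)) := by
      simpa using hd.hasFDerivAt
    exact h2.comp_hasDerivAt 0 h1
  have h := hl.le_slope_of_hasDerivAt (Set.mem_univ 0) (Set.mem_univ 1) one_pos hl'
  simp only [slope_def_field, l] at h
  simp at h
  rw [map_sub]
  linarith

/-- A continuous function on a finite-dimensional space attains its minimum if it is bounded below
by a coercive function of the distance to some point. -/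
lemma exists_forall_le_of_tendsto_norm [FiniteDimensional ℝ E] {F : E → ℝ} (hF : Continuous F)
    (x₀ : E) {G : ℝ → ℝ} (hG : Filter.Tendsto G Filter.atTop Filter.atTop)
    (hFG : ∀ x, G ‖x - x₀‖ ≤ F x) : ∃ y, ∀ x, F y ≤ F x := by
  refine hF.exists_forall_le ?_
  refine Filter.tendsto_atTop_mono hFG (hG.comp ?_)
  have h1 : Filter.Tendsto (fun x : E => ‖x‖ - ‖x₀‖) (Filter.cocompact E) Filter.atTop :=
    Filter.tendsto_atTop_add_const_right _ _ (tendsto_norm_cocompact_atTop (E := E))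
  exact Filter.tendsto_atTop_mono (fun x => norm_sub_norm_le x x₀) h1

/-- A power dominates a smaller power. -/
lemma tendsto_mul_rpow_sub_mul_rpow {r t : ℝ} (ht : 0 ≤ t) (htr : t < r) {c : ℝ} (hc : 0 < c)
    (b b' : ℝ) (hb : 0 ≤ b) :
    Filter.Tendsto (fun x : ℝ => c * x ^ r - b * (1 + x) ^ t - b') Filter.atTop Filter.atTop := by
  have h1 : Filter.Tendsto (fun x : ℝ => c * x ^ (r - t) - b * 2 ^ t) Filter.atTop Filter.atTop :=
    Filter.tendsto_atTop_add_const_right _ _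
      ((tendsto_rpow_atTop (by linarith)).const_mul_atTop hc)
  have h2 : Filter.Tendsto (fun x : ℝ => (c * x ^ (r - t) - b * 2 ^ t) - b')
      Filter.atTop Filter.atTop := Filter.tendsto_atTop_add_const_right _ _ h1
  refine Filter.tendsto_atTop_mono' _ ?_ h2
  filter_upwards [Filter.eventually_ge_atTop 1, h1.eventually_ge_atTop 0] with x hx hx2
  have hx0 : 0 < x := by linarith
  have e1 : x ^ r = x ^ (r - t) * x ^ t := by rw [← Real.rpow_add hx0]; ring_nf
  have e2 : (1 + x) ^ t ≤ 2 ^ t * x ^ t := by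
    rw [← Real.mul_rpow (by norm_num) hx0.le]
    exact Real.rpow_le_rpow (by linarith) (by linarith) ht
  have e3 : 1 ≤ x ^ t := Real.one_le_rpow hx ht
  have e4 : b * (1 + x) ^ t ≤ b * (2 ^ t * x ^ t) := mul_le_mul_of_nonneg_left e2 hb
  rw [e1]
  nlinarith [mul_le_mul_of_nonneg_left e3 hx2]

end SmoothNorm

/-! ### Taylor expansion of the gradient -/

section Taylor

/-- Taylor's formula along a line: `φ i` is the `i`-th derivative of `φ 0`, and the last one varies
by at most `K`. -/
lemma norm_sub_taylor_le_of_hasDerivAt {G : Type*} [NormedAddCommGroup G] [NormedSpace ℝ G]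
    {K : ℝ} (n : ℕ) :
    ∀ φ : ℕ → ℝ → G, (∀ i < n, ∀ t, HasDerivAt (φ i) (φ (i + 1) t) t) →
      (∀ t ∈ Set.Icc (0 : ℝ) 1, ‖φ n t - φ n 0‖ ≤ K) →
      ∀ t ∈ Set.Icc (0 : ℝ) 1,
        ‖φ 0 t - ∑ i ∈ Finset.range (n + 1), (t ^ i / (i.factorial : ℝ)) • φ i 0‖ ≤
          K * (t ^ n / (n.factorial : ℝ)) := by
  have hpow : ∀ (i : ℕ) (t : ℝ), HasDerivAt (fun t : ℝ => t ^ (i + 1) / ((i + 1).factorial : ℝ))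
      (t ^ i / (i.factorial : ℝ)) t := by
    intro i t
    have h := (hasDerivAt_pow (i + 1) t).div_const ((i + 1).factorial : ℝ)
    refine h.congr_deriv ?_
    rw [Nat.factorial_succ]
    push_cast
    have : (i.factorial : ℝ) ≠ 0 := by positivity
    field_simp
  induction n with
  | zero =>
    intro φ _ hK t ht
    simpa using hK t ht
  | succ n ih =>
    intro φ hφ hK t ht
    have h1 := ih (fun i => φ (i + 1)) (fun i hi t => hφ (i + 1) (by omega) t) hK
    have hd : ∀ t, HasDerivAt
        (fun t => φ 0 t - ∑ i ∈ Finset.range (n + 1 + 1), (t ^ i / (i.factorial : ℝ)) • φ i 0)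
        (φ 1 t - ∑ i ∈ Finset.range (n + 1), (t ^ i / (i.factorial : ℝ)) • φ (i + 1) 0) t := by
      intro t
      refine (hφ 0 (by omega) t).sub ?_
      simp_rw [Finset.sum_range_succ' _ (n + 1)]
      simp only [pow_zero, Nat.factorial_zero, Nat.cast_one, div_one, one_smul]
      refine HasDerivAt.add_const _ ?_
      exact HasDerivAt.fun_sum fun i _ => (hpow i t).smul_const _
    refine image_norm_le_of_norm_deriv_right_le_deriv_boundary
      (f := fun t => φ 0 t - ∑ i ∈ Finset.range (n + 1 + 1), (t ^ i / (i.factorial : ℝ)) • φ i 0)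
      (fun t _ => (hd t).continuousAt.continuousWithinAt)
      (fun t _ => (hd t).hasDerivWithinAt) ?_ (fun t => (hpow n t).const_mul K)
      (fun t ht => h1 t ⟨ht.1, ht.2.le⟩) ht
    simp [Finset.sum_range_succ' _ (n + 1)]

variable {E G : Type} [NormedAddCommGroup E] [NormedSpace ℝ E]
  [NormedAddCommGroup G] [NormedSpace ℝ G]

/-- Taylor's theorem with a Hölder continuous last derivative. -/
lemma norm_sub_sum_iteratedFDeriv_le {F : E → G} {n : ℕ} (hF : ContDiff ℝ n F) {L ν : ℝ}
    (hL : 0 ≤ L) (hν : 0 < ν) (x : E)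
    (hH : ∀ y, ‖iteratedFDeriv ℝ n F y - iteratedFDeriv ℝ n F x‖ ≤ L * ‖y - x‖ ^ ν) (y : E) :
    ‖F y - ∑ i ∈ Finset.range (n + 1),
        (1 / (i.factorial : ℝ)) • iteratedFDeriv ℝ i F x (fun _ => y - x)‖ ≤
      L / (n.factorial : ℝ) * ‖y - x‖ ^ ((n : ℝ) + ν) := by
  set h := y - x with hh
  let φ : ℕ → ℝ → G := fun i t => iteratedFDeriv ℝ i F (x + t • h) (fun _ => h)
  have hφ : ∀ i < n, ∀ t, HasDerivAt (φ i) (φ (i + 1) t) t := by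
    intro i hi t
    have h1 : HasDerivAt (fun t : ℝ => x + t • h) h t := by
      simpa using ((hasDerivAt_id t).smul_const h).const_add x
    have h2 := ((hF.differentiable_iteratedFDeriv (m := i) (by exact_mod_cast hi))
      (x + t • h)).hasFDerivAt
    have h3 := h2.comp_hasDerivAt t h1
    exact ((ContinuousMultilinearMap.apply ℝ (fun _ : Fin i => E) G
      (fun _ => h)).hasFDerivAt.comp_hasDerivAt t h3)
  have hK : ∀ t ∈ Set.Icc (0 : ℝ) 1, ‖φ n t - φ n 0‖ ≤ L * ‖h‖ ^ ((n : ℝ) + ν) := by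
    intro t ht
    have h1 : φ n t - φ n 0 =
        (iteratedFDeriv ℝ n F (x + t • h) - iteratedFDeriv ℝ n F x) (fun _ => h) := by
      simp [φ]
    rw [h1]
    refine (ContinuousMultilinearMap.le_opNorm _ _).trans ?_
    have h2 : ‖(x + t • h) - x‖ ^ ν ≤ ‖h‖ ^ ν := by
      rw [add_sub_cancel_left, norm_smul, Real.norm_of_nonneg ht.1]
      exact Real.rpow_le_rpow (mul_nonneg ht.1 (norm_nonneg _))
        (mul_le_of_le_one_left (norm_nonneg _) ht.2) hν.le
    have h3 : ‖h‖ ^ ((n : ℝ) + ν) = ‖h‖ ^ ν * ‖h‖ ^ n := by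
      rw [← Real.rpow_natCast, ← Real.rpow_add_of_nonneg (norm_nonneg _) hν.le (by positivity),
        add_comm]
    rw [h3, ← mul_assoc]
    simp only [Finset.prod_const, Finset.card_univ, Fintype.card_fin]
    gcongr
    exact (hH _).trans (mul_le_mul_of_nonneg_left h2 hL)
  have := norm_sub_taylor_le_of_hasDerivAt n φ hφ hK 1 (by simp)
  simp only [φ, one_smul, zero_smul, add_zero, one_pow] at this
  rw [hh] at this ⊢
  rw [add_sub_cancel] at this
  refine this.trans (le_of_eq ?_)
  ring

/-- A form of the symmetry of higher derivatives: a single vector may be moved to the last slot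
when all the others are equal. -/
lemma iteratedFDeriv_update_const (n : ℕ) :
    ∀ {G : Type} [NormedAddCommGroup G] [NormedSpace ℝ G] {f : E → G},
      ContDiff ℝ (n + 1 : ℕ) f → ∀ (x h u : E) (j : Fin (n + 1)),
      iteratedFDeriv ℝ (n + 1) f x (Function.update (fun _ => h) j u) =
        iteratedFDeriv ℝ n (fderiv ℝ f) x (fun _ => h) u := by
  induction n with
  | zero =>
    intro G _ _ f hf x h u j
    obtain rfl : j = Fin.last 0 := Subsingleton.elim (α := Fin 1) _ _
    rw [iteratedFDeriv_succ_apply_right, Fin.init_update_last, Function.update_self]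
    rfl
  | succ n ih =>
    intro G _ _ f hf x h u j
    have hf1 : ContDiff ℝ (n + 1 : ℕ) (fderiv ℝ f) := hf.fderiv_right (by norm_cast)
    have hf2 : ContDiff ℝ n (fderiv ℝ (fderiv ℝ f)) := hf1.fderiv_right (by norm_cast)
    rw [iteratedFDeriv_succ_apply_right]
    induction j using Fin.lastCases with
    | last =>
      rw [Fin.init_update_last, Function.update_self]
      rfl
    | cast i =>
      rw [Fin.init_update_castSucc, Function.update_of_ne (Fin.castSucc_lt_last i).ne']
      have e1 : (Fin.init (fun _ : Fin (n + 2) => h) : Fin (n + 1) → E) = fun _ => h := rfl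
      rw [e1, ih hf1, iteratedFDeriv_succ_apply_right]
      have e2 : fderiv ℝ (fderiv ℝ f) = fun y =>
          (ContinuousLinearMap.flipₗᵢ ℝ E E G) (fderiv ℝ (fderiv ℝ f) y) := by
        funext y
        ext v w
        have hsymm : IsSymmSndFDerivAt ℝ f y :=
          (hf.contDiffAt).isSymmSndFDerivAt (by
            rw [minSmoothness_of_isRCLikeNormedField]
            exact_mod_cast (by omega : 2 ≤ n + 1 + 1))
        exact hsymm v w
      have e3 := ContinuousLinearMap.iteratedFDeriv_comp_left (𝕜 := ℝ)
        (F := E →L[ℝ] E →L[ℝ] G) (G := E →L[ℝ] E →L[ℝ] G)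
        ((ContinuousLinearMap.flipₗᵢ ℝ E E G).toContinuousLinearEquiv :
          (E →L[ℝ] E →L[ℝ] G) →L[ℝ] (E →L[ℝ] E →L[ℝ] G))
        (hf2.contDiffAt (x := x)) (le_refl _)
      have e4 : iteratedFDeriv ℝ n (fderiv ℝ (fderiv ℝ f)) x (fun _ => h) =
          ContinuousLinearMap.flip
            (iteratedFDeriv ℝ n (fderiv ℝ (fderiv ℝ f)) x (fun _ => h)) := by
        conv_lhs => rw [e2]
        exact congrArg (fun M : ContinuousMultilinearMap ℝ (fun _ : Fin n => E) _ =>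
          M (fun _ => h)) e3
      exact congrArg (fun M : E →L[ℝ] E →L[ℝ] G => M u h) e4

variable {f : E → ℝ}

lemma taylorModel_qOracle (q : ℕ) (f : E → ℝ) (x y : E) :
    taylorModel (qOracle q f x) x y = ∑ i ∈ Finset.range (q + 1),
      (1 / (i.factorial : ℝ)) * iteratedFDeriv ℝ i f x (fun _ => y - x) :=
  Fin.sum_univ_eq_sum_range
    (fun i => (1 / (i.factorial : ℝ)) * iteratedFDeriv ℝ i f x (fun _ => y - x)) (q + 1)

/-- The gradient of the Taylor polynomial of `f` is the Taylor polynomial of the gradient. -/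
lemma hasFDerivAt_taylorModel {n : ℕ} (hf : ContDiff ℝ (n + 1 : ℕ) f) (x y : E) :
    HasFDerivAt (taylorModel (qOracle (n + 1) f x) x)
      (∑ i ∈ Finset.range (n + 1),
        (1 / (i.factorial : ℝ)) • iteratedFDeriv ℝ i (fderiv ℝ f) x (fun _ => y - x)) y := by
  have e : taylorModel (qOracle (n + 1) f x) x = fun y => ∑ i ∈ Finset.range (n + 1 + 1),
      (1 / (i.factorial : ℝ)) * iteratedFDeriv ℝ i f x (fun _ => y - x) :=
    funext fun y => taylorModel_qOracle (n + 1) f x y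
  rw [e]
  simp_rw [Finset.sum_range_succ' _ (n + 1)]
  simp only [Nat.factorial_zero, iteratedFDeriv_zero_apply]
  refine HasFDerivAt.add_const _ (HasFDerivAt.fun_sum fun i hi => ?_)
  have h1 : ∀ _ : Fin (i + 1), HasFDerivAt (fun y : E => y - x) (ContinuousLinearMap.id ℝ E) y :=
    fun _ => (hasFDerivAt_id y).sub_const x
  have h2 := (HasFDerivAt.multilinear_comp (iteratedFDeriv ℝ (i + 1) f x) h1).const_mul
    (1 / ((i + 1).factorial : ℝ))
  refine h2.congr_fderiv ?_
  ext u
  have hi' : i + 1 ≤ n + 1 := by have := Finset.mem_range.1 hi; omega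
  have h3 : ∀ j : Fin (i + 1),
      (iteratedFDeriv ℝ (i + 1) f x).toContinuousLinearMap (fun _ => y - x) j u =
      iteratedFDeriv ℝ i (fderiv ℝ f) x (fun _ => y - x) u := fun j =>
    iteratedFDeriv_update_const i (hf.of_le (by exact_mod_cast hi')) x (y - x) u j
  simp only [ContinuousLinearMap.comp_id, smul_apply, sum_apply, h3, Finset.sum_const,
    Finset.card_univ, Fintype.card_fin, smul_eq_mul, nsmul_eq_mul]
  rw [Nat.factorial_succ]
  push_cast
  have : (i.factorial : ℝ) ≠ 0 := by positivity
  field_simp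

/-- The Taylor polynomial approximates the gradient to order `q + ν - 1`. -/
lemma norm_fderiv_sub_fderiv_taylorModel_le {q : ℕ} (hq : 1 ≤ q) (hf : ContDiff ℝ q f) {L ν : ℝ}
    (hL : 0 ≤ L) (hν : 0 < ν)
    (hH : ∀ x y, ‖iteratedFDeriv ℝ q f x - iteratedFDeriv ℝ q f y‖ ≤ L * ‖x - y‖ ^ ν) (x y : E) :
    ∃ g : E →L[ℝ] ℝ, HasFDerivAt (taylorModel (qOracle q f x) x) g y ∧
      ‖fderiv ℝ f y - g‖ ≤ L / ((q - 1).factorial : ℝ) * ‖y - x‖ ^ ((q : ℝ) + ν - 1) := by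
  obtain ⟨n, rfl⟩ : ∃ n, q = n + 1 := ⟨q - 1, by omega⟩
  refine ⟨_, hasFDerivAt_taylorModel hf x y, ?_⟩
  have hf1 : ContDiff ℝ n (fderiv ℝ f) := hf.fderiv_right (by norm_cast)
  have hiso : ∀ y, ‖iteratedFDeriv ℝ n (fderiv ℝ f) y - iteratedFDeriv ℝ n (fderiv ℝ f) x‖ =
      ‖iteratedFDeriv ℝ (n + 1) f y - iteratedFDeriv ℝ (n + 1) f x‖ := by
    intro y
    simp only [iteratedFDeriv_succ_eq_comp_right, Function.comp_apply]
    rw [← dist_eq_norm, ← dist_eq_norm]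
    exact ((continuousMultilinearCurryRightEquiv' ℝ n E ℝ).symm.dist_map _ _).symm
  have h := norm_sub_sum_iteratedFDeriv_le hf1 hL hν x (fun y => (hiso y).trans_le (hH y x)) y
  have e : ((n + 1 : ℕ) : ℝ) + ν - 1 = (n : ℝ) + ν := by push_cast; ring
  rw [e]
  exact h

end Taylor

/-! ### Scalar inequalities behind uniform convexity of the p-norm -/

section Scalar

lemma rpow_add_le_two_rpow_mul {a b t : ℝ} (ha : 0 ≤ a) (hb : 0 ≤ b) (ht : 1 ≤ t) :
    (a + b) ^ t ≤ 2 ^ (t - 1) * (a ^ t + b ^ t) := by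
  lift a to NNReal using ha
  lift b to NNReal using hb
  exact_mod_cast NNReal.rpow_add_le_mul_rpow_add_rpow a b ht

lemma abs_rpow_sub_two_mul_self {p : ℝ} (hp : 2 ≤ p) {x : ℝ} (hx : 0 ≤ x) :
    |x| ^ (p - 2) * x = x ^ (p - 1) := by
  rw [abs_of_nonneg hx]
  rcases hx.eq_or_lt with rfl | hx
  · rw [mul_zero, Real.zero_rpow (by linarith)]
  · rw [← Real.rpow_add_one hx.ne']; ring_nf

/-- Strong monotonicity of the derivative of `|x| ^ p / p` for `p ≥ 2`. -/
lemma two_rpow_mul_le_abs_rpow_sub {p : ℝ} (hp : 2 ≤ p) {s t : ℝ} (hts : t ≤ s) :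
    2 ^ (2 - p) * (s - t) ^ (p - 1) ≤ |s| ^ (p - 2) * s - |t| ^ (p - 2) * t := by
  have h2 : (2 : ℝ) ^ (2 - p) ≤ 1 :=
    Real.rpow_le_one_of_one_le_of_nonpos (by norm_num) (by linarith)
  have hst : 0 ≤ (s - t) ^ (p - 1) := Real.rpow_nonneg (by linarith) _
  have hneg : ∀ x : ℝ, |x| ^ (p - 2) * x = -(|-x| ^ (p - 2) * (-x)) := by
    intro x; rw [abs_neg]; ring
  rcases le_total 0 t with h0 | h0
  · rw [abs_rpow_sub_two_mul_self hp h0, abs_rpow_sub_two_mul_self hp (h0.trans hts)]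
    have := Real.add_rpow_le_rpow_add h0 (sub_nonneg.2 hts) (by linarith : 1 ≤ p - 1)
    rw [add_sub_cancel] at this
    nlinarith
  · rcases le_total 0 s with h1 | h1
    · rw [hneg t, abs_rpow_sub_two_mul_self hp h1,
        abs_rpow_sub_two_mul_self hp (neg_nonneg.2 h0), sub_neg_eq_add]
      have := rpow_add_le_two_rpow_mul h1 (neg_nonneg.2 h0) (by linarith : 1 ≤ p - 1)
      rw [← sub_eq_add_neg] at this
      calc (2 : ℝ) ^ (2 - p) * (s - t) ^ (p - 1)
          ≤ 2 ^ (2 - p) * (2 ^ (p - 1 - 1) * (s ^ (p - 1) + (-t) ^ (p - 1))) := by gcongr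
        _ = 2 ^ ((2 - p) + (p - 1 - 1)) * (s ^ (p - 1) + (-t) ^ (p - 1)) := by
            rw [Real.rpow_add (by norm_num)]; ring
        _ = _ := by
            rw [show (2 - p) + (p - 1 - 1) = 0 by ring, Real.rpow_zero, one_mul]
    · rw [hneg t, hneg s, abs_rpow_sub_two_mul_self hp (neg_nonneg.2 h1),
        abs_rpow_sub_two_mul_self hp (neg_nonneg.2 h0)]
      have := Real.add_rpow_le_rpow_add (neg_nonneg.2 h1) (sub_nonneg.2 hts)
        (by linarith : 1 ≤ p - 1)
      rw [show -s + (s - t) = -t by ring] at this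
      nlinarith

/-- Uniform convexity of `|x| ^ p` on the line for `p ≥ 2`. -/
lemma abs_rpow_bregman {p : ℝ} (hp : 2 ≤ p) (s t : ℝ) :
    |t| ^ p + p * |t| ^ (p - 2) * t * (s - t) + 2 ^ (2 - p) * |s - t| ^ p ≤ |s| ^ p := by
  wlog hts : t ≤ s generalizing s t with H
  · have := H (-s) (-t) (by linarith)
    rw [abs_neg, abs_neg, show -s - -t = -(s - t) by ring, abs_neg] at this
    linarith
  let G : ℝ → ℝ := fun s =>
    |s| ^ p - p * |t| ^ (p - 2) * t * (s - t) - 2 ^ (2 - p) * |s - t| ^ p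
  have hG : ∀ s, HasDerivAt G (p * |s| ^ (p - 2) * s - p * |t| ^ (p - 2) * t
      - 2 ^ (2 - p) * (p * |s - t| ^ (p - 2) * (s - t))) s := by
    intro s
    have h1 := hasDerivAt_abs_rpow s (by linarith : 1 < p)
    have h2 := ((hasDerivAt_id s).sub_const t).const_mul (p * |t| ^ (p - 2) * t)
    have h3 := (HasDerivAt.comp_sub_const s t
      (hasDerivAt_abs_rpow (s - t) (by linarith : 1 < p))).const_mul ((2 : ℝ) ^ (2 - p))
    exact ((h1.sub h2).sub h3).congr_deriv (by simp)
  have hmono : MonotoneOn G (Set.Ici t) := by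
    refine monotoneOn_of_deriv_nonneg (convex_Ici t)
      (fun s _ => (hG s).continuousAt.continuousWithinAt)
      (fun s _ => (hG s).differentiableAt.differentiableWithinAt) ?_
    intro s hs
    rw [interior_Ici] at hs
    have hs' : t ≤ s := le_of_lt hs
    rw [(hG s).deriv]
    have h1 := two_rpow_mul_le_abs_rpow_sub hp hs'
    have h2 := abs_rpow_sub_two_mul_self hp (sub_nonneg.2 hs')
    rw [← h2] at h1
    nlinarith
  have := hmono (Set.mem_Ici.2 le_rfl) (Set.mem_Ici.2 hts) hts
  simp only [G, sub_self, abs_zero, mul_zero, sub_zero] at this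
  rw [Real.zero_rpow (by linarith)] at this
  linarith

lemma two_le_rpow_add_rpow {c s : ℝ} (hc : c ≤ 0) (h0 : 0 ≤ s) (h1 : s < 1) :
    2 ≤ (1 + s) ^ c + (1 - s) ^ c := by
  have hu : 0 < 1 + s := by linarith
  have hv : 0 < 1 - s := by linarith
  rw [Real.rpow_def_of_pos hu, Real.rpow_def_of_pos hv]
  have e1 := Real.add_one_le_exp (Real.log (1 + s) * c)
  have e2 := Real.add_one_le_exp (Real.log (1 - s) * c)
  have e3 : Real.log (1 + s) + Real.log (1 - s) ≤ 0 := by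
    rw [← Real.log_mul hu.ne' hv.ne']
    exact Real.log_nonpos (by positivity) (by nlinarith)
  nlinarith

/-- The two-point inequality for `1` and `s`, with `(1 + (p - 1) s ^ 2) ^ (p / 2)` replaced by its
upper bound from the concavity of `x ^ (p / 2)`. -/
lemma two_point_aux {p s : ℝ} (hp1 : 1 < p) (hp2 : p ≤ 2) (h0 : 0 ≤ s) (h1 : s ≤ 1) :
    2 + p * (p - 1) * s ^ 2 ≤ (1 + s) ^ p + (1 - s) ^ p := by
  have hder : ∀ t : ℝ, 1 ≤ t → ∀ s, HasDerivAt (fun s : ℝ => (1 + s) ^ t)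
      (t * (1 + s) ^ (t - 1)) s := by
    intro t ht s
    have := (((hasDerivAt_id s).const_add 1).rpow_const (p := t) (Or.inr ht))
    simpa using this
  have hder' : ∀ t : ℝ, 1 ≤ t → ∀ s, HasDerivAt (fun s : ℝ => (1 - s) ^ t)
      (-(t * (1 - s) ^ (t - 1))) s := by
    intro t ht s
    have := (((hasDerivAt_id s).const_sub 1).rpow_const (p := t) (Or.inr ht))
    simpa using this
  -- the derivative, up to the factor `p`
  have key : ∀ s ∈ Set.Icc (0 : ℝ) 1,
      0 ≤ (1 + s) ^ (p - 1) - (1 - s) ^ (p - 1) - 2 * (p - 1) * s := by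
    intro s hs
    let G : ℝ → ℝ := fun s => (1 + s) ^ (p - 1) - (1 - s) ^ (p - 1) - 2 * (p - 1) * s
    have hmono : MonotoneOn G (Set.Icc 0 1) := by
      have hG : ∀ s ∈ interior (Set.Icc (0 : ℝ) 1), HasDerivAt G
          ((p - 1) * ((1 + s) ^ (p - 2) + (1 - s) ^ (p - 2) - 2)) s := by
        intro s hs
        rw [interior_Icc] at hs
        have e1 := (((hasDerivAt_id s).const_add 1).rpow_const (p := p - 1)
          (Or.inl (by simp only [id]; linarith [hs.1])))
        have e2 := (((hasDerivAt_id s).const_sub 1).rpow_const (p := p - 1)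
          (Or.inl (by simp only [id]; linarith [hs.2])))
        have e3 := (hasDerivAt_id s).const_mul (2 * (p - 1))
        refine ((e1.sub e2).sub e3).congr_deriv ?_
        simp only [id]
        rw [show p - 1 - 1 = p - 2 by ring]
        ring
      refine monotoneOn_of_deriv_nonneg (convex_Icc 0 1) ?_
        (fun s hs => (hG s hs).differentiableAt.differentiableWithinAt) ?_
      · have : Continuous G := by
          have c1 : Continuous fun s : ℝ => (1 + s) ^ (p - 1) :=
            (continuous_const.add continuous_id).rpow_const fun _ => Or.inr (by linarith)
          have c2 : Continuous fun s : ℝ => (1 - s) ^ (p - 1) :=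
            (continuous_const.sub continuous_id).rpow_const fun _ => Or.inr (by linarith)
          exact (c1.sub c2).sub (continuous_const.mul continuous_id)
        exact this.continuousOn
      · intro s hs
        rw [(hG s hs).deriv]
        rw [interior_Icc] at hs
        have := two_le_rpow_add_rpow (c := p - 2) (by linarith) hs.1.le hs.2
        exact mul_nonneg (by linarith) (by linarith)
    have := hmono (Set.left_mem_Icc.2 zero_le_one) hs hs.1
    simpa [G] using this
  let H : ℝ → ℝ := fun s => (1 + s) ^ p + (1 - s) ^ p - p * (p - 1) * s ^ 2
  have hH : ∀ s, HasDerivAt H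
      (p * ((1 + s) ^ (p - 1) - (1 - s) ^ (p - 1) - 2 * (p - 1) * s)) s := by
    intro s
    have e3 := (hasDerivAt_pow 2 s).const_mul (p * (p - 1))
    refine (((hder p hp1.le s).add (hder' p hp1.le s)).sub e3).congr_deriv ?_
    simp only [Nat.cast_ofNat, Nat.add_one_sub_one, pow_one]
    ring
  have hmono : MonotoneOn H (Set.Icc 0 1) := by
    refine monotoneOn_of_deriv_nonneg (convex_Icc 0 1)
      (fun s _ => (hH s).continuousAt.continuousWithinAt)
      (fun s _ => (hH s).differentiableAt.differentiableWithinAt) ?_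
    intro s hs
    rw [(hH s).deriv]
    exact mul_nonneg (by linarith) (key s (interior_subset hs))
  have := hmono (Set.left_mem_Icc.2 zero_le_one) ⟨h0, h1⟩ h0
  simp only [H, add_zero, sub_zero, Real.one_rpow] at this
  norm_num at this
  linarith

/-- The two-point inequality of Ball, Carlen and Lieb. -/
lemma two_point_inequality {p : ℝ} (hp1 : 1 < p) (hp2 : p ≤ 2) (a b : ℝ) :
    (a ^ 2 + (p - 1) * b ^ 2) ^ (p / 2) ≤ (|a + b| ^ p + |a - b| ^ p) / 2 := by
  have main : ∀ a b : ℝ, 0 < a → |b| ≤ a →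
      (a ^ 2 + (p - 1) * b ^ 2) ^ (p / 2) ≤ (|a + b| ^ p + |a - b| ^ p) / 2 := by
    intro a b ha hb
    wlog hb0 : 0 ≤ b generalizing b with H
    · have := H (-b) (by rwa [abs_neg]) (by linarith)
      rw [neg_sq, sub_neg_eq_add, ← sub_eq_add_neg] at this
      linarith
    rw [abs_of_nonneg hb0] at hb
    obtain ⟨s, rfl⟩ : ∃ s, b = a * s := ⟨b / a, by field_simp⟩
    have hs0 : 0 ≤ s := nonneg_of_mul_nonneg_right hb0 ha
    have hs1 : s ≤ 1 := by
      by_contra h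
      push Not at h
      nlinarith
    have e1 : a ^ 2 + (p - 1) * (a * s) ^ 2 = a ^ 2 * (1 + (p - 1) * s ^ 2) := by ring
    have e2 : |a + a * s| = a * (1 + s) := by
      rw [abs_of_nonneg (by nlinarith)]; ring
    have e3 : |a - a * s| = a * (1 - s) := by
      rw [abs_of_nonneg (by nlinarith)]; ring
    have e4 : (a ^ 2) ^ (p / 2) = a ^ p := by
      rw [← Real.rpow_natCast, ← Real.rpow_mul ha.le]
      congr 1
      push_cast
      ring
    have hps : 0 ≤ (p - 1) * s ^ 2 := mul_nonneg (by linarith) (by positivity)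
    rw [e1, e2, e3, Real.mul_rpow (by positivity) (by linarith), e4,
      Real.mul_rpow ha.le (by linarith), Real.mul_rpow ha.le (by linarith)]
    have e5 := rpow_one_add_le_one_add_mul_self (s := (p - 1) * s ^ 2) (by linarith)
      (p := p / 2) (by linarith) (by linarith)
    have e6 := two_point_aux hp1 hp2 hs0 hs1
    have hap : 0 ≤ a ^ p := Real.rpow_nonneg ha.le _
    nlinarith
  have main2 : ∀ a b : ℝ, |b| ≤ |a| →
      (a ^ 2 + (p - 1) * b ^ 2) ^ (p / 2) ≤ (|a + b| ^ p + |a - b| ^ p) / 2 := by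
    intro a b hab
    rcases lt_trichotomy a 0 with h | rfl | h
    · have := main (-a) b (by linarith) (by rwa [abs_of_neg h] at hab)
      rw [neg_sq, show -a + b = -(a - b) by ring, show -a - b = -(a + b) by ring, abs_neg,
        abs_neg] at this
      linarith
    · obtain rfl : b = 0 := by simpa using hab
      simp [Real.zero_rpow (by linarith : p / 2 ≠ 0)]
      positivity
    · exact main a b h (by rwa [abs_of_pos h] at hab)
  rcases le_total |b| |a| with h | h
  · exact main2 a b h
  · have h1 := main2 b a h
    rw [add_comm b a, abs_sub_comm b a] at h1
    refine le_trans (Real.rpow_le_rpow ?_ ?_ (by linarith)) h1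
    · have := sq_nonneg a
      have := sq_nonneg b
      nlinarith
    · have := sq_le_sq.2 h
      nlinarith

end Scalar

/-! ### The p-norm and its regularizer -/

/-- Iterating the midpoint inequality towards `y` and passing to the limit bounds the derivative
at `y`. -/
lemma add_fderiv_le_of_midpoint {E : Type*} [NormedAddCommGroup E] [NormedSpace ℝ E]
    {Φ : E → ℝ} {κ : ℝ}
    (hmid : ∀ x y, Φ ((1 / 2 : ℝ) • (x + y)) ≤ (Φ x + Φ y) / 2 - κ / 4 * ‖x - y‖ ^ 2)
    {x y : E} (hd : DifferentiableAt ℝ Φ y) :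
    Φ y + fderiv ℝ Φ y (x - y) + κ * ‖x - y‖ ^ 2 ≤ Φ x := by
  set h := x - y with hh
  have step : ∀ n : ℕ, ((1 / 2 : ℝ) ^ n)⁻¹ * (Φ (y + (1 / 2 : ℝ) ^ n • h) - Φ y) ≤
      Φ (y + h) - Φ y - κ * ‖h‖ ^ 2 * (1 - (1 / 2 : ℝ) ^ n) := by
    intro n
    induction n with
    | zero => simp
    | succ n ih =>
      have hpos : (0 : ℝ) < (1 / 2) ^ n := by positivity
      set t : ℝ := (1 / 2) ^ n with ht
      have e := hmid (y + t • h) y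
      have e1 : (1 / 2 : ℝ) • (y + t • h + y) = y + (t * (1 / 2)) • h := by module
      rw [e1, add_sub_cancel_left, norm_smul, Real.norm_of_nonneg hpos.le] at e
      rw [pow_succ, ← ht]
      have e2 : (t * (1 / 2))⁻¹ * (Φ (y + (t * (1 / 2)) • h) - Φ y) ≤
          t⁻¹ * (Φ (y + t • h) - Φ y) - κ * ‖h‖ ^ 2 * t / 2 := by
        rw [mul_inv, mul_assoc, ← sub_nonneg]
        have : t⁻¹ * (Φ (y + t • h) - Φ y) - κ * ‖h‖ ^ 2 * t / 2 -
            t⁻¹ * ((1 / 2)⁻¹ * (Φ (y + (t * (1 / 2)) • h) - Φ y)) =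
            2 * t⁻¹ * ((Φ (y + t • h) + Φ y) / 2 - κ / 4 * (t * ‖h‖) ^ 2 -
              Φ (y + (t * (1 / 2)) • h)) := by
          field_simp
          ring
        rw [this]
        exact mul_nonneg (by positivity) (by linarith)
      linarith
  have hline : HasDerivAt (fun t : ℝ => Φ (y + t • h)) (fderiv ℝ Φ y h) 0 := by
    have h1 : HasDerivAt (fun t : ℝ => y + t • h) h 0 := by
      simpa using ((hasDerivAt_id (0 : ℝ)).smul_const h).const_add y
    have h2 : HasFDerivAt Φ (fderiv ℝ Φ y) (y + (0 : ℝ) • h) := by simpa using hd.hasFDerivAt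
    exact h2.comp_hasDerivAt 0 h1
  have hlim0 : Filter.Tendsto (fun n : ℕ => (1 / 2 : ℝ) ^ n) Filter.atTop (nhds 0) :=
    tendsto_pow_atTop_nhds_zero_of_lt_one (by norm_num) (by norm_num)
  have hlim : Filter.Tendsto
      (fun n : ℕ => ((1 / 2 : ℝ) ^ n)⁻¹ * (Φ (y + (1 / 2 : ℝ) ^ n • h) - Φ y))
      Filter.atTop (nhds (fderiv ℝ Φ y h)) := by
    have h1 := hline.tendsto_slope_zero
    have h2 : Filter.Tendsto (fun n : ℕ => (1 / 2 : ℝ) ^ n) Filter.atTop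
        (nhdsWithin 0 {0}ᶜ) :=
      tendsto_nhdsWithin_iff.2 ⟨hlim0, Filter.Eventually.of_forall fun n => by simp⟩
    have h3 := h1.comp h2
    simpa [Function.comp_def] using h3
  have hlim2 : Filter.Tendsto
      (fun n : ℕ => Φ (y + h) - Φ y - κ * ‖h‖ ^ 2 * (1 - (1 / 2 : ℝ) ^ n)) Filter.atTop
      (nhds (Φ (y + h) - Φ y - κ * ‖h‖ ^ 2 * (1 - 0))) :=
    ((hlim0.const_sub 1).const_mul _).const_sub _
  have := le_of_tendsto_of_tendsto' hlim hlim2 step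
  rw [hh, add_sub_cancel] at this
  rw [hh]
  linarith

lemma PiLp.norm_rpow_eq_sum {p : ℝ≥0∞} {d : ℕ} (hp : 0 < p.toReal)
    (x : PiLp p (fun _ : Fin d => ℝ)) :
    ‖x‖ ^ p.toReal = ∑ i, |x i| ^ p.toReal := by
  rw [PiLp.norm_eq_sum hp, ← Real.rpow_mul (Finset.sum_nonneg fun i _ => by positivity),
    one_div_mul_cancel hp.ne', Real.rpow_one]
  simp

section PNorm

variable {p : ℝ≥0∞} [Fact (1 ≤ p)] {d : ℕ}

lemma PiLp.hasFDerivAt_sum_abs_rpow (hp : 1 < p.toReal) (x : PiLp p (fun _ : Fin d => ℝ)) :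
    HasFDerivAt (fun x : PiLp p (fun _ : Fin d => ℝ) => ∑ i, |x i| ^ p.toReal)
      (∑ i, (p.toReal * |x i| ^ (p.toReal - 2) * x i) •
        (PiLp.proj p (fun _ : Fin d => ℝ) i : PiLp p (fun _ : Fin d => ℝ) →L[ℝ] ℝ)) x := by
  refine HasFDerivAt.fun_sum fun i _ => ?_
  have h1 := (PiLp.proj p (fun _ : Fin d => ℝ) i :
    PiLp p (fun _ : Fin d => ℝ) →L[ℝ] ℝ).hasFDerivAt (x := x)
  exact (hasDerivAt_abs_rpow (x i) hp).comp_hasFDerivAt x h1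

/-- For `1 < p < ∞` the p-norm is differentiable away from the origin. -/
lemma PiLp.differentiableAt_norm (hp : 1 < p.toReal) (x : PiLp p (fun _ : Fin d => ℝ))
    (hx : x ≠ 0) : DifferentiableAt ℝ (‖·‖) x := by
  have hp0 : 0 < p.toReal := by linarith
  have e : (fun x : PiLp p (fun _ : Fin d => ℝ) => ‖x‖) =
      fun x => (∑ i, |x i| ^ p.toReal) ^ (1 / p.toReal) := by
    funext x
    rw [PiLp.norm_eq_sum hp0]
    simp
  rw [e]
  have hne : (∑ i, |x i| ^ p.toReal) ≠ 0 := by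
    rw [← PiLp.norm_rpow_eq_sum hp0]
    exact (Real.rpow_pos_of_pos (norm_pos_iff.2 hx) _).ne'
  exact ((PiLp.hasFDerivAt_sum_abs_rpow hp x).rpow_const (Or.inl hne)).differentiableAt

/-- The factor in the regularizer `pReg p x₀ x = pRegConst p * ‖x - x₀‖ ^ max 2 p`. -/
def pRegConst (p : ℝ) : ℝ :=
  if 2 ≤ p then (2 : ℝ) ^ (p * (p - 2) / (p - 1)) / p else 1 / (2 * (p - 1))

lemma pRegConst_pos {p : ℝ} (hp : 1 < p) : 0 < pRegConst p := by
  unfold pRegConst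
  split_ifs
  · positivity
  · have : 0 < p - 1 := by linarith
    positivity

lemma pReg_eq {E : Type*} [NormedAddCommGroup E] (p : ℝ) (x₀ : E) :
    pReg p x₀ = fun x => pRegConst p * ‖x - x₀‖ ^ max 2 p := by
  funext x
  unfold pReg pRegConst
  split_ifs with h
  · rw [max_eq_right h]
  · rw [max_eq_left (by linarith), ← Real.rpow_natCast]
    norm_num

lemma hasFDerivAt_pReg {E : Type*} [NormedAddCommGroup E] [NormedSpace ℝ E]
    (hsm : ∀ x : E, x ≠ 0 → DifferentiableAt ℝ (‖·‖) x) (p : ℝ) (x₀ x : E) :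
    HasFDerivAt (pReg p x₀) (pRegConst p •
      ((max 2 p * ‖x - x₀‖ ^ (max 2 p - 1)) • fderiv ℝ (‖·‖) (x - x₀))) x := by
  rw [pReg_eq]
  exact (hasFDerivAt_norm_sub_rpow_of_smooth hsm
    (lt_of_lt_of_le one_lt_two (le_max_left 2 p)) x₀ x).const_mul _

lemma bregman_pReg_center {E : Type*} [NormedAddCommGroup E] [NormedSpace ℝ E]
    (hsm : ∀ x : E, x ≠ 0 → DifferentiableAt ℝ (‖·‖) x) (p : ℝ) (x₀ x : E) :
    bregman (pReg p x₀) x x₀ = pRegConst p * ‖x - x₀‖ ^ max 2 p := by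
  have hm : (0 : ℝ) < max 2 p := lt_of_lt_of_le two_pos (le_max_left 2 p)
  have hm1 : max 2 p - 1 ≠ 0 := by have := le_max_left 2 p; linarith
  unfold bregman
  rw [(hasFDerivAt_pReg hsm p x₀ x₀).fderiv, pReg_eq]
  simp [Real.zero_rpow hm1, Real.zero_rpow hm.ne']

/-- Minkowski's inequality for `p ≤ 2`, in the form in which it lifts the two-point inequality
from coordinates to vectors. -/
lemma add_rpow_sum_le {ι : Type*} (s : Finset ι) {t : ℝ} (ht : 1 ≤ t) (a b : ι → ℝ)
    (ha : ∀ i, 0 ≤ a i) (hb : ∀ i, 0 ≤ b i) :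
    (∑ i ∈ s, a i) ^ t + (∑ i ∈ s, b i) ^ t ≤ (∑ i ∈ s, (a i ^ t + b i ^ t) ^ (1 / t)) ^ t := by
  have ht0 : 0 < t := by linarith
  have hnn : 0 ≤ (∑ i ∈ s, a i) ^ t + (∑ i ∈ s, b i) ^ t :=
    add_nonneg (Real.rpow_nonneg (Finset.sum_nonneg fun i _ => ha i) _)
      (Real.rpow_nonneg (Finset.sum_nonneg fun i _ => hb i) _)
  suffices h : ((∑ i ∈ s, a i) ^ t + (∑ i ∈ s, b i) ^ t) ^ (1 / t) ≤
      ∑ i ∈ s, (a i ^ t + b i ^ t) ^ (1 / t) by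
    have h2 := Real.rpow_le_rpow (Real.rpow_nonneg hnn _) h ht0.le
    rwa [← Real.rpow_mul hnn, one_div_mul_cancel ht0.ne', Real.rpow_one] at h2
  classical
  induction s using Finset.induction_on with
  | empty => simp [Real.zero_rpow ht0.ne', Real.zero_rpow (inv_ne_zero ht0.ne')]
  | insert j s hj ih =>
    have hA : 0 ≤ ∑ i ∈ s, a i := Finset.sum_nonneg fun i _ => ha i
    have hB : 0 ≤ ∑ i ∈ s, b i := Finset.sum_nonneg fun i _ => hb i
    have hnn' : 0 ≤ (∑ i ∈ s, a i) ^ t + (∑ i ∈ s, b i) ^ t := by positivity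
    rw [Finset.sum_insert hj, Finset.sum_insert hj, Finset.sum_insert hj]
    have h := Real.Lp_add_le_of_nonneg (s := (Finset.univ : Finset (Fin 2)))
      (f := ![a j, b j]) (g := ![∑ i ∈ s, a i, ∑ i ∈ s, b i]) ht
      (by simp [Fin.forall_fin_two, ha, hb]) (by simp [Fin.forall_fin_two, hA, hB])
    simp only [Fin.sum_univ_two, Matrix.cons_val_zero, Matrix.cons_val_one] at h
    exact h.trans (by gcongr; exact ih hnn')

/-- The p-norm is 2-uniformly convex for `1 < p ≤ 2`, with the best constant `p - 1`. -/
lemma PiLp.two_uniform_convexity (hp1 : 1 < p.toReal) (hp2 : p.toReal ≤ 2)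
    (x y : PiLp p (fun _ : Fin d => ℝ)) :
    ‖x‖ ^ 2 + (p.toReal - 1) * ‖y‖ ^ 2 ≤ (‖x + y‖ ^ 2 + ‖x - y‖ ^ 2) / 2 := by
  set P := p.toReal with hP
  have hP0 : 0 < P := by linarith
  have hc : 0 ≤ P - 1 := by linarith
  have ht : 1 ≤ 2 / P := by rw [le_div_iff₀ hP0]; linarith
  have pow_eq : ∀ u : ℝ, 0 ≤ u → (u ^ P) ^ (2 / P) = u ^ 2 := by
    intro u hu
    rw [← Real.rpow_mul hu, mul_div_cancel₀ _ hP0.ne']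
    norm_num
  -- comparison of the square mean with the `p`-mean of `‖x + y‖` and `‖x - y‖`
  have s1 : ((‖x + y‖ ^ P + ‖x - y‖ ^ P) / 2) ^ (2 / P) ≤ (‖x + y‖ ^ 2 + ‖x - y‖ ^ 2) / 2 := by
    have h := Real.rpow_arith_mean_le_arith_mean_rpow (Finset.univ : Finset (Fin 2))
      ![1 / 2, 1 / 2] ![‖x + y‖ ^ P, ‖x - y‖ ^ P] (by simp [Fin.forall_fin_two])
      (by norm_num [Fin.sum_univ_two])
      (by simp only [Finset.mem_univ, forall_const, Fin.forall_fin_two, Matrix.cons_val_zero,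
            Matrix.cons_val_one]
          exact ⟨by positivity, by positivity⟩) ht
    simp only [Fin.sum_univ_two, Matrix.cons_val_zero, Matrix.cons_val_one] at h
    rw [pow_eq _ (norm_nonneg _), pow_eq _ (norm_nonneg _)] at h
    calc _ = (1 / 2 * ‖x + y‖ ^ P + 1 / 2 * ‖x - y‖ ^ P) ^ (2 / P) := by ring_nf
      _ ≤ _ := h
      _ = _ := by ring
  have s2 : ∑ i, (x i ^ 2 + (P - 1) * y i ^ 2) ^ (P / 2) ≤
      (‖x + y‖ ^ P + ‖x - y‖ ^ P) / 2 := by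
    rw [PiLp.norm_rpow_eq_sum hP0, PiLp.norm_rpow_eq_sum hP0, ← Finset.sum_add_distrib,
      Finset.sum_div]
    exact Finset.sum_le_sum fun i _ => two_point_inequality hp1 hp2 (x i) (y i)
  have s3 := add_rpow_sum_le Finset.univ ht (fun i => |x i| ^ P)
    (fun i => |Real.sqrt (P - 1) * y i| ^ P) (fun i => by positivity) (fun i => by positivity)
  have e1 : ∑ i, |x i| ^ P = ‖x‖ ^ P := (PiLp.norm_rpow_eq_sum hP0 x).symm
  have e2 : ∑ i, |Real.sqrt (P - 1) * y i| ^ P = (Real.sqrt (P - 1) * ‖y‖) ^ P := by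
    rw [Real.mul_rpow (Real.sqrt_nonneg _) (norm_nonneg _), PiLp.norm_rpow_eq_sum hP0,
      Finset.mul_sum]
    refine Finset.sum_congr rfl fun i _ => ?_
    rw [abs_mul, abs_of_nonneg (Real.sqrt_nonneg _),
      Real.mul_rpow (Real.sqrt_nonneg _) (abs_nonneg _)]
  have e3 : ∀ i, ((|x i| ^ P) ^ (2 / P) + (|Real.sqrt (P - 1) * y i| ^ P) ^ (2 / P)) ^
      (1 / (2 / P)) = (x i ^ 2 + (P - 1) * y i ^ 2) ^ (P / 2) := by
    intro i
    rw [pow_eq _ (abs_nonneg _), pow_eq _ (abs_nonneg _), sq_abs, sq_abs, mul_pow,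
      Real.sq_sqrt hc, one_div_div]
  simp only [e3] at s3
  rw [e1, e2, pow_eq _ (norm_nonneg _), pow_eq _ (by positivity), mul_pow, Real.sq_sqrt hc] at s3
  refine s3.trans (le_trans ?_ s1)
  refine Real.rpow_le_rpow (Finset.sum_nonneg fun i _ => ?_) s2 (by positivity)
  have := sq_nonneg (x i)
  have := sq_nonneg (y i)
  exact Real.rpow_nonneg (by nlinarith) _

/-- The scaled regularizer is `(1, max 2 p)`-uniformly convex. -/
lemma PiLp.isInexactUniformlyConvex_pReg (hp : 1 < p.toReal) (x₀ : PiLp p (fun _ : Fin d => ℝ)) :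
    IsInexactUniformlyConvex 0 1 (max 2 p.toReal) (pReg p.toReal x₀) := by
  have hsm := fun x hx => PiLp.differentiableAt_norm (d := d) hp x hx
  refine ⟨fun x => (hasFDerivAt_pReg hsm _ x₀ x).differentiableAt, fun x y => ?_⟩
  rw [sub_zero]
  set P := p.toReal with hP
  have hP0 : 0 < P := by linarith
  rcases le_or_gt 2 P with h2 | h2
  · rw [max_eq_right h2]
    set K : ℝ := (2 : ℝ) ^ (P * (P - 2) / (P - 1)) / P with hK
    have hψ : pReg P x₀ = fun x => K * ∑ i, |(x - x₀) i| ^ P := by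
      funext x
      rw [← PiLp.norm_rpow_eq_sum hP0]
      rw [hP, pReg, if_pos h2]
    have hd : HasFDerivAt (pReg P x₀) (K • (∑ i, (P * |(y - x₀) i| ^ (P - 2) * (y - x₀) i) •
        (PiLp.proj p (fun _ : Fin d => ℝ) i : PiLp p (fun _ : Fin d => ℝ) →L[ℝ] ℝ))) y := by
      rw [hψ]
      have h1 := (PiLp.hasFDerivAt_sum_abs_rpow hp (y - x₀)).comp y
        ((hasFDerivAt_id y).sub_const x₀)
      rw [ContinuousLinearMap.comp_id] at h1
      exact h1.const_mul K
    have hK0 : 0 < K := by positivity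
    -- the scaling of the regularizer compensates the constant of the scalar inequality
    have hK2 : 1 / P ≤ K * 2 ^ (2 - P) := by
      have : (1 : ℝ) ≤ 2 ^ (P * (P - 2) / (P - 1)) * 2 ^ (2 - P) := by
        rw [← Real.rpow_add two_pos]
        refine Real.one_le_rpow one_le_two ?_
        have hP1 : 0 < P - 1 := by linarith
        have : P * (P - 2) / (P - 1) + (2 - P) = (P - 2) / (P - 1) := by
          field_simp
          ring
        rw [this]
        exact div_nonneg (by linarith) hP1.le
      rw [hK, div_mul_eq_mul_div]
      gcongr
    unfold bregman
    rw [hd.fderiv, hψ]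
    rw [show (K • ∑ i, (P * |(y - x₀) i| ^ (P - 2) * (y - x₀) i) •
        (PiLp.proj p (fun _ : Fin d => ℝ) i : PiLp p (fun _ : Fin d => ℝ) →L[ℝ] ℝ)) (x - y) =
        K * ∑ i, (P * |(y - x₀) i| ^ (P - 2) * (y - x₀) i) * (x - y) i by
      rw [_root_.smul_apply, _root_.sum_apply]; rfl]
    have e : x - y = (x - x₀) - (y - x₀) := by abel
    rw [e, PiLp.norm_rpow_eq_sum hP0]
    set u := x - x₀
    set w := y - x₀
    have hsub : ∀ i, (u - w) i = u i - w i := fun i => rfl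
    simp only [hsub]
    rw [← mul_sub, ← mul_sub, ← Finset.sum_sub_distrib, ← Finset.sum_sub_distrib]
    calc 1 / P * ∑ i, |u i - w i| ^ P ≤ K * 2 ^ (2 - P) * ∑ i, |u i - w i| ^ P :=
          mul_le_mul_of_nonneg_right hK2 (Finset.sum_nonneg fun i _ => by positivity)
      _ = K * ∑ i, 2 ^ (2 - P) * |u i - w i| ^ P := by rw [mul_assoc, Finset.mul_sum]
      _ ≤ _ := by
        refine mul_le_mul_of_nonneg_left (Finset.sum_le_sum fun i _ => ?_) hK0.le
        have := abs_rpow_bregman h2 (u i) (w i)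
        linarith
  · rw [max_eq_left h2.le]
    have hψ : ∀ x, pReg P x₀ x = 1 / (2 * (P - 1)) * ‖x - x₀‖ ^ 2 := by
      intro x
      simp [pReg, not_le.2 h2]
    have hP1 : 0 < P - 1 := by linarith
    have hmid : ∀ x y, pReg P x₀ ((1 / 2 : ℝ) • (x + y)) ≤
        (pReg P x₀ x + pReg P x₀ y) / 2 - (1 / 2) / 4 * ‖x - y‖ ^ 2 := by
      intro x y
      have h := PiLp.two_uniform_convexity hp h2.le ((1 / 2 : ℝ) • ((x - x₀) + (y - x₀)))
        ((1 / 2 : ℝ) • ((x - x₀) - (y - x₀)))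
      rw [show (1 / 2 : ℝ) • ((x - x₀) + (y - x₀)) + (1 / 2 : ℝ) • ((x - x₀) - (y - x₀)) =
          x - x₀ by module,
        show (1 / 2 : ℝ) • ((x - x₀) + (y - x₀)) - (1 / 2 : ℝ) • ((x - x₀) - (y - x₀)) =
          y - x₀ by module,
        show (1 / 2 : ℝ) • ((x - x₀) + (y - x₀)) = (1 / 2 : ℝ) • (x + y) - x₀ by module,
        show (x - x₀) - (y - x₀) = x - y by abel,
        norm_smul (1 / 2 : ℝ) (x - y), ← hP] at h
      rw [hψ, hψ, hψ]
      set N := ‖(1 / 2 : ℝ) • (x + y) - x₀‖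
      have e : (1 / (2 * (P - 1)) * ‖x - x₀‖ ^ 2 + 1 / (2 * (P - 1)) * ‖y - x₀‖ ^ 2) / 2 -
          1 / 2 / 4 * ‖x - y‖ ^ 2 = 1 / (2 * (P - 1)) * ((‖x - x₀‖ ^ 2 + ‖y - x₀‖ ^ 2) / 2 -
            (P - 1) * (‖(1 / 2 : ℝ)‖ * ‖x - y‖) ^ 2) := by
        rw [Real.norm_of_nonneg (by norm_num : (0 : ℝ) ≤ 1 / 2)]
        field_simp
        ring
      rw [e]
      exact mul_le_mul_of_nonneg_left (by linarith) (by positivity)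
    have h := add_fderiv_le_of_midpoint hmid (x := x) (y := y)
      (hasFDerivAt_pReg hsm P x₀ y).differentiableAt
    unfold bregman
    rw [show (2 : ℝ) = ((2 : ℕ) : ℝ) by norm_num, Real.rpow_natCast]
    push_cast
    linarith

end PNorm

/-! ### Taylor steps are inexact proximal steps -/

section TaylorStep

variable {E : Type} [NormedAddCommGroup E] [NormedSpace ℝ E]

lemma baseLam_pos {q : ℕ} {L σ : ℝ} (hL : 0 < L) (hσ : 0 < σ) : 0 < baseLam q L σ := by
  unfold baseLam; positivity

lemma hasFDerivAt_regTaylor (hsm : ∀ x : E, x ≠ 0 → DifferentiableAt ℝ (‖·‖) x)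
    {q : ℕ} {ν lam : ℝ} (hqν : 1 < (q : ℝ) + ν) {J : Jet E q} {x y : E}
    {g : E →L[ℝ] ℝ} (hg : HasFDerivAt (taylorModel J x) g y) :
    HasFDerivAt (regTaylor ν lam J x)
      (g + (‖y - x‖ ^ ((q : ℝ) + ν - 1) / lam) • fderiv ℝ (‖·‖) (y - x)) y := by
  have h := hg.add ((hasFDerivAt_norm_sub_rpow_of_smooth hsm hqν x y).const_mul
    (1 / (lam * (q + ν))))
  refine h.congr_fderiv ?_
  rw [smul_smul]
  congr 2
  have : (q : ℝ) + ν ≠ 0 := by linarith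
  field_simp

/-- Up to a relative error `1 / 4`, the gradient of `f` at a Taylor step `y` from `x` is the
negative gradient of `‖· - x‖ ^ (q + ν) / ((q + ν) lam)`. -/
lemma IsApproxCritical.norm_fderiv_add_le (hsm : ∀ x : E, x ≠ 0 → DifferentiableAt ℝ (‖·‖) x)
    {f : E → ℝ} {q : ℕ} (hq : 1 ≤ q) (hf : ContDiff ℝ q f) {L ν : ℝ} (hL : 0 < L) (hν : 0 < ν)
    (hH : ∀ x y, ‖iteratedFDeriv ℝ q f x - iteratedFDeriv ℝ q f y‖ ≤ L * ‖x - y‖ ^ ν)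
    {x y : E} (h : IsApproxCritical L ν (baseLam q L (1 / 4)) (qOracle q f x) x y) :
    ‖fderiv ℝ f y + (‖y - x‖ ^ ((q : ℝ) + ν - 1) / baseLam q L (1 / 4)) •
        fderiv ℝ (‖·‖) (y - x)‖ ≤
      1 / 4 / baseLam q L (1 / 4) * ‖y - x‖ ^ ((q : ℝ) + ν - 1) := by
  have hqν : 1 < (q : ℝ) + ν := by
    have : (1 : ℝ) ≤ q := by exact_mod_cast hq
    linarith
  obtain ⟨g, hg, hgn⟩ := h
  obtain ⟨gT, hgT, hgTn⟩ := norm_fderiv_sub_fderiv_taylorModel_le hq hf hL.le hν hH x y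
  have hu := hg.unique (hasFDerivAt_regTaylor hsm hqν hgT)
  set N := (‖y - x‖ ^ ((q : ℝ) + ν - 1) / baseLam q L (1 / 4)) • fderiv ℝ (‖·‖) (y - x)
  have e : fderiv ℝ f y + N = (fderiv ℝ f y - gT) + g := by rw [hu]; abel
  have e2 : 1 / 4 / baseLam q L (1 / 4) =
      L / ((q - 1).factorial : ℝ) + L / ((q - 1).factorial : ℝ) := by
    unfold baseLam
    field_simp
    ring
  rw [e, e2, add_mul]
  exact (norm_add_le _ _).trans (add_le_add hgTn hgn)

/-- If the Taylor step does not move, then `x` is a critical point. -/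
lemma IsApproxCritical.fderiv_eq_zero (hsm : ∀ x : E, x ≠ 0 → DifferentiableAt ℝ (‖·‖) x)
    {f : E → ℝ} {q : ℕ} (hq : 1 ≤ q) (hf : ContDiff ℝ q f) {L ν : ℝ} (hL : 0 < L) (hν : 0 < ν)
    (hH : ∀ x y, ‖iteratedFDeriv ℝ q f x - iteratedFDeriv ℝ q f y‖ ≤ L * ‖x - y‖ ^ ν)
    {x : E} (h : IsApproxCritical L ν (baseLam q L (1 / 4)) (qOracle q f x) x x) :
    fderiv ℝ f x = 0 := by
  have h1 := h.norm_fderiv_add_le hsm hq hf hL hν hH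
  have hqν : (q : ℝ) + ν - 1 ≠ 0 := by
    have : (1 : ℝ) ≤ q := by exact_mod_cast hq
    linarith
  simpa [Real.zero_rpow hqν] using h1

lemma exists_isApproxCritical [FiniteDimensional ℝ E]
    (hsm : ∀ x : E, x ≠ 0 → DifferentiableAt ℝ (‖·‖) x)
    {f : E → ℝ} {q : ℕ} (hq : 1 ≤ q) (hf : ContDiff ℝ q f) {L ν lam : ℝ} (hL : 0 < L)
    (hν : 0 < ν) (hlam : 0 < lam) (x : E) :
    ∃ y, IsApproxCritical L ν lam (qOracle q f x) x y := by
  have hqν : 1 < (q : ℝ) + ν := by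
    have : (1 : ℝ) ≤ q := by exact_mod_cast hq
    linarith
  obtain ⟨n, rfl⟩ : ∃ n, q = n + 1 := ⟨q - 1, by omega⟩
  have hd := fun y => hasFDerivAt_regTaylor (lam := lam) hsm hqν (hasFDerivAt_taylorModel hf x y)
  set M : ℝ := ∑ i ∈ Finset.range (n + 1 + 1),
    (1 / (i.factorial : ℝ)) * ‖iteratedFDeriv ℝ i f x‖ with hM
  have hM0 : 0 ≤ M := Finset.sum_nonneg fun i _ => by positivity
  have hcoer : ∀ y, 1 / (lam * ((n + 1 : ℕ) + ν)) * ‖y - x‖ ^ (((n + 1 : ℕ) : ℝ) + ν) -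
      M * (1 + ‖y - x‖) ^ (((n + 1 : ℕ) : ℝ)) - 0 ≤
        regTaylor ν lam (qOracle (n + 1) f x) x y := by
    intro y
    unfold regTaylor
    have h1 : -(M * (1 + ‖y - x‖) ^ (((n + 1 : ℕ) : ℝ))) ≤
        taylorModel (qOracle (n + 1) f x) x y := by
      rw [taylorModel_qOracle, hM, Finset.sum_mul, ← Finset.sum_neg_distrib]
      refine Finset.sum_le_sum fun i hi => ?_
      have h2 : |iteratedFDeriv ℝ i f x (fun _ => y - x)| ≤
          ‖iteratedFDeriv ℝ i f x‖ * (1 + ‖y - x‖) ^ (n + 1) := by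
        refine ((iteratedFDeriv ℝ i f x).le_opNorm (fun _ => y - x)).trans ?_
        simp only [Finset.prod_const, Finset.card_univ, Fintype.card_fin]
        refine mul_le_mul_of_nonneg_left ?_ (norm_nonneg _)
        calc ‖y - x‖ ^ i ≤ (1 + ‖y - x‖) ^ i := by gcongr; linarith
          _ ≤ (1 + ‖y - x‖) ^ (n + 1) :=
            pow_le_pow_right₀ (by linarith [norm_nonneg (y - x)])
              (by have := Finset.mem_range.1 hi; omega)
      rw [Real.rpow_natCast, mul_assoc, ← mul_neg]
      exact mul_le_mul_of_nonneg_left (abs_le.1 h2).1 (by positivity)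
    linarith
  obtain ⟨y, hy⟩ := exists_forall_le_of_tendsto_norm
    (continuous_iff_continuousAt.2 fun y => (hd y).continuousAt) x
    (tendsto_mul_rpow_sub_mul_rpow (Nat.cast_nonneg (n + 1))
      (by linarith : ((n + 1 : ℕ) : ℝ) < ((n + 1 : ℕ) : ℝ) + ν)
      (by positivity : 0 < 1 / (lam * (((n + 1 : ℕ) : ℝ) + ν))) M 0 hM0) hcoer
  refine ⟨y, 0, ?_, by simp; positivity⟩
  have hmin : IsLocalMin (regTaylor ν lam (qOracle (n + 1) f x) x) y :=
    Filter.Eventually.of_forall hy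
  have h0 := hmin.hasFDerivAt_eq_zero (hd y)
  exact h0 ▸ hd y

/-- A gradient that is close to the gradient of the proximal term makes an inexact proximal
step; for convex `f` no enlargement of the subdifferential is needed. -/
lemma isInexactProx_of_norm_fderiv_add_le (hsm : ∀ x : E, x ≠ 0 → DifferentiableAt ℝ (‖·‖) x)
    {f : E → ℝ} (hf : ConvexOn ℝ Set.univ f) {r lam : ℝ} (hr : 1 < r) (hlam : 0 < lam) {x y : E}
    (hd : DifferentiableAt ℝ f y)
    (h : ‖fderiv ℝ f y + (‖y - x‖ ^ (r - 1) / lam) • fderiv ℝ (‖·‖) (y - x)‖ ≤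
      1 / 4 / lam * ‖y - x‖ ^ (r - 1)) :
    IsInexactProx f r lam (1 / 4) (1 / 4) x y (fderiv ℝ f y) := by
  refine ⟨hlam, ⟨0, le_rfl, fun z => ?_, by positivity⟩, _,
    (hasFDerivAt_norm_sub_rpow_of_smooth hsm hr x y).const_mul _, ?_⟩
  · have := hf.add_fderiv_le hd z
    linarith
  · rw [norm_sub_rev x y]
    refine le_of_eq_of_le ?_ h
    have e : -(1 / (r * lam)) * (r * ‖y - x‖ ^ (r - 1)) = -(‖y - x‖ ^ (r - 1) / lam) := by
      field_simp
    rw [smul_smul, e]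
    exact congrArg norm ((congrArg (fderiv ℝ f y - ·) (neg_smul _ _)).trans (sub_neg_eq_add _ _))

/-- With the adaptive proximal parameter `lam = lamBase * ‖y - x‖ ^ (r - s)`, a proximal step with
exponent `s` is one with exponent `r`. -/
lemma rpow_div_mul_rpow_sub {n : ℝ} (hn : 0 < n) (r s lam : ℝ) :
    n ^ (r - 1) / (lam * n ^ (r - s)) = n ^ (s - 1) / lam := by
  rw [show r - 1 = (s - 1) + (r - s) by ring, Real.rpow_add hn]
  have : n ^ (r - s) ≠ 0 := (Real.rpow_pos_of_pos hn _).ne'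
  rcases eq_or_ne lam 0 with rfl | hl
  · simp
  · field_simp

variable {v : E →L[ℝ] ℝ} {r lam : ℝ} {x y : E}

lemma norm_le_of_norm_add_le (hlam : 0 < lam)
    (h : ‖v + (‖y - x‖ ^ (r - 1) / lam) • fderiv ℝ (‖·‖) (y - x)‖ ≤
      1 / 4 / lam * ‖y - x‖ ^ (r - 1)) :
    ‖v‖ ≤ 5 / 4 / lam * ‖y - x‖ ^ (r - 1) := by
  set N := (‖y - x‖ ^ (r - 1) / lam) • fderiv ℝ (‖·‖) (y - x)
  have hN : ‖N‖ ≤ ‖y - x‖ ^ (r - 1) / lam := by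
    rw [norm_smul, Real.norm_of_nonneg (by positivity)]
    exact mul_le_of_le_one_right (by positivity) (norm_fderiv_norm_le_one _)
  have e : v = (v + N) - N := by abel
  rw [e]
  refine (norm_sub_le _ _).trans ((add_le_add h hN).trans (le_of_eq ?_))
  field_simp
  ring

lemma le_apply_sub_of_norm_add_le (hsm : ∀ x : E, x ≠ 0 → DifferentiableAt ℝ (‖·‖) x)
    (hr : 1 < r)
    (h : ‖v + (‖y - x‖ ^ (r - 1) / lam) • fderiv ℝ (‖·‖) (y - x)‖ ≤
      1 / 4 / lam * ‖y - x‖ ^ (r - 1)) :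
    3 / 4 / lam * ‖y - x‖ ^ r ≤ v (x - y) := by
  set c := ‖y - x‖ ^ (r - 1) with hc
  set N := fderiv ℝ (‖·‖) (y - x) with hN
  have e1 : v (x - y) = c / lam * ‖y - x‖ - (v + (c / lam) • N) (y - x) := by
    have h1 : N (y - x) = ‖y - x‖ := fderiv_norm_apply_self hsm (y - x)
    rw [← neg_sub y x, map_neg, _root_.add_apply, _root_.smul_apply, h1, smul_eq_mul]
    ring
  have e2 : ‖y - x‖ ^ r = c * ‖y - x‖ := by
    rcases eq_or_ne (y - x) 0 with h0 | h0
    · rw [h0, norm_zero, Real.zero_rpow (by linarith), mul_zero]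
    · rw [hc, ← Real.rpow_add_one (norm_ne_zero_iff.2 h0)]
      ring_nf
  have e3 : (v + (c / lam) • N) (y - x) ≤ 1 / 4 / lam * c * ‖y - x‖ :=
    (le_abs_self _).trans (((v + (c / lam) • N).le_opNorm _).trans
      (mul_le_mul_of_nonneg_right h (norm_nonneg _)))
  rw [e1, e2]
  have : c / lam * ‖y - x‖ - 1 / 4 / lam * c * ‖y - x‖ = 3 / 4 / lam * (c * ‖y - x‖) := by ring
  linarith

end TaylorStep

/-! ### One accelerated step -/

lemma stepConst_pos {μ r : ℝ} (hμ : 0 < μ) (hr : 1 < r) : 0 < stepConst μ r (1 / 4) (1 / 4) := by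
  unfold stepConst
  have : 0 < r - 1 := by linarith
  have : (0 : ℝ) < (1 / 4) ^ (r / (r - 1)) := by positivity
  norm_num
  positivity

/-- The slack in the step constant: `5 / 8` in place of `1 - σ = 3 / 4` on the right leaves a
descent term. -/
lemma stepConst_mul_le {μ r : ℝ} (hμ : 0 < μ) (hr : 1 < r) :
    stepConst μ r (1 / 4) (1 / 4) * (5 / 4) ^ r ≤ μ * (r / (r - 1) * (5 / 8)) ^ (r - 1) := by
  have hr1 : 0 < r - 1 := by linarith
  have hq : 0 < (r / (r - 1)) := by positivity
  have h4 : (0 : ℝ) < (1 / 4) ^ (r / (r - 1)) := by positivity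
  unfold stepConst
  set t := (1 / 4 : ℝ) ^ (r / (r - 1))
  set rs := r / (r - 1)
  have h1 : (rs * (1 - 1 / 4 - 1 / 4) / (1 + t)) ^ (r - 1) ≤ (rs * (1 / 2)) ^ (r - 1) := by
    refine Real.rpow_le_rpow ?_ ?_ hr1.le
    · norm_num; positivity
    · rw [div_le_iff₀ (by positivity)]
      nlinarith
  have h2 : (rs * (5 / 8)) ^ (r - 1) = (rs * (1 / 2)) ^ (r - 1) * (5 / 4) ^ (r - 1) := by
    rw [← Real.mul_rpow (by positivity) (by norm_num)]
    ring_nf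
  have h3 : (5 / 4 : ℝ) ^ r = (5 / 4) ^ (r - 1) * (5 / 4) := by
    rw [← Real.rpow_add_one (by norm_num)]
    ring_nf
  rw [h2, h3]
  calc μ / 2 * (rs * (1 - 1 / 4 - 1 / 4) / (1 + t)) ^ (r - 1) * ((5 / 4) ^ (r - 1) * (5 / 4))
      ≤ μ / 2 * (rs * (1 / 2)) ^ (r - 1) * ((5 / 4) ^ (r - 1) * (5 / 4)) := by gcongr
    _ = 5 / 8 * (μ * ((rs * (1 / 2)) ^ (r - 1) * (5 / 4) ^ (r - 1))) := by ring
    _ ≤ μ * ((rs * (1 / 2)) ^ (r - 1) * (5 / 4) ^ (r - 1)) :=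
        mul_le_of_le_one_left (by positivity) (by norm_num)

/-- Young's inequality with the weights dictated by the step-size rule: the linear term in the
displacement `w` of `z` is absorbed by the uniform convexity of the regularizer and the progress
of the proximal step of length `n`. -/
lemma step_young {μ r A a lam n w : ℝ} (hμ : 0 < μ) (hr : 1 < r) (hA : 0 ≤ A) (ha : 0 ≤ a)
    (hlam : 0 < lam) (hn : 0 ≤ n) (hw : 0 ≤ w)
    (h : a ^ r ≤ stepConst μ r (1 / 4) (1 / 4) * A ^ (r - 1) * lam) :
    a * (5 / 4 / lam * n ^ (r - 1)) * w ≤ 5 / 8 / lam * (A * n ^ r) + μ / r * w ^ r := by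
  have hr0 : 0 < r := by linarith
  have hr1 : 0 < r - 1 := by linarith
  set P := r / (r - 1) * (5 / 8) * (A * (n ^ r / lam)) with hP
  have hP0 : 0 ≤ P := by positivity
  have hQ0 : 0 ≤ μ * w ^ r := by positivity
  have hyoung := Real.geom_mean_le_arith_mean2_weighted (w₁ := (r - 1) / r) (w₂ := 1 / r)
    (by positivity) (by positivity) hP0 hQ0 (by field_simp; ring)
  have e1 : (r - 1) / r * P + 1 / r * (μ * w ^ r) =
      5 / 8 / lam * (A * n ^ r) + μ / r * w ^ r := by
    rw [hP]; field_simp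
  rw [e1] at hyoung
  refine le_trans ?_ hyoung
  have e2 : (P ^ ((r - 1) / r) * (μ * w ^ r) ^ (1 / r)) ^ r = P ^ (r - 1) * (μ * w ^ r) := by
    rw [Real.mul_rpow (by positivity) (by positivity), ← Real.rpow_mul hP0, ← Real.rpow_mul hQ0,
      one_div_mul_cancel hr0.ne', Real.rpow_one, div_mul_cancel₀ _ hr0.ne']
  rw [← Real.rpow_le_rpow_iff (by positivity) (by positivity) hr0, e2,
    Real.mul_rpow (by positivity) hw, Real.mul_rpow ha (by positivity),
    Real.mul_rpow (by positivity) (by positivity), hP,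
    Real.mul_rpow (by positivity) (by positivity),
    Real.mul_rpow hA (by positivity), Real.div_rpow (by positivity) hlam.le,
    Real.div_rpow (by positivity) hlam.le, ← Real.rpow_mul hn, ← Real.rpow_mul hn,
    mul_comm (r - 1) r]
  set N := n ^ (r * (r - 1))
  have hN : 0 ≤ N := by positivity
  have hl : lam ^ r = lam ^ (r - 1) * lam := by
    rw [← Real.rpow_add_one hlam.ne']; ring_nf
  have hl0 : 0 < lam ^ (r - 1) := by positivity
  have hC := stepConst_mul_le hμ hr
  rw [hl]
  have hAr : 0 ≤ A ^ (r - 1) := by positivity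
  calc a ^ r * ((5 / 4) ^ r / (lam ^ (r - 1) * lam) * N) * w ^ r
      ≤ stepConst μ r (1 / 4) (1 / 4) * A ^ (r - 1) * lam *
        ((5 / 4) ^ r / (lam ^ (r - 1) * lam) * N) * w ^ r := by gcongr
    _ = (stepConst μ r (1 / 4) (1 / 4) * (5 / 4) ^ r) *
        (A ^ (r - 1) * (N / lam ^ (r - 1)) * w ^ r) := by field_simp
    _ ≤ (μ * (r / (r - 1) * (5 / 8)) ^ (r - 1)) *
        (A ^ (r - 1) * (N / lam ^ (r - 1)) * w ^ r) := by gcongr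
    _ = _ := by ring

/-! ### The estimate sequence -/

section Accel

variable {E : Type} [NormedAddCommGroup E] [NormedSpace ℝ E]

/-- What the two methods have in common: `K` accelerated steps, each of which extrapolates with
the tentative step size `aHat` and is then damped by the factor `γ ≤ 1`. The step from `x` to `yt`
is an inexact proximal step with parameter `lam`, expressed through the gradient of the proximal
term, and `aHat_rpow` is the step-size rule for the damped step `γ * aHat`. -/
structure IsAccelProxRun (f ψ : E → ℝ) (x₀ : E) (r μ : ℝ) (K : ℕ) (x y yt z : ℕ → E)
    (v : ℕ → (E →L[ℝ] ℝ)) (a A aHat AHat γ lam : ℕ → ℝ) : Prop where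
  z_zero : z 0 = x₀
  A_zero : A 0 = 0
  aHat_pos : ∀ k < K, 0 < aHat (k + 1)
  γ_pos : ∀ k < K, 0 < γ (k + 1)
  γ_le : ∀ k < K, γ (k + 1) ≤ 1
  lam_pos : ∀ k < K, 0 < lam (k + 1)
  a_eq : ∀ k < K, a (k + 1) = γ (k + 1) * aHat (k + 1)
  A_succ : ∀ k < K, A (k + 1) = a (k + 1) + A k
  AHat_eq : ∀ k < K, AHat (k + 1) = aHat (k + 1) + A k
  aHat_rpow : ∀ k < K, γ (k + 1) * aHat (k + 1) ^ r ≤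
    stepConst μ r (1 / 4) (1 / 4) * AHat (k + 1) ^ (r - 1) * lam (k + 1)
  x_eq : ∀ k < K, x (k + 1) = (A k / AHat (k + 1)) • y k + (aHat (k + 1) / AHat (k + 1)) • z k
  prox : ∀ k < K, ‖v (k + 1) + (‖yt (k + 1) - x (k + 1)‖ ^ (r - 1) / lam (k + 1)) •
      fderiv ℝ (‖·‖) (yt (k + 1) - x (k + 1))‖ ≤
    1 / 4 / lam (k + 1) * ‖yt (k + 1) - x (k + 1)‖ ^ (r - 1)
  v_eq : ∀ k < K, v (k + 1) = fderiv ℝ f (yt (k + 1))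
  y_le : ∀ k < K, A (k + 1) * f (y (k + 1)) ≤
    (1 - γ (k + 1)) * A k * f (y k) + γ (k + 1) * AHat (k + 1) * f (yt (k + 1))
  z_min : ∀ k < K, ∀ w,
    (∑ i ∈ Finset.Icc 1 (k + 1), a i * v i (z (k + 1))) + bregman ψ (z (k + 1)) x₀ ≤
      (∑ i ∈ Finset.Icc 1 (k + 1), a i * v i w) + bregman ψ w x₀

/-- The three-point inequality for a minimizer of a linear functional plus a Bregman
divergence. -/
lemma add_bregman_eq_of_minimizer {ψ : E → ℝ} (hψ : Differentiable ℝ ψ) (l : E →L[ℝ] ℝ)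
    {x₀ z : E} (hz : ∀ w, l z + bregman ψ z x₀ ≤ l w + bregman ψ w x₀) (w : E) :
    l z + bregman ψ z x₀ + bregman ψ w z = l w + bregman ψ w x₀ := by
  have hd : HasFDerivAt (fun w => l w + bregman ψ w x₀)
      (l + (fderiv ℝ ψ z - fderiv ℝ ψ x₀)) z := by
    have h1 : HasFDerivAt (fun w => bregman ψ w x₀) (fderiv ℝ ψ z - fderiv ℝ ψ x₀) z := by
      unfold bregman
      have h2 := (fderiv ℝ ψ x₀).hasFDerivAt.comp z ((hasFDerivAt_id z).sub_const x₀)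
      rw [ContinuousLinearMap.comp_id] at h2
      exact ((hψ z).hasFDerivAt.sub_const (ψ x₀)).sub h2
    exact l.hasFDerivAt.add h1
  have hmin : IsLocalMin (fun w => l w + bregman ψ w x₀) z := Filter.Eventually.of_forall hz
  have h0 := hmin.hasFDerivAt_eq_zero hd
  have h3 := congrArg (fun M : E →L[ℝ] ℝ => M (w - z)) h0
  simp only [_root_.add_apply, _root_.sub_apply, _root_.zero_apply, map_sub] at h3
  unfold bregman
  simp only [map_sub]
  linarith

variable {f ψ : E → ℝ} {x₀ : E} {r μ : ℝ} {K : ℕ} {x y yt z : ℕ → E}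
  {v : ℕ → (E →L[ℝ] ℝ)} {a A aHat AHat γ lam : ℕ → ℝ}

namespace IsAccelProxRun

lemma a_pos (h : IsAccelProxRun f ψ x₀ r μ K x y yt z v a A aHat AHat γ lam) {k : ℕ} (hk : k < K) :
    0 < a (k + 1) := by
  rw [h.a_eq k hk]
  exact mul_pos (h.γ_pos k hk) (h.aHat_pos k hk)

lemma A_eq_sum (h : IsAccelProxRun f ψ x₀ r μ K x y yt z v a A aHat AHat γ lam) {k : ℕ}
    (hk : k ≤ K) : A k = ∑ i ∈ Finset.Icc 1 k, a i := by
  induction k with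
  | zero => simp [h.A_zero]
  | succ k ih =>
    rw [Finset.sum_Icc_succ_top (by omega), h.A_succ k (by omega), ih (by omega)]
    ring

lemma A_nonneg (h : IsAccelProxRun f ψ x₀ r μ K x y yt z v a A aHat AHat γ lam) {k : ℕ}
    (hk : k ≤ K) : 0 ≤ A k := by
  induction k with
  | zero => rw [h.A_zero]
  | succ k ih =>
    rw [h.A_succ k (by omega)]
    have := h.a_pos (k := k) (by omega)
    linarith [ih (by omega)]

lemma AHat_pos (h : IsAccelProxRun f ψ x₀ r μ K x y yt z v a A aHat AHat γ lam) {k : ℕ}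
    (hk : k < K) : 0 < AHat (k + 1) := by
  rw [h.AHat_eq k hk]
  linarith [h.aHat_pos k hk, h.A_nonneg hk.le]

/-- One step of the estimate sequence: the linear model at `yt` pays for the new weight, and the
uniform convexity of `ψ` absorbs the movement of the minimizer. -/
lemma step (h : IsAccelProxRun f ψ x₀ r μ K x y yt z v a A aHat AHat γ lam)
    (hsm : ∀ x : E, x ≠ 0 → DifferentiableAt ℝ (‖·‖) x)
    (hf : ConvexOn ℝ Set.univ f) (hfd : Differentiable ℝ f) (hr : 1 < r) (hμ : 0 < μ)
    {δ : ℝ} (hψ : IsInexactUniformlyConvex δ μ r ψ) {k : ℕ} (hk : k < K) (w : E) :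
    A (k + 1) * f (y (k + 1)) + γ (k + 1) * AHat (k + 1) / (8 * lam (k + 1)) *
        ‖yt (k + 1) - x (k + 1)‖ ^ r - δ ≤
      A k * f (y k) + bregman ψ w (z k) +
        a (k + 1) * (f (yt (k + 1)) + v (k + 1) (w - yt (k + 1))) := by
  have hγ := h.γ_pos k hk
  have hγ1 := h.γ_le k hk
  have hlam := h.lam_pos k hk
  have haH := h.aHat_pos k hk
  have hAH := h.AHat_pos hk
  have hA := h.A_nonneg hk.le
  have hAe := h.AHat_eq k hk
  have hae := h.a_eq k hk
  have hx := h.x_eq k hk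
  have hpow := h.aHat_rpow k hk
  have hy := h.y_le k hk
  have hprox := h.prox k hk
  have hve := h.v_eq k hk
  set v' := v (k + 1)
  set Y := yt (k + 1)
  set X := x (k + 1)
  set n := ‖Y - X‖
  set g := γ (k + 1)
  set l := lam (k + 1)
  set B := AHat (k + 1)
  set b := aHat (k + 1)
  -- lower model of `f` at the previous point
  have h1 : f Y + v' (y k - Y) ≤ f (y k) := by
    rw [hve]; exact hf.add_fderiv_le (hfd Y) (y k)
  have h2 := hψ.2 w (z k)
  have hvn := norm_le_of_norm_add_le hlam hprox
  have hvx := le_apply_sub_of_norm_add_le hsm hr hprox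
  have h3 : -(‖v'‖ * ‖w - z k‖) ≤ v' (w - z k) := by
    have := (abs_le.1 ((Real.norm_eq_abs _).symm.le.trans (v'.le_opNorm (w - z k)))).1
    exact this
  have hstep : (g * b) ^ r ≤ stepConst μ r (1 / 4) (1 / 4) * (g * B) ^ (r - 1) * l := by
    rw [Real.mul_rpow hγ.le haH.le, Real.mul_rpow hγ.le hAH.le]
    have e : g ^ r = g ^ (r - 1) * g := by
      rw [← Real.rpow_add_one hγ.ne']; ring_nf
    rw [e]
    have := mul_le_mul_of_nonneg_left hpow (Real.rpow_nonneg hγ.le (r - 1))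
    linarith
  have h4 := step_young hμ hr (by positivity : 0 ≤ g * B) (by positivity : 0 ≤ g * b) hlam
    (norm_nonneg (Y - X)) (norm_nonneg (w - z k)) hstep
  -- the defining property of the extrapolated point
  have h5 : B * v' (X - Y) + b * v' (w - z k) = A k * v' (y k - Y) + b * v' (w - Y) := by
    have e1 : B * v' X = A k * v' (y k) + b * v' (z k) := by
      rw [hx, map_add, map_smul, map_smul, smul_eq_mul, smul_eq_mul]
      field_simp
    simp only [map_sub]
    have e2 : B * v' Y = b * v' Y + A k * v' Y := by rw [hAe]; ring
    linarith
  have h6 : g * b * (-(‖v'‖ * ‖w - z k‖)) ≤ g * b * v' (w - z k) :=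
    mul_le_mul_of_nonneg_left h3 (by positivity)
  have h7 : g * b * (‖v'‖ * ‖w - z k‖) ≤
      g * b * (5 / 4 / l * n ^ (r - 1)) * ‖w - z k‖ := by
    rw [mul_assoc (g * b)]
    exact mul_le_mul_of_nonneg_left (mul_le_mul_of_nonneg_right hvn (norm_nonneg _))
      (by positivity)
  have h8 : g * B * (3 / 4 / l * n ^ r) ≤ g * B * v' (X - Y) :=
    mul_le_mul_of_nonneg_left hvx (by positivity)
  have h9 : g * A k * (f Y + v' (y k - Y)) ≤ g * A k * f (y k) :=
    mul_le_mul_of_nonneg_left h1 (by positivity)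
  have h10 : g * B * f Y = g * b * f Y + g * A k * f Y := by rw [hAe]; ring
  have h11 : g * (B * v' (X - Y) + b * v' (w - z k)) =
      g * (A k * v' (y k - Y) + b * v' (w - Y)) := by rw [h5]
  have h12 : g * B * (3 / 4 / l * n ^ r) - 5 / 8 / l * (g * B * n ^ r) =
      g * B / (8 * l) * n ^ r := by field_simp; ring
  rw [hae]
  linarith

/-- The invariant of the estimate sequence. -/
lemma estimate (h : IsAccelProxRun f ψ x₀ r μ K x y yt z v a A aHat AHat γ lam)
    (hsm : ∀ x : E, x ≠ 0 → DifferentiableAt ℝ (‖·‖) x)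
    (hf : ConvexOn ℝ Set.univ f) (hfd : Differentiable ℝ f) (hr : 1 < r) (hμ : 0 < μ)
    {δ : ℝ} (hψ : IsInexactUniformlyConvex δ μ r ψ) {k : ℕ} (hk : k ≤ K) (w : E) :
    A k * f (y k) + ∑ j ∈ Finset.range k, γ (j + 1) * AHat (j + 1) / (8 * lam (j + 1)) *
        ‖yt (j + 1) - x (j + 1)‖ ^ r - k * δ + bregman ψ w (z k) ≤
      ∑ i ∈ Finset.Icc 1 k, a i * (f (yt i) + v i (w - yt i)) + bregman ψ w x₀ := by
  induction k generalizing w with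
  | zero => simp [h.A_zero, h.z_zero]
  | succ k ih =>
    have hk' : k < K := by omega
    have h1 := h.step hsm hf hfd hr hμ hψ hk' (z (k + 1))
    have h2 := ih hk'.le (z (k + 1))
    set l : E →L[ℝ] ℝ := ∑ i ∈ Finset.Icc 1 (k + 1), a i • v i with hl
    have hlw : ∀ w, l w = ∑ i ∈ Finset.Icc 1 (k + 1), a i * v i w := by
      intro w; simp [hl, _root_.sum_apply]
    have h3 := add_bregman_eq_of_minimizer hψ.1 l (x₀ := x₀) (z := z (k + 1))
      (fun w => by rw [hlw, hlw]; exact h.z_min k hk' w) w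
    rw [hlw, hlw] at h3
    have h4 : ∀ w, ∑ i ∈ Finset.Icc 1 (k + 1), a i * (f (yt i) + v i (w - yt i)) =
        ∑ i ∈ Finset.Icc 1 (k + 1), a i * v i w +
          ∑ i ∈ Finset.Icc 1 (k + 1), a i * (f (yt i) - v i (yt i)) := by
      intro w
      rw [← Finset.sum_add_distrib]
      refine Finset.sum_congr rfl fun i _ => ?_
      rw [map_sub]; ring
    have h5 := h4 (z (k + 1))
    rw [Finset.sum_Icc_succ_top (by omega : 1 ≤ k + 1)] at h5
    rw [h4 w, Finset.sum_range_succ]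
    push_cast
    linarith

/-- Both the accuracy, weighted by `A`, and the accumulated lengths of the proximal steps are
controlled by the divergence from the starting point. -/
lemma bound (h : IsAccelProxRun f ψ x₀ r μ K x y yt z v a A aHat AHat γ lam)
    (hsm : ∀ x : E, x ≠ 0 → DifferentiableAt ℝ (‖·‖) x)
    (hf : ConvexOn ℝ Set.univ f) (hfd : Differentiable ℝ f) (hr : 1 < r) (hμ : 0 < μ)
    {δ : ℝ} (hψ : IsInexactUniformlyConvex δ μ r ψ) (xs : E) :
    A K * (f (y K) - f xs) + ∑ j ∈ Finset.range K, γ (j + 1) * AHat (j + 1) / (8 * lam (j + 1)) *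
        ‖yt (j + 1) - x (j + 1)‖ ^ r ≤ bregman ψ xs x₀ + (K + 1) * δ := by
  have h1 := h.estimate hsm hf hfd hr hμ hψ le_rfl xs
  have h2 : ∑ i ∈ Finset.Icc 1 K, a i * (f (yt i) + v i (xs - yt i)) ≤ A K * f xs := by
    rw [h.A_eq_sum le_rfl, Finset.sum_mul]
    refine Finset.sum_le_sum fun i hi => ?_
    obtain ⟨k, rfl⟩ : ∃ k, i = k + 1 := ⟨i - 1, by have := (Finset.mem_Icc.1 hi).1; omega⟩
    have hk : k < K := by have := (Finset.mem_Icc.1 hi).2; omega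
    refine mul_le_mul_of_nonneg_left ?_ (h.a_pos hk).le
    rw [h.v_eq k hk]
    exact hf.add_fderiv_le (hfd _) xs
  have h3 := hψ.2 xs (z K)
  have h4 : 0 ≤ μ / r * ‖xs - z K‖ ^ r := by positivity
  rw [mul_sub]
  linarith

end IsAccelProxRun

end Accel

/-! ### Growth of the weights -/

/-- The tangent inequality for the concave function `x ^ β`. -/
lemma rpow_add_mul_sub_le {A A' β : ℝ} (hA : 0 ≤ A) (hA' : 0 < A') (hβ0 : 0 ≤ β) (hβ1 : β ≤ 1) :
    A ^ β + β * ((A' - A) * A' ^ (β - 1)) ≤ A' ^ β := by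
  have h := rpow_one_add_le_one_add_mul_self (s := A / A' - 1)
    (by have : 0 ≤ A / A' := by positivity
        linarith) hβ0 hβ1
  rw [add_sub_cancel, Real.div_rpow hA hA'.le] at h
  have hp : 0 < A' ^ β := Real.rpow_pos_of_pos hA' _
  rw [div_le_iff₀ hp] at h
  have e : A' ^ (β - 1) = A' ^ β / A' := by rw [Real.rpow_sub_one hA'.ne']
  rw [e]
  have : (1 + β * (A / A' - 1)) * A' ^ β = A' ^ β - β * ((A' - A) * (A' ^ β / A')) := by
    field_simp
    ring
  linarith

/-- The step-size rule makes `A ^ (1 / r)` grow by at least `κ ^ (1 / r) / r` in each step. -/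
lemma rpow_inv_growth {A a A' κ r : ℝ} (hr : 1 < r) (hA : 0 ≤ A) (ha : 0 < a) (hA' : A' = a + A)
    (hκ : 0 < κ) (h : a = (κ * A' ^ (r - 1)) ^ (1 / r)) :
    A ^ (1 / r) + κ ^ (1 / r) / r ≤ A' ^ (1 / r) := by
  have hA'0 : 0 < A' := by linarith
  have hr0 : 0 < r := by linarith
  have h1 := rpow_add_mul_sub_le (β := 1 / r) hA hA'0 (by positivity)
    (by rw [div_le_one hr0]; exact hr.le)
  have e : (A' - A) * A' ^ (1 / r - 1) = κ ^ (1 / r) := by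
    rw [hA', add_sub_cancel_right, ← hA', h, Real.mul_rpow hκ.le (by positivity),
      ← Real.rpow_mul hA'0.le, mul_assoc, ← Real.rpow_add hA'0]
    have : (r - 1) * (1 / r) + (1 / r - 1) = 0 := by field_simp; ring
    rw [this, Real.rpow_zero, mul_one]
  rw [e] at h1
  calc _ = A ^ (1 / r) + 1 / r * κ ^ (1 / r) := by ring
    _ ≤ _ := h1

/-- Solvability of the step-size equation. -/
lemma exists_stepSize {A κ r : ℝ} (hr : 1 < r) (hA : 0 ≤ A) (hκ : 0 < κ) :
    ∃ a, 0 < a ∧ a = (κ * (a + A) ^ (r - 1)) ^ (1 / r) := by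
  have hr0 : 0 < r := by linarith
  have hr1 : 0 < r - 1 := by linarith
  rcases hA.eq_or_lt with rfl | hA
  · refine ⟨κ, hκ, ?_⟩
    rw [add_zero]
    nth_rewrite 2 [← Real.rpow_one κ]
    rw [← Real.rpow_add hκ, ← Real.rpow_mul hκ.le]
    have : (1 + (r - 1)) * (1 / r) = 1 := by field_simp; ring
    rw [this, Real.rpow_one]
  · let G : ℝ → ℝ := fun a => a - (κ * (a + A) ^ (r - 1)) ^ (1 / r)
    have hG : Continuous G := by
      have h1 : Continuous fun a : ℝ => (a + A) ^ (r - 1) :=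
        (continuous_id.add continuous_const).rpow_const fun _ => Or.inr hr1.le
      exact continuous_id.sub ((continuous_const.mul h1).rpow_const
        fun _ => Or.inr (by positivity))
    set b := max A (2 ^ (r - 1) * κ) with hb
    have hb0 : 0 < b := lt_of_lt_of_le hA (le_max_left _ _)
    have hG0 : G 0 ≤ 0 := by
      simp only [G, zero_sub, zero_add]
      have : 0 ≤ (κ * A ^ (r - 1)) ^ (1 / r) := by positivity
      linarith
    have hGb : 0 ≤ G b := by
      simp only [G]
      rw [sub_nonneg, ← Real.rpow_le_rpow_iff (by positivity) hb0.le hr0,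
        ← Real.rpow_mul (by positivity), one_div_mul_cancel hr0.ne', Real.rpow_one]
      have e : b ^ r = b ^ (r - 1) * b := by rw [← Real.rpow_add_one hb0.ne']; ring_nf
      calc κ * (b + A) ^ (r - 1) ≤ κ * (2 * b) ^ (r - 1) := by
            have : b + A ≤ 2 * b := by linarith [le_max_left A (2 ^ (r - 1) * κ)]
            gcongr
        _ = b ^ (r - 1) * (2 ^ (r - 1) * κ) := by
            rw [Real.mul_rpow two_pos.le hb0.le]; ring
        _ ≤ b ^ (r - 1) * b := by
            gcongr
            exact le_max_right _ _
        _ = b ^ r := e.symm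
    obtain ⟨a, ha, ha0⟩ := intermediate_value_Icc hb0.le hG.continuousOn ⟨hG0, hGb⟩
    have hae : a = (κ * (a + A) ^ (r - 1)) ^ (1 / r) := sub_eq_zero.1 ha0
    refine ⟨a, ?_, hae⟩
    rw [hae]
    have : 0 < a + A := by linarith [ha.1]
    positivity

/-- A linear functional plus the Bregman divergence of a uniformly convex function attains its
minimum. -/
lemma exists_minimizer_add_bregman {E : Type} [NormedAddCommGroup E] [NormedSpace ℝ E]
    [FiniteDimensional ℝ E] {ψ : E → ℝ} {m : ℝ} (hm : 1 < m)
    (hψ : IsInexactUniformlyConvex 0 1 m ψ) (x₀ : E) (l : E →L[ℝ] ℝ) :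
    ∃ z, ∀ w, l z + bregman ψ z x₀ ≤ l w + bregman ψ w x₀ := by
  have hcont : Continuous fun w => l w + bregman ψ w x₀ := by
    unfold bregman
    exact l.continuous.add ((hψ.1.continuous.sub continuous_const).sub
      ((fderiv ℝ ψ x₀).continuous.comp (continuous_id.sub continuous_const)))
  refine exists_forall_le_of_tendsto_norm hcont x₀
    (tendsto_mul_rpow_sub_mul_rpow zero_le_one hm (by positivity : 0 < 1 / m) ‖l‖ (-l x₀)
      (norm_nonneg l)) fun w => ?_
  have h1 := hψ.2 w x₀
  have h2 : -(‖l‖ * ‖w - x₀‖) ≤ l (w - x₀) :=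
    (abs_le.1 ((Real.norm_eq_abs _).symm.le.trans (l.le_opNorm (w - x₀)))).1
  rw [map_sub] at h2
  rw [Real.rpow_one]
  linarith [norm_nonneg l]

/-! ### The method with constant proximal parameter -/

section Method1

lemma inexactMu_eq {m r R T : ℝ} (hr : 0 < r) (hm : 0 < m) (hR : 0 < R) (hT : 0 < T) :
    inexactMu m r R T = R ^ (m - r) * T ^ (-((m - r) / m)) := by
  unfold inexactMu
  rw [Real.mul_rpow (by positivity) (by positivity), ← Real.rpow_mul hR.le, ← Real.rpow_mul hT.le]
  congr 2
  · field_simp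
  · field_simp

lemma inexactMu_pos {m r R T : ℝ} (hR : 0 < R) (hT : 0 < T) : 0 < inexactMu m r R T := by
  unfold inexactMu; positivity

lemma stepConst_eq_mul (μ r σ σ' : ℝ) : stepConst μ r σ σ' = μ * stepConst 1 r σ σ' := by
  unfold stepConst; ring

variable {E : Type} [NormedAddCommGroup E] [NormedSpace ℝ E]

/-- A `(1, m)`-uniformly convex function is inexactly uniformly convex with any smaller exponent,
by Young's inequality. -/
lemma IsInexactUniformlyConvex.of_exponent_le {ψ : E → ℝ} {m r R T : ℝ}
    (h : IsInexactUniformlyConvex 0 1 m ψ) (hr : 0 < r) (hrm : r ≤ m) (hR : 0 < R) (hT : 0 < T) :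
    IsInexactUniformlyConvex ((m - r) / (r * m) * (R ^ m / T)) (inexactMu m r R T) r ψ := by
  have hm : 0 < m := by linarith
  refine ⟨h.1, fun x y => le_trans ?_ (h.2 x y)⟩
  rw [inexactMu_eq hr hm hR hT]
  set t := ‖x - y‖
  have ht : 0 ≤ t := norm_nonneg _
  have hy := Real.geom_mean_le_arith_mean2_weighted (w₁ := r / m) (w₂ := (m - r) / m)
    (by positivity) (div_nonneg (by linarith) hm.le) (Real.rpow_nonneg ht m)
    (by positivity : 0 ≤ R ^ m / T) (by field_simp; ring)
  have e : (t ^ m) ^ (r / m) * (R ^ m / T) ^ ((m - r) / m) =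
      R ^ (m - r) * T ^ (-((m - r) / m)) * t ^ r := by
    rw [Real.div_rpow (by positivity) hT.le, ← Real.rpow_mul ht, ← Real.rpow_mul hR.le,
      mul_div_cancel₀ _ hm.ne', mul_div_cancel₀ _ hm.ne', Real.rpow_neg hT.le]
    ring
  rw [e] at hy
  have h2 : R ^ (m - r) * T ^ (-((m - r) / m)) / r * t ^ r =
      1 / r * (R ^ (m - r) * T ^ (-((m - r) / m)) * t ^ r) := by ring
  have h3 : 1 / r * (r / m * t ^ m + (m - r) / m * (R ^ m / T)) =
      1 / m * t ^ m + (m - r) / (r * m) * (R ^ m / T) := by field_simp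
  have h4 := mul_le_mul_of_nonneg_left hy (by positivity : 0 ≤ 1 / r)
  rw [h3] at h4
  rw [h2]
  linarith

variable {q : ℕ} {ν L r μ σ σ' : ℝ} {ψ : E → ℝ} {x₀ : E} {f : E → ℝ} {K : ℕ} {s : Alg1Data E}

/-- The first `K` iterations only involve the data with indices up to `K`. -/
lemma IsAlg1Run.congr {s' : Alg1Data E} (h : IsAlg1Run q ν L r μ σ σ' ψ x₀ f K s)
    (hx : ∀ i ≤ K, s'.x i = s.x i) (hy : ∀ i ≤ K, s'.y i = s.y i) (hz : ∀ i ≤ K, s'.z i = s.z i)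
    (hv : ∀ i ≤ K, s'.v i = s.v i) (ha : ∀ i ≤ K, s'.a i = s.a i)
    (hA : ∀ i ≤ K, s'.A i = s.A i) : IsAlg1Run q ν L r μ σ σ' ψ x₀ f K s' where
  y_zero := by rw [hy 0 (by omega), h.y_zero]
  z_zero := by rw [hz 0 (by omega), h.z_zero]
  A_zero := by rw [hA 0 (by omega), h.A_zero]
  A_succ k hk := by rw [hA _ (by omega), hA _ (by omega), ha _ (by omega), h.A_succ k hk]
  a_pos k hk := by rw [ha _ (by omega)]; exact h.a_pos k hk
  a_eq k hk := by rw [ha _ (by omega), hA _ (by omega)]; exact h.a_eq k hk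
  x_succ k hk := by
    rw [hx _ (by omega), hA _ (by omega), hA _ (by omega), ha _ (by omega), hy _ (by omega),
      hz _ (by omega)]
    exact h.x_succ k hk
  y_succ k hk := by rw [hx _ (by omega), hy _ (by omega)]; exact h.y_succ k hk
  v_succ k hk := by rw [hv _ (by omega), hy _ (by omega)]; exact h.v_succ k hk
  z_succ k hk w := by
    have e : ∀ w, ∑ i ∈ Finset.Icc 1 (k + 1), s'.a i * s'.v i w =
        ∑ i ∈ Finset.Icc 1 (k + 1), s.a i * s.v i w := fun w =>
      Finset.sum_congr rfl fun i hi => by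
        have := (Finset.mem_Icc.1 hi).2
        rw [ha _ (by omega), hv _ (by omega)]
    rw [e, e, hz _ (by omega)]
    exact h.z_succ k hk w

lemma IsAlg1Run.A_nonneg (h : IsAlg1Run q ν L r μ σ σ' ψ x₀ f K s) {k : ℕ} (hk : k ≤ K) :
    0 ≤ s.A k := by
  induction k with
  | zero => rw [h.A_zero]
  | succ k ih =>
    rw [h.A_succ k (by omega)]
    linarith [h.a_pos k (by omega), ih (by omega)]

lemma IsAlg1Run.transfer {g : E → ℝ} (h : IsAlg1Run q ν L r μ σ σ' ψ x₀ f K s)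
    (hS : SameAnswers q f g s.x s.y K) : IsAlg1Run q ν L r μ σ σ' ψ x₀ g K s :=
  { h with
    y_succ := fun k hk => by rw [(hS k hk).1]; exact h.y_succ k hk
    v_succ := fun k hk => by rw [(hS k hk).2.2]; exact h.v_succ k hk }

lemma IsAlg1Run.norm_add_le (h : IsAlg1Run q ν L (q + ν) μ (1 / 4) (1 / 4) ψ x₀ f K s)
    (hsm : ∀ x : E, x ≠ 0 → DifferentiableAt ℝ (‖·‖) x)
    (hq : 1 ≤ q) (hf : ContDiff ℝ q f) (hL : 0 < L) (hν : 0 < ν)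
    (hH : ∀ x y, ‖iteratedFDeriv ℝ q f x - iteratedFDeriv ℝ q f y‖ ≤ L * ‖x - y‖ ^ ν)
    {k : ℕ} (hk : k < K) :
    ‖s.v (k + 1) + (‖s.y (k + 1) - s.x (k + 1)‖ ^ ((q : ℝ) + ν - 1) / baseLam q L (1 / 4)) •
        fderiv ℝ (‖·‖) (s.y (k + 1) - s.x (k + 1))‖ ≤
      1 / 4 / baseLam q L (1 / 4) * ‖s.y (k + 1) - s.x (k + 1)‖ ^ ((q : ℝ) + ν - 1) := by
  rw [h.v_succ k hk]
  exact (h.y_succ k hk).norm_fderiv_add_le hsm hq hf hL hν hH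

lemma IsAlg1Run.isAccelProxRun (h : IsAlg1Run q ν L (q + ν) μ (1 / 4) (1 / 4) ψ x₀ f K s)
    (hsm : ∀ x : E, x ≠ 0 → DifferentiableAt ℝ (‖·‖) x)
    (hq : 1 ≤ q) (hf : ContDiff ℝ q f) (hL : 0 < L) (hν : 0 < ν) (hμ : 0 < μ)
    (hH : ∀ x y, ‖iteratedFDeriv ℝ q f x - iteratedFDeriv ℝ q f y‖ ≤ L * ‖x - y‖ ^ ν) :
    IsAccelProxRun f ψ x₀ (q + ν) μ K s.x s.y s.y s.z s.v s.a s.A s.a s.A (fun _ => 1)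
      (fun _ => baseLam q L (1 / 4)) where
  z_zero := h.z_zero
  A_zero := h.A_zero
  aHat_pos := h.a_pos
  γ_pos _ _ := one_pos
  γ_le _ _ := le_rfl
  lam_pos _ _ := baseLam_pos hL (by norm_num)
  a_eq _ _ := (one_mul _).symm
  A_succ := h.A_succ
  AHat_eq := h.A_succ
  aHat_rpow k hk := by
    have hq1 : (1 : ℝ) ≤ q := by exact_mod_cast hq
    have hC := stepConst_pos hμ (by linarith : 1 < (q : ℝ) + ν)
    have hl := baseLam_pos (q := q) hL (by norm_num : (0 : ℝ) < 1 / 4)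
    have hA := h.A_nonneg (k := k + 1) (by omega)
    rw [one_mul]
    conv_lhs => rw [h.a_eq k hk]
    rw [← Real.rpow_mul (by positivity), one_div_mul_cancel (by linarith), Real.rpow_one]
  x_eq := h.x_succ
  prox _ hk := h.norm_add_le hsm hq hf hL hν hH hk
  v_eq := h.v_succ
  y_le _ _ := by simp
  z_min := h.z_succ

lemma exists_isAlg1Run [FiniteDimensional ℝ E]
    (hsm : ∀ x : E, x ≠ 0 → DifferentiableAt ℝ (‖·‖) x)
    (hq : 1 ≤ q) (hf : ContDiff ℝ q f) (hL : 0 < L) (hν : 0 < ν) (hμ : 0 < μ)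
    {m : ℝ} (hm : 1 < m) (hψ : IsInexactUniformlyConvex 0 1 m ψ) (x₀ : E) (K : ℕ) :
    ∃ s, IsAlg1Run q ν L (q + ν) μ (1 / 4) (1 / 4) ψ x₀ f K s := by
  have hq1 : (1 : ℝ) ≤ q := by exact_mod_cast hq
  have hr : 1 < (q : ℝ) + ν := by linarith
  have hlam := baseLam_pos (q := q) hL (by norm_num : (0 : ℝ) < 1 / 4)
  have hC := stepConst_pos hμ hr
  induction K with
  | zero =>
    exact ⟨⟨fun _ => x₀, fun _ => x₀, fun _ => x₀, fun _ => 0, fun _ => 0, fun _ => 0⟩,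
      { y_zero := rfl, z_zero := rfl, A_zero := rfl,
        A_succ := fun k hk => absurd hk (by omega), a_pos := fun k hk => absurd hk (by omega),
        a_eq := fun k hk => absurd hk (by omega), x_succ := fun k hk => absurd hk (by omega),
        y_succ := fun k hk => absurd hk (by omega), v_succ := fun k hk => absurd hk (by omega),
        z_succ := fun k hk => absurd hk (by omega) }⟩
  | succ K ih =>
    obtain ⟨s, hs⟩ := ih
    obtain ⟨a, ha, hae⟩ := exists_stepSize hr (hs.A_nonneg le_rfl) (mul_pos hC hlam)
    set X := (s.A K / (a + s.A K)) • s.y K + (a / (a + s.A K)) • s.z K with hX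
    obtain ⟨Y, hY⟩ := exists_isApproxCritical hsm hq hf hL hν hlam X
    obtain ⟨Z, hZ⟩ := exists_minimizer_add_bregman hm hψ x₀
      ((∑ i ∈ Finset.Icc 1 K, s.a i • s.v i) + a • fderiv ℝ f Y)
    let s' : Alg1Data E :=
      { x := Function.update s.x (K + 1) X, y := Function.update s.y (K + 1) Y
        z := Function.update s.z (K + 1) Z, v := Function.update s.v (K + 1) (fderiv ℝ f Y)
        a := Function.update s.a (K + 1) a, A := Function.update s.A (K + 1) (a + s.A K) }
    have hne : ∀ i ≤ K, i ≠ K + 1 := fun i hi => by omega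
    have hc : IsAlg1Run q ν L (q + ν) μ (1 / 4) (1 / 4) ψ x₀ f K s' :=
      hs.congr (fun i hi => Function.update_of_ne (hne i hi) _ _)
        (fun i hi => Function.update_of_ne (hne i hi) _ _)
        (fun i hi => Function.update_of_ne (hne i hi) _ _)
        (fun i hi => Function.update_of_ne (hne i hi) _ _)
        (fun i hi => Function.update_of_ne (hne i hi) _ _)
        (fun i hi => Function.update_of_ne (hne i hi) _ _)
    have ex : s'.x (K + 1) = X := Function.update_self _ _ _
    have ey : s'.y (K + 1) = Y := Function.update_self _ _ _
    have ez : s'.z (K + 1) = Z := Function.update_self _ _ _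
    have ev : s'.v (K + 1) = fderiv ℝ f Y := Function.update_self _ _ _
    have ea : s'.a (K + 1) = a := Function.update_self _ _ _
    have eA : s'.A (K + 1) = a + s.A K := Function.update_self _ _ _
    have eAK : s'.A K = s.A K := Function.update_of_ne (hne K le_rfl) _ _
    have eyK : s'.y K = s.y K := Function.update_of_ne (hne K le_rfl) _ _
    have ezK : s'.z K = s.z K := Function.update_of_ne (hne K le_rfl) _ _
    have split : ∀ {P : ℕ → Prop}, (∀ k < K, P k) → P K → ∀ k < K + 1, P k := by
      intro P h1 h2 k hk
      rcases Nat.lt_succ_iff_lt_or_eq.1 hk with h | rfl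
      · exact h1 k h
      · exact h2
    refine ⟨s', hc.y_zero, hc.z_zero, hc.A_zero, split hc.A_succ ?_, split hc.a_pos ?_,
      split hc.a_eq ?_, split hc.x_succ ?_, split hc.y_succ ?_, split hc.v_succ ?_,
      split hc.z_succ ?_⟩
    · rw [eA, ea, eAK]
    · rw [ea]; exact ha
    · rw [ea, eA]
      conv_lhs => rw [hae]
      ring_nf
    · rw [ex, eA, ea, eAK, eyK, ezK]
    · rw [ex, ey]; exact hY
    · rw [ev, ey]
    · intro w
      have e : ∀ w, ∑ i ∈ Finset.Icc 1 (K + 1), s'.a i * s'.v i w =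
          ((∑ i ∈ Finset.Icc 1 K, s.a i • s.v i) + a • fderiv ℝ f Y) w := by
        intro w
        rw [Finset.sum_Icc_succ_top (by omega), ea, ev, _root_.add_apply, _root_.sum_apply]
        refine congrArg₂ (· + ·) (Finset.sum_congr rfl fun i hi => ?_) rfl
        have hi' := (Finset.mem_Icc.1 hi).2
        rw [show s'.a i = s.a i from Function.update_of_ne (hne i hi') _ _,
          show s'.v i = s.v i from Function.update_of_ne (hne i hi') _ _]
        rfl
      rw [e, e, ez]
      exact hZ w

/-- For a constant proximal parameter `A ^ (1 / r)` grows at least linearly. -/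
lemma IsAlg1Run.le_A (h : IsAlg1Run q ν L r μ σ σ' ψ x₀ f K s) (hr : 1 < r)
    (hκ : 0 < stepConst μ r σ σ' * baseLam q L σ) :
    stepConst μ r σ σ' * baseLam q L σ * (K / r) ^ r ≤ s.A K := by
  set κ := stepConst μ r σ σ' * baseLam q L σ with hκe
  have hr0 : 0 < r := by linarith
  have key : ∀ k ≤ K, k * (κ ^ (1 / r) / r) ≤ s.A k ^ (1 / r) := by
    intro k hk
    induction k with
    | zero => simp only [Nat.cast_zero, zero_mul]; exact Real.rpow_nonneg (h.A_nonneg hk) _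
    | succ k ih =>
      have h1 := rpow_inv_growth hr (h.A_nonneg (by omega : k ≤ K)) (h.a_pos k hk)
        (h.A_succ k hk) hκ (by
          conv_lhs => rw [h.a_eq k hk]
          rw [hκe]; ring_nf)
      have := ih (by omega)
      push_cast
      linarith
  have h1 := Real.rpow_le_rpow (by positivity) (key K le_rfl) hr0.le
  rw [← Real.rpow_mul (h.A_nonneg le_rfl), one_div_mul_cancel hr0.ne', Real.rpow_one] at h1
  refine le_trans (le_of_eq ?_) h1
  rw [show (K : ℝ) * (κ ^ (1 / r) / r) = κ ^ (1 / r) * (K / r) by ring,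
    Real.mul_rpow (by positivity) (by positivity), ← Real.rpow_mul hκ.le,
    one_div_mul_cancel hr0.ne', Real.rpow_one]

/-- The rate of the method with constant proximal parameter, for a regularizer whose divergence
from the starting point is at most `D * R ^ m`. -/
lemma IsAlg1Run.rate {m R D : ℝ} {T : ℕ}
    (h : IsAlg1Run q ν L (q + ν) (inexactMu m (q + ν) R T) (1 / 4) (1 / 4) ψ x₀ f T s)
    (hsm : ∀ x : E, x ≠ 0 → DifferentiableAt ℝ (‖·‖) x) (hfc : ConvexOn ℝ Set.univ f)
    (hq : 1 ≤ q) (hf : ContDiff ℝ q f) (hL : 0 < L) (hν : 0 < ν)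
    (hH : ∀ x y, ‖iteratedFDeriv ℝ q f x - iteratedFDeriv ℝ q f y‖ ≤ L * ‖x - y‖ ^ ν)
    (hrm : (q : ℝ) + ν ≤ m) (hψ : IsInexactUniformlyConvex 0 1 m ψ) (hR : 0 < R) (hT : 1 ≤ T)
    {xs : E} (hmin : ∀ x, f xs ≤ f x) (hD : bregman ψ xs x₀ ≤ D * R ^ m) :
    f (s.y T) - f xs ≤
      (D + 2 * ((m - (q + ν)) / ((q + ν) * m))) * (8 * ((q : ℝ) + ν) ^ ((q : ℝ) + ν)) /
        (stepConst 1 (q + ν) (1 / 4) (1 / 4) * ((q - 1).factorial : ℝ)) *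
        (L * R ^ ((q : ℝ) + ν) * (T : ℝ) ^ (-(((m + 1) * (q + ν) - m) / m))) := by
  have hq1 : (1 : ℝ) ≤ q := by exact_mod_cast hq
  have hT1 : (1 : ℝ) ≤ T := by exact_mod_cast hT
  have hT0 : (0 : ℝ) < T := by linarith
  set r := (q : ℝ) + ν with hr
  have hr1 : 1 < r := by linarith
  have hr0 : 0 < r := by linarith
  have hm0 : 0 < m := by linarith
  have hμ := inexactMu_pos (m := m) (r := r) hR hT0
  have hlam := baseLam_pos (q := q) hL (by norm_num : (0 : ℝ) < 1 / 4)
  have hC1 := stepConst_pos one_pos hr1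
  have hbound := (h.isAccelProxRun hsm hq hf hL hν hμ hH).bound hsm hfc
    (hf.differentiable (by exact_mod_cast (by omega : q ≠ 0))) hr1 hμ
    (hψ.of_exponent_le hr0 hrm hR hT0) xs
  have hsum : 0 ≤ ∑ j ∈ Finset.range T, (fun _ : ℕ => (1 : ℝ)) (j + 1) * s.A (j + 1) /
      (8 * (fun _ : ℕ => baseLam q L (1 / 4)) (j + 1)) * ‖s.y (j + 1) - s.x (j + 1)‖ ^ r :=
    Finset.sum_nonneg fun j hj => by
      have := h.A_nonneg (k := j + 1) (by have := Finset.mem_range.1 hj; omega)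
      positivity
  have hA := h.le_A hr1 (mul_pos (stepConst_pos hμ hr1) hlam)
  have hgap : 0 ≤ f (s.y T) - f xs := by linarith [hmin (s.y T)]
  -- the inexactness is of order `R ^ m / T`, so that over `T` iterations it accumulates to the same
  -- order as the initial divergence
  have hM : s.A T * (f (s.y T) - f xs) ≤ (D + 2 * ((m - r) / (r * m))) * R ^ m := by
    have h1 : ((T : ℝ) + 1) * ((m - r) / (r * m) * (R ^ m / T)) ≤
        2 * ((m - r) / (r * m)) * R ^ m := by
      have h2 : 0 ≤ (m - r) / (r * m) * R ^ m :=
        mul_nonneg (div_nonneg (by linarith) (by positivity)) (by positivity)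
      have h3 : ((T : ℝ) + 1) * ((m - r) / (r * m) * (R ^ m / T)) =
          (m - r) / (r * m) * R ^ m * ((T + 1) / T) := by ring
      have h4 : ((T : ℝ) + 1) / T ≤ 2 := by rw [div_le_iff₀ hT0]; linarith
      rw [h3]
      have := mul_le_mul_of_nonneg_left h4 h2
      linarith
    rw [add_mul]
    linarith
  have hM2 := (mul_le_mul_of_nonneg_right hA hgap).trans hM
  have hpos : 0 < stepConst (inexactMu m r R T) r (1 / 4) (1 / 4) * baseLam q L (1 / 4) *
      ((T : ℝ) / r) ^ r := by
    have := stepConst_pos hμ hr1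
    positivity
  rw [← le_div_iff₀' hpos] at hM2
  refine hM2.trans (le_of_eq ?_)
  rw [stepConst_eq_mul, inexactMu_eq hr0 hm0 hR hT0, Real.div_rpow hT0.le hr0.le]
  have e1 : R ^ m = R ^ (m - r) * R ^ r := by rw [← Real.rpow_add hR]; ring_nf
  have e2 : (T : ℝ) ^ (-(((m + 1) * r - m) / m)) *
      ((T : ℝ) ^ (-((m - r) / m)) * (T : ℝ) ^ r) = 1 := by
    rw [← Real.rpow_add hT0, ← Real.rpow_add hT0]
    have : -(((m + 1) * r - m) / m) + (-((m - r) / m) + r) = 0 := by field_simp; ring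
    rw [this, Real.rpow_zero]
  have e3 : (T : ℝ) ^ (-(((m + 1) * r - m) / m)) =
      1 / ((T : ℝ) ^ (-((m - r) / m)) * (T : ℝ) ^ r) := eq_one_div_of_mul_eq_one_left e2
  rw [e3, e1]
  unfold baseLam
  have : R ^ (m - r) ≠ 0 := by positivity
  have : r ^ r ≠ 0 := by positivity
  have : (T : ℝ) ^ r ≠ 0 := by positivity
  have : (T : ℝ) ^ (-((m - r) / m)) ≠ 0 := by positivity
  field_simp
  ring

end Method1

/-! ### The adaptive method: basic facts -/

section Method2

variable {E : Type} [NormedAddCommGroup E] [NormedSpace ℝ E]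

variable {q : ℕ} {ν L r σ σ' α : ℝ} {b : Bool} {ψ : E → ℝ} {x₀ : E} {f : E → ℝ} {K : ℕ}
  {s : Alg2Data E}

namespace IsAlg2Run

lemma lam_pos (h : IsAlg2Run q ν L r σ σ' α b ψ x₀ f K s) (hL : 0 < L) (hσ : 0 < σ) {k : ℕ}
    (hk : k < K) : 0 < s.lam (k + 1) := by
  rw [h.lam_succ k hk]
  have := baseLam_pos (q := q) hL hσ
  have := norm_pos_iff.2 (sub_ne_zero.2 (h.yt_ne k hk))
  positivity

lemma lamHat_pos (h : IsAlg2Run q ν L r σ σ' α b ψ x₀ f K s) (hL : 0 < L) (hσ : 0 < σ)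
    (hα : 0 < α) {k : ℕ} (hK : 0 < K) (hk : k ≤ K) : 0 < s.lamHat (k + 1) := by
  induction k with
  | zero => rw [zero_add, h.lamHat_one hK]; exact h.lam_pos hL hσ hK
  | succ k ih =>
    have := ih (by omega)
    rw [h.lamHat_succ k (by omega)]
    split_ifs <;> positivity

lemma γ_pos (h : IsAlg2Run q ν L r σ σ' α b ψ x₀ f K s) (hL : 0 < L) (hσ : 0 < σ) (hα : 0 < α)
    {k : ℕ} (hk : k < K) : 0 < s.γ (k + 1) := by
  rw [h.γ_succ k hk]
  exact lt_min (div_pos (h.lam_pos hL hσ hk) (h.lamHat_pos hL hσ hα (by omega) hk.le)) one_pos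

lemma γ_le (h : IsAlg2Run q ν L r σ σ' α b ψ x₀ f K s) {k : ℕ} (hk : k < K) :
    s.γ (k + 1) ≤ 1 := by
  rw [h.γ_succ k hk]
  exact min_le_right _ _

lemma A_nonneg (h : IsAlg2Run q ν L r σ σ' α b ψ x₀ f K s) (hL : 0 < L) (hσ : 0 < σ)
    (hα : 0 < α) {k : ℕ} (hk : k ≤ K) : 0 ≤ s.A k := by
  induction k with
  | zero => rw [h.A_zero]
  | succ k ih =>
    rw [h.A_succ k (by omega), h.a_succ k (by omega)]
    have := h.γ_pos hL hσ hα (k := k) (by omega)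
    have := (h.extrapolate k (by omega)).aHat_pos
    have := ih (by omega)
    positivity

/-- The damped weight is the corresponding mixture of the old weight and the tentative one. -/
lemma A_succ_eq (h : IsAlg2Run q ν L r σ σ' α b ψ x₀ f K s) {k : ℕ} (hk : k < K) :
    s.A (k + 1) = (1 - s.γ (k + 1)) * s.A k + s.γ (k + 1) * s.AHat (k + 1) := by
  rw [h.A_succ k hk, h.a_succ k hk, (h.extrapolate k hk).AHat_eq]
  ring

lemma A_succ_pos (h : IsAlg2Run q ν L r σ σ' α b ψ x₀ f K s) (hL : 0 < L) (hσ : 0 < σ)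
    (hα : 0 < α) {k : ℕ} (hk : k < K) : 0 < s.A (k + 1) := by
  rw [h.A_succ k hk, h.a_succ k hk]
  have := h.γ_pos hL hσ hα hk
  have := (h.extrapolate k hk).aHat_pos
  have := h.A_nonneg hL hσ hα hk.le
  positivity

lemma norm_add_le (h : IsAlg2Run q ν L r (1 / 4) σ' α b ψ x₀ f K s)
    (hsm : ∀ x : E, x ≠ 0 → DifferentiableAt ℝ (‖·‖) x)
    (hq : 1 ≤ q) (hf : ContDiff ℝ q f) (hL : 0 < L) (hν : 0 < ν)
    (hH : ∀ x y, ‖iteratedFDeriv ℝ q f x - iteratedFDeriv ℝ q f y‖ ≤ L * ‖x - y‖ ^ ν)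
    {k : ℕ} (hk : k < K) :
    ‖s.v (k + 1) + (‖s.yt (k + 1) - s.x (k + 1)‖ ^ (r - 1) / s.lam (k + 1)) •
        fderiv ℝ (‖·‖) (s.yt (k + 1) - s.x (k + 1))‖ ≤
      1 / 4 / s.lam (k + 1) * ‖s.yt (k + 1) - s.x (k + 1)‖ ^ (r - 1) := by
  have hn := norm_pos_iff.2 (sub_ne_zero.2 (h.yt_ne k hk))
  have h1 := (h.yt_succ k hk).norm_fderiv_add_le hsm hq hf hL hν hH
  rw [div_mul_eq_mul_div, mul_div_assoc] at h1 ⊢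
  rw [h.v_succ k hk, h.lam_succ k hk, rpow_div_mul_rpow_sub hn]
  exact h1

lemma isAccelProxRun (h : IsAlg2Run q ν L r (1 / 4) (1 / 4) α b ψ x₀ f K s)
    (hsm : ∀ x : E, x ≠ 0 → DifferentiableAt ℝ (‖·‖) x) (hfc : ConvexOn ℝ Set.univ f)
    (hq : 1 ≤ q) (hf : ContDiff ℝ q f) (hL : 0 < L) (hν : 0 < ν) (hr : 1 < r) (hα : 0 < α)
    (hH : ∀ x y, ‖iteratedFDeriv ℝ q f x - iteratedFDeriv ℝ q f y‖ ≤ L * ‖x - y‖ ^ ν) :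
    IsAccelProxRun f ψ x₀ r 1 K s.x s.y s.yt s.z s.v s.a s.A s.aHat s.AHat s.γ s.lam where
  z_zero := h.z_zero
  A_zero := h.A_zero
  aHat_pos k hk := (h.extrapolate k hk).aHat_pos
  γ_pos _ hk := h.γ_pos hL (by norm_num) hα hk
  γ_le _ hk := h.γ_le hk
  lam_pos _ hk := h.lam_pos hL (by norm_num) hk
  a_eq := h.a_succ
  A_succ := h.A_succ
  AHat_eq k hk := (h.extrapolate k hk).AHat_eq
  aHat_rpow k hk := by
    have hC := stepConst_pos one_pos hr
    have hl := h.lam_pos hL (by norm_num) hk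
    have hlH := h.lamHat_pos hL (by norm_num) hα (by omega) hk.le
    have hA := h.A_nonneg hL (by norm_num) hα hk.le
    have he := h.extrapolate k hk
    have hAH : 0 < s.AHat (k + 1) := by rw [he.AHat_eq]; linarith [he.aHat_pos]
    have hpow : s.aHat (k + 1) ^ r =
        stepConst 1 r (1 / 4) (1 / 4) * s.AHat (k + 1) ^ (r - 1) * s.lamHat (k + 1) := by
      conv_lhs => rw [he.aHat_eq]
      rw [← Real.rpow_mul (by positivity), one_div_mul_cancel (by linarith), Real.rpow_one]
    have hγ : s.γ (k + 1) * s.lamHat (k + 1) ≤ s.lam (k + 1) := by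
      rw [h.γ_succ k hk, ← le_div_iff₀ hlH]
      exact min_le_left _ _
    rw [hpow]
    have := mul_le_mul_of_nonneg_left hγ
      (by positivity : 0 ≤ stepConst 1 r (1 / 4) (1 / 4) * s.AHat (k + 1) ^ (r - 1))
    linarith
  x_eq k hk := (h.extrapolate k hk).x_eq
  prox _ hk := h.norm_add_le hsm hq hf hL hν hH hk
  v_eq := h.v_succ
  y_le k hk := by
    have hA := h.A_nonneg hL (by norm_num) hα hk.le
    have hA' := h.A_succ_pos hL (by norm_num) hα hk
    have hγ := h.γ_pos hL (by norm_num) hα hk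
    have hγ1 := h.γ_le hk
    have he := h.extrapolate k hk
    have hAH : 0 < s.AHat (k + 1) := by rw [he.AHat_eq]; linarith [he.aHat_pos]
    have hsum := h.A_succ_eq hk
    have hrule := h.y_succ k hk
    have hw1 : 0 ≤ (1 - s.γ (k + 1)) * s.A k := mul_nonneg (by linarith) hA
    have hw2 : 0 ≤ s.γ (k + 1) * s.AHat (k + 1) := by positivity
    unfold Alg2YRule at hrule
    split_ifs at hrule with hb
    · rw [hsum, add_mul]
      exact add_le_add (mul_le_mul_of_nonneg_left hrule.2.2 hw1)
        (mul_le_mul_of_nonneg_left hrule.2.1 hw2)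
    · have hc := hfc.2 (Set.mem_univ (s.y k)) (Set.mem_univ (s.yt (k + 1)))
        (div_nonneg hw1 hA'.le) (div_nonneg hw2 hA'.le)
        (by rw [← add_div, ← hsum, div_self hA'.ne'])
      rw [← hrule, smul_eq_mul, smul_eq_mul] at hc
      have := mul_le_mul_of_nonneg_left hc hA'.le
      refine this.trans (le_of_eq ?_)
      field_simp
  z_min := h.z_succ

/-! ### The adaptive method: growth of the weights -/

/-- Partial sums of `lamHat ^ (1 / r)`. -/
def sumRoot (s : Alg2Data E) (r : ℝ) (k : ℕ) : ℝ :=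
  ∑ j ∈ Finset.range k, s.lamHat (j + 1) ^ (1 / r)

/-- Iteration `j + 1` is good if its tentative parameter was overestimated, or if `j = 0`. In a good
iteration the length of the proximal step controls the tentative parameter from below. -/
def goodSet (s : Alg2Data E) (k : ℕ) : Finset ℕ :=
  {j ∈ Finset.range k | j = 0 ∨ s.lam (j + 1) < s.lamHat (j + 1)}

/-- The ratio between `A ^ (1 / r)` and `sumRoot`, up to the factor `C ^ (1 / r) / r`. -/
def rootRatio (α r : ℝ) : ℝ :=
  1 + α ^ (1 / r) / (α ^ (1 / r) - 1) * α ^ (1 / r)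

lemma rootRatio_pos (hα : 1 < α) (hr : 0 < r) : 0 < rootRatio α r := by
  have h1 : 1 < α ^ (1 / r) := Real.one_lt_rpow hα (by positivity)
  have : 0 < α ^ (1 / r) - 1 := by linarith
  unfold rootRatio
  positivity

/-- In an iteration whose tentative parameter was not overestimated, `A ^ (1 / r)` grows. -/
lemma growth_of_le (h : IsAlg2Run q ν L r σ σ' α b ψ x₀ f K s) (hL : 0 < L) (hσ : 0 < σ)
    (hα : 0 < α) (hr : 1 < r) (hC : 0 < stepConst 1 r σ σ') {k : ℕ} (hk : k < K)
    (hup : s.lamHat (k + 1) ≤ s.lam (k + 1)) :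
    s.A k ^ (1 / r) + stepConst 1 r σ σ' ^ (1 / r) / r * s.lamHat (k + 1) ^ (1 / r) ≤
      s.A (k + 1) ^ (1 / r) := by
  have hlH := h.lamHat_pos hL hσ hα (by omega) hk.le
  have he := h.extrapolate k hk
  have hγ : s.γ (k + 1) = 1 := by
    rw [h.γ_succ k hk]
    exact min_eq_right ((one_le_div hlH).2 hup)
  have hA : s.A (k + 1) = s.aHat (k + 1) + s.A k := by
    rw [h.A_succ k hk, h.a_succ k hk, hγ, one_mul]
  have h1 := rpow_inv_growth hr (h.A_nonneg hL hσ hα hk.le) he.aHat_pos hA (mul_pos hC hlH) (by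
    conv_lhs => rw [he.aHat_eq]
    rw [he.AHat_eq, hA]
    ring_nf)
  rw [Real.mul_rpow hC.le hlH.le] at h1
  refine le_trans (le_of_eq ?_) h1
  ring

/-- Overestimated tentative parameters decay geometrically until the next iteration in which
`A ^ (1 / r)` grows, so that these iterations dominate the whole sum `sumRoot`. -/
lemma sumRoot_le (h : IsAlg2Run q ν L r σ σ' α b ψ x₀ f K s) (hL : 0 < L) (hσ : 0 < σ)
    (hα : 1 < α) (hr : 1 < r) (hC : 0 < stepConst 1 r σ σ') {k : ℕ} (hk : k ≤ K) :
    stepConst 1 r σ σ' ^ (1 / r) / r / rootRatio α r * sumRoot s r k ≤ s.A k ^ (1 / r) := by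
  have hr0 : 0 < r := by linarith
  have hα0 : 0 < α := by linarith
  set β := α ^ (1 / r) with hβ
  have hβ1 : 1 < β := Real.one_lt_rpow hα (by positivity)
  have hβ2 : 0 < β - 1 := by linarith
  set g := stepConst 1 r σ σ' ^ (1 / r) / r with hg
  have hg0 : 0 < g := by positivity
  set c := β / (β - 1) with hc
  have hc0 : 0 < c := by positivity
  have hcβ : c * (β - 1) = β := by rw [hc]; field_simp
  have hratio : rootRatio α r = 1 + c * β := rfl
  have hR := rootRatio_pos (α := α) (r := r) hα hr0
  have hmono : ∀ k < K, s.A k ^ (1 / r) ≤ s.A (k + 1) ^ (1 / r) := by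
    intro k hk
    have h1 := h.γ_pos hL hσ hα0 hk
    have h2 := (h.extrapolate k hk).aHat_pos
    refine Real.rpow_le_rpow (h.A_nonneg hL hσ hα0 hk.le) ?_ (by positivity)
    rw [h.A_succ k hk, h.a_succ k hk]
    have := mul_pos h1 h2
    linarith
  -- `c * lamHat ^ (1 / r)` is the sum over all later iterations if all of them decrease `lamHat`
  have key : ∀ k, k + 1 ≤ K → g * (sumRoot s r (k + 1) + c * s.lamHat (k + 2) ^ (1 / r)) ≤
      rootRatio α r * s.A (k + 1) ^ (1 / r) := by
    intro k hk
    induction k with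
    | zero =>
      have hup : s.lamHat (0 + 1) ≤ s.lam (0 + 1) := (h.lamHat_one (by omega)).le
      have h1 := h.growth_of_le hL hσ hα0 hr hC (by omega) hup
      have hlH := h.lamHat_pos hL hσ hα0 (k := 0) (by omega) (by omega)
      have h2 := h.lamHat_succ 0 (by omega)
      rw [if_pos hup] at h2
      rw [h2, Real.mul_rpow hα0.le hlH.le, ← hβ]
      rw [h.A_zero, Real.zero_rpow (by positivity), zero_add] at h1
      have h3 := mul_le_mul_of_nonneg_left h1 hR.le
      refine le_trans (le_of_eq ?_) h3
      rw [hratio]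
      simp only [sumRoot, zero_add, Finset.range_one, Finset.sum_singleton]
      ring
    | succ k ih =>
      have h1 := ih (by omega)
      have hlH := h.lamHat_pos hL hσ hα0 (k := k + 1) (by omega) (by omega)
      have h2 := h.lamHat_succ (k + 1) (by omega)
      have hs : sumRoot s r (k + 1 + 1) = sumRoot s r (k + 1) + s.lamHat (k + 2) ^ (1 / r) :=
        Finset.sum_range_succ _ _
      have hx : 0 ≤ s.lamHat (k + 2) ^ (1 / r) := Real.rpow_nonneg hlH.le _
      rw [hs, h2]
      by_cases hup : s.lamHat (k + 1 + 1) ≤ s.lam (k + 1 + 1)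
      · have h3 := h.growth_of_le hL hσ hα0 hr hC (by omega) hup
        have h4 := mul_le_mul_of_nonneg_left h3 hR.le
        rw [if_pos hup, Real.mul_rpow hα0.le hlH.le, ← hβ]
        have h5 : g * (sumRoot s r (k + 1) + s.lamHat (k + 2) ^ (1 / r) +
            c * (β * s.lamHat (k + 1 + 1) ^ (1 / r))) =
            g * (sumRoot s r (k + 1) + c * s.lamHat (k + 2) ^ (1 / r)) +
              rootRatio α r * (g * s.lamHat (k + 1 + 1) ^ (1 / r)) -
              g * c * s.lamHat (k + 2) ^ (1 / r) := by
          rw [hratio]; ring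
        have h6 : 0 ≤ g * c * s.lamHat (k + 2) ^ (1 / r) := by positivity
        linarith
      · have h3 := mul_le_mul_of_nonneg_left (hmono (k + 1) (by omega)) hR.le
        rw [if_neg hup, Real.mul_rpow (by positivity) hlH.le, Real.inv_rpow hα0.le, ← hβ]
        refine le_trans (le_of_eq ?_) (h1.trans h3)
        have h4 : 1 + c * β⁻¹ = c := by
          rw [hc]; field_simp; ring
        have h5 : sumRoot s r (k + 1) + s.lamHat (k + 2) ^ (1 / r) +
            c * (β⁻¹ * s.lamHat (k + 1 + 1) ^ (1 / r)) =
            sumRoot s r (k + 1) + (1 + c * β⁻¹) * s.lamHat (k + 2) ^ (1 / r) := by ring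
        rw [h5, h4]
  rw [div_mul_eq_mul_div, div_le_iff₀ hR]
  rcases k with _ | k
  · simp only [sumRoot, Finset.range_zero, Finset.sum_empty, mul_zero]
    exact mul_nonneg (Real.rpow_nonneg (h.A_nonneg hL hσ hα0 hk) _) hR.le
  · have h1 := key k hk
    have hlH := h.lamHat_pos hL hσ hα0 (k := k + 1) (by omega) hk
    have h2 : 0 ≤ g * (c * s.lamHat (k + 2) ^ (1 / r)) := by positivity
    rw [mul_add] at h1
    linarith

/-- In a good iteration the progress of the proximal step bounds `A * lamHat ^ (-e)`. -/
lemma le_of_mem_goodSet (h : IsAlg2Run q ν L r σ σ' α b ψ x₀ f K s) (hL : 0 < L) (hσ : 0 < σ)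
    (hα : 0 < α) {e : ℝ} (he : 1 < e) {j : ℕ} (hj : j ∈ goodSet s K) :
    s.A (j + 1) * s.lamHat (j + 1) ^ (-e) ≤
      s.γ (j + 1) * s.AHat (j + 1) * s.lam (j + 1) ^ (-e) := by
  obtain ⟨hjK, hj'⟩ := Finset.mem_filter.1 hj
  have hk : j < K := Finset.mem_range.1 hjK
  have hl := h.lam_pos hL hσ hk
  have hlH := h.lamHat_pos hL hσ hα (by omega) hk.le
  have hA := h.A_nonneg hL hσ hα hk.le
  have hex := h.extrapolate j hk
  have hAH : 0 < s.AHat (j + 1) := by rw [hex.AHat_eq]; linarith [hex.aHat_pos]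
  have hγ1 := h.γ_le hk
  have hAA : s.A (j + 1) ≤ s.AHat (j + 1) := by
    rw [h.A_succ j hk, h.a_succ j hk, hex.AHat_eq]
    have := mul_le_of_le_one_left hex.aHat_pos.le hγ1
    linarith
  rcases lt_or_ge (s.lam (j + 1)) (s.lamHat (j + 1)) with hlt | hge
  · have hγ : s.γ (j + 1) = s.lam (j + 1) / s.lamHat (j + 1) := by
      rw [h.γ_succ j hk]
      exact min_eq_left ((div_le_one hlH).2 hlt.le)
    have e1 : s.lamHat (j + 1) ^ (-e) = s.lamHat (j + 1) ^ (1 - e) / s.lamHat (j + 1) := by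
      rw [← Real.rpow_sub_one hlH.ne']; ring_nf
    have e2 : s.lam (j + 1) ^ (1 - e) = s.lam (j + 1) * s.lam (j + 1) ^ (-e) := by
      rw [sub_eq_add_neg, Real.rpow_add hl, Real.rpow_one]
    have e3 : s.lamHat (j + 1) ^ (1 - e) ≤ s.lam (j + 1) ^ (1 - e) :=
      Real.rpow_le_rpow_of_nonpos hl hlt.le (by linarith)
    rw [hγ, e1]
    calc s.A (j + 1) * (s.lamHat (j + 1) ^ (1 - e) / s.lamHat (j + 1))
        ≤ s.AHat (j + 1) * (s.lam (j + 1) ^ (1 - e) / s.lamHat (j + 1)) := by gcongr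
      _ = _ := by rw [e2]; ring
  · have hj0 : j = 0 := by
      rcases hj' with h0 | h0
      · exact h0
      · exact absurd h0 (not_lt.2 hge)
    subst hj0
    have hlam : s.lamHat (0 + 1) = s.lam (0 + 1) := h.lamHat_one (by omega)
    have hγ : s.γ (0 + 1) = 1 := by
      rw [h.γ_succ 0 hk]
      exact min_eq_right ((one_le_div hlH).2 hge)
    rw [hγ, one_mul, hlam]
    gcongr

/-- Few good iterations make the tentative parameter large. -/
lemma lamHat_ge (h : IsAlg2Run q ν L r σ σ' α b ψ x₀ f K s) (hL : 0 < L) (hσ : 0 < σ)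
    (hα : 1 < α) (hK : 0 < K) {k : ℕ} (hk : k ≤ K) :
    s.lamHat 1 * α ^ ((k : ℝ) - 2 * (goodSet s k).card) ≤ s.lamHat (k + 1) := by
  have hα0 : 0 < α := by linarith
  induction k with
  | zero => simp [goodSet]
  | succ k ih =>
    have h1 := ih (by omega)
    have hlH := h.lamHat_pos hL hσ hα0 hK (k := k) (by omega)
    have hlH1 := h.lamHat_pos hL hσ hα0 hK (k := 0) (by omega)
    rw [zero_add] at hlH1
    have h2 := h.lamHat_succ k (by omega)
    rw [show k + 1 + 1 = k + 2 from rfl, h2]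
    have hαinv : α⁻¹ ≤ α := (inv_le_one_of_one_le₀ hα.le).trans hα.le
    by_cases hgood : k = 0 ∨ s.lam (k + 1) < s.lamHat (k + 1)
    · have hcard : (goodSet s (k + 1)).card = (goodSet s k).card + 1 := by
        unfold goodSet
        rw [Finset.range_add_one, Finset.filter_insert, if_pos hgood,
          Finset.card_insert_of_notMem (by simp)]
      have h3 : α⁻¹ * s.lamHat (k + 1) ≤
          if s.lamHat (k + 1) ≤ s.lam (k + 1) then α * s.lamHat (k + 1)
            else α⁻¹ * s.lamHat (k + 1) := by
        split_ifs
        · gcongr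
        · exact le_rfl
      refine le_trans ?_ h3
      have e : ((k + 1 : ℕ) : ℝ) - 2 * ((goodSet s (k + 1)).card : ℝ) =
          ((k : ℝ) - 2 * (goodSet s k).card) - 1 := by
        rw [hcard]; push_cast; ring
      rw [e, Real.rpow_sub_one hα0.ne', div_eq_inv_mul]
      calc _ = α⁻¹ * (s.lamHat 1 * α ^ ((k : ℝ) - 2 * (goodSet s k).card)) := by ring
        _ ≤ _ := by gcongr
    · have hcard : (goodSet s (k + 1)).card = (goodSet s k).card := by
        unfold goodSet
        rw [Finset.range_add_one, Finset.filter_insert, if_neg hgood]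
      push Not at hgood
      rw [if_pos hgood.2, hcard]
      have e : ((k + 1 : ℕ) : ℝ) - 2 * ((goodSet s k).card : ℝ) =
          ((k : ℝ) - 2 * (goodSet s k).card) + 1 := by
        push_cast; ring
      rw [e, Real.rpow_add_one hα0.ne']
      calc _ = α * (s.lamHat 1 * α ^ ((k : ℝ) - 2 * (goodSet s k).card)) := by ring
        _ ≤ _ := by gcongr

end IsAlg2Run

end Method2

/-! ### The adaptive method: polynomial growth -/

/-- A discrete reverse Hölder inequality. If the partial sums `X` of positive numbers `x` satisfy
`∑ X ^ r x ^ (-r e) ≤ B` over a set of indices, then the total sum is large in terms of the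
cardinality of that set. With `β = 1 - 1 / e`, the weighted product of `X ^ r x ^ (-r e)` and of
`x X ^ (β - 1)` is `1`, and the second factor telescopes. -/
lemma mul_rpow_le_sum_rpow {T : ℕ} {x : ℕ → ℝ} (hx : ∀ j < T, 0 < x j) {r e B : ℝ} (hr : 0 < r)
    (he : 1 < e) (hB : 0 < B) {G : Finset ℕ} (hG : G ⊆ Finset.range T) (hne : G.Nonempty)
    (h : ∑ j ∈ G, (∑ i ∈ Finset.range (j + 1), x i) ^ r * x j ^ (-(r * e)) ≤ B) :
    (1 - 1 / e) * ((G.card : ℝ) * ((G.card : ℝ) / B) ^ (1 / (r * e))) ≤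
      (∑ i ∈ Finset.range T, x i) ^ (1 - 1 / e) := by
  have he0 : 0 < e := by linarith
  have hre : 0 < r * e := by positivity
  set β := 1 - 1 / e with hβ
  have hβ0 : 0 < β := by
    have : 1 / e < 1 := by rw [div_lt_one he0]; exact he
    rw [hβ]; linarith
  have hβ1 : β ≤ 1 := by
    have : 0 < 1 / e := by positivity
    rw [hβ]; linarith
  let X : ℕ → ℝ := fun k => ∑ i ∈ Finset.range k, x i
  have hXs : ∀ k, X (k + 1) = X k + x k := fun k => Finset.sum_range_succ _ _
  have hX0 : ∀ k ≤ T, 0 ≤ X k := fun k hk =>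
    Finset.sum_nonneg fun i hi => (hx i (by have := Finset.mem_range.1 hi; omega)).le
  have hXpos : ∀ k < T, 0 < X (k + 1) := fun k hk => by
    rw [hXs]; linarith [hX0 k hk.le, hx k hk]
  have htel : ∀ k ≤ T, β * ∑ j ∈ Finset.range k, x j * X (j + 1) ^ (β - 1) ≤ X k ^ β := by
    intro k hk
    induction k with
    | zero => simp [X, Real.zero_rpow hβ0.ne']
    | succ k ih =>
      have h1 := rpow_add_mul_sub_le (hX0 k (by omega)) (hXpos k hk) hβ0.le hβ1
      rw [show X (k + 1) - X k = x k by rw [hXs]; ring] at h1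
      rw [Finset.sum_range_succ, mul_add]
      linarith [ih (by omega)]
  set D : ℝ := (G.card : ℝ) with hD
  have hD0 : 0 < D := by rw [hD]; exact_mod_cast hne.card_pos
  set w₁ := 1 / (1 + r * e) with hw₁
  set w₂ := r * e / (1 + r * e) with hw₂
  have hw10 : 0 < w₁ := by positivity
  have hw20 : 0 < w₂ := by positivity
  have hw : w₁ + w₂ = 1 := by rw [hw₁, hw₂]; field_simp
  set η := D / B with hη
  have hη0 : 0 < η := by positivity
  set η' := η ^ (-(1 / (r * e))) with hη'
  have hη'0 : 0 < η' := by positivity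
  have hpt : ∀ j ∈ G, 1 ≤ w₁ * (η * (X (j + 1) ^ r * x j ^ (-(r * e)))) +
      w₂ * (η' * (x j * X (j + 1) ^ (β - 1))) := by
    intro j hj
    have hjT := Finset.mem_range.1 (hG hj)
    have hxj := hx j hjT
    have hXj := hXpos j hjT
    have hg := Real.geom_mean_le_arith_mean2_weighted hw10.le hw20.le
      (by positivity : 0 ≤ η * (X (j + 1) ^ r * x j ^ (-(r * e))))
      (by positivity : 0 ≤ η' * (x j * X (j + 1) ^ (β - 1))) hw
    refine le_trans (le_of_eq ?_) hg
    rw [hη', Real.mul_rpow hη0.le (by positivity), Real.mul_rpow (by positivity) (by positivity),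
      Real.mul_rpow (by positivity) (by positivity), Real.mul_rpow hxj.le (by positivity),
      ← Real.rpow_mul hη0.le, ← Real.rpow_mul hXj.le, ← Real.rpow_mul hXj.le,
      ← Real.rpow_mul hxj.le]
    have e1 : η ^ w₁ * η ^ (-(1 / (r * e)) * w₂) = 1 := by
      rw [← Real.rpow_add hη0, hw₁, hw₂]
      have : 1 / (1 + r * e) + -(1 / (r * e)) * (r * e / (1 + r * e)) = 0 := by
        field_simp; ring
      rw [this, Real.rpow_zero]
    have e2 : X (j + 1) ^ (r * w₁) * X (j + 1) ^ ((β - 1) * w₂) = 1 := by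
      rw [← Real.rpow_add hXj, hw₁, hw₂, hβ]
      have : r * (1 / (1 + r * e)) + (1 - 1 / e - 1) * (r * e / (1 + r * e)) = 0 := by
        field_simp; ring
      rw [this, Real.rpow_zero]
    have e3 : x j ^ (-(r * e) * w₁) * x j ^ w₂ = 1 := by
      rw [← Real.rpow_add hxj, hw₁, hw₂]
      have : -(r * e) * (1 / (1 + r * e)) + r * e / (1 + r * e) = 0 := by
        field_simp; ring
      rw [this, Real.rpow_zero]
    calc (1 : ℝ) = (η ^ w₁ * η ^ (-(1 / (r * e)) * w₂)) *
          (X (j + 1) ^ (r * w₁) * X (j + 1) ^ ((β - 1) * w₂)) *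
          (x j ^ (-(r * e) * w₁) * x j ^ w₂) := by rw [e1, e2, e3]; norm_num
      _ = _ := by ring
  have hsum : D ≤ w₁ * (η * ∑ j ∈ G, X (j + 1) ^ r * x j ^ (-(r * e))) +
      w₂ * (η' * ∑ j ∈ G, x j * X (j + 1) ^ (β - 1)) := by
    have h1 := Finset.sum_le_sum hpt
    rw [Finset.sum_const, nsmul_eq_mul, mul_one, Finset.sum_add_distrib, ← Finset.mul_sum,
      ← Finset.mul_sum, ← Finset.mul_sum, ← Finset.mul_sum] at h1
    exact h1
  have hGv : ∑ j ∈ G, x j * X (j + 1) ^ (β - 1) ≤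
      ∑ j ∈ Finset.range T, x j * X (j + 1) ^ (β - 1) :=
    Finset.sum_le_sum_of_subset_of_nonneg hG fun j hj _ => by
      have hjT := Finset.mem_range.1 hj
      have := hx j hjT
      have := hXpos j hjT
      positivity
  have h1 : w₁ * (η * ∑ j ∈ G, X (j + 1) ^ r * x j ^ (-(r * e))) ≤ w₁ * D := by
    refine mul_le_mul_of_nonneg_left ?_ hw10.le
    calc η * ∑ j ∈ G, X (j + 1) ^ r * x j ^ (-(r * e)) ≤ η * B :=
          mul_le_mul_of_nonneg_left h hη0.le
      _ = D := by rw [hη]; field_simp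
  have h2 : β * ∑ j ∈ G, x j * X (j + 1) ^ (β - 1) ≤ X T ^ β :=
    (mul_le_mul_of_nonneg_left hGv hβ0.le).trans (htel T le_rfl)
  have h3 : w₂ * D ≤ w₂ * (η' * ∑ j ∈ G, x j * X (j + 1) ^ (β - 1)) := by
    have : w₂ * D = D - w₁ * D := by rw [← one_sub_mul, ← hw]; ring
    linarith
  have h4 : D ≤ η' * ∑ j ∈ G, x j * X (j + 1) ^ (β - 1) := le_of_mul_le_mul_left h3 hw20
  have h5 : η' * η ^ (1 / (r * e)) = 1 := by
    rw [hη', ← Real.rpow_add hη0, neg_add_cancel, Real.rpow_zero]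
  have hη1 : 0 < η ^ (1 / (r * e)) := by positivity
  calc β * (D * η ^ (1 / (r * e)))
      ≤ β * ((η' * ∑ j ∈ G, x j * X (j + 1) ^ (β - 1)) * η ^ (1 / (r * e))) := by gcongr
    _ = (η' * η ^ (1 / (r * e))) * (β * ∑ j ∈ G, x j * X (j + 1) ^ (β - 1)) := by ring
    _ = β * ∑ j ∈ G, x j * X (j + 1) ^ (β - 1) := by rw [h5, one_mul]
    _ ≤ X T ^ β := h2

lemma exists_mul_rpow_le_rpow {α : ℝ} (hα : 1 < α) (ρ : ℝ) :
    ∃ c : ℝ, 0 < c ∧ ∀ T : ℕ, 1 ≤ T → c * (T : ℝ) ^ ρ ≤ α ^ ((T : ℝ) / 2) := by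
  obtain ⟨n, hn⟩ := exists_nat_ge ρ
  have hα0 : 0 < α := by linarith
  have hb : 0 < Real.log α / 2 := by have := Real.log_pos hα; positivity
  refine ⟨(Real.log α / 2) ^ n / n.factorial, by positivity, fun T hT => ?_⟩
  have hT1 : (1 : ℝ) ≤ T := by exact_mod_cast hT
  have h1 : (T : ℝ) ^ ρ ≤ (T : ℝ) ^ n := by
    rw [← Real.rpow_natCast]
    exact Real.rpow_le_rpow_of_exponent_le hT1 hn
  have h2 := Real.pow_div_factorial_le_exp (Real.log α / 2 * T) (by positivity) n
  calc (Real.log α / 2) ^ n / n.factorial * (T : ℝ) ^ ρ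
      ≤ (Real.log α / 2) ^ n / n.factorial * (T : ℝ) ^ n := by gcongr
    _ = (Real.log α / 2 * T) ^ n / n.factorial := by rw [mul_pow]; ring
    _ ≤ _ := h2
    _ = α ^ ((T : ℝ) / 2) := by rw [Real.rpow_def_of_pos hα0]; ring_nf

namespace IsAlg2Run

variable {E : Type} [NormedAddCommGroup E] [NormedSpace ℝ E]
  {q : ℕ} {ν L r σ σ' α : ℝ} {b : Bool} {ψ : E → ℝ} {x₀ : E} {f : E → ℝ} {T : ℕ}
  {s : Alg2Data E}

/-- The weights grow polynomially: if at least a quarter of the iterations are good, by the reverse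
Hölder inequality, and otherwise even exponentially because the tentative parameter does. -/
lemma le_A (h : IsAlg2Run q ν L r σ σ' α b ψ x₀ f T s) (hL : 0 < L) (hσ : 0 < σ)
    (hα : 1 < α) (hr : 1 < r) (hC : 0 < stepConst 1 r σ σ') (hT : 1 ≤ T) {e B c₁ c₂ : ℝ}
    (he : 1 < e) (hB : 0 < B)
    (hsum : ∑ j ∈ Finset.range T, s.γ (j + 1) * s.AHat (j + 1) * s.lam (j + 1) ^ (-e) ≤ B)
    (hc₁ : c₁ = stepConst 1 r σ σ' ^ (1 / r) / r / rootRatio α r)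
    (hexp : c₂ * (T : ℝ) ^ ((r * e + 1) / (e - 1)) ≤ α ^ ((T : ℝ) / 2)) :
    c₁ ^ r * min ((1 - 1 / e) ^ (r * e / (e - 1)) * (1 / 4) ^ ((r * e + 1) / (e - 1))) (c₂ / α) *
      ((T : ℝ) ^ ((r * e + 1) / (e - 1)) * (B / c₁ ^ r) ^ (-(1 / (e - 1)))) ≤ s.A T := by
  have hr0 : 0 < r := by linarith
  have hα0 : 0 < α := by linarith
  have he1 : 0 < e - 1 := by linarith
  have he0 : 0 < e := by linarith
  have hT0 : (0 : ℝ) < T := by exact_mod_cast hT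
  have hc10 : 0 < c₁ := by
    have := rootRatio_pos (α := α) (r := r) hα hr0
    rw [hc₁]; positivity
  have hlH : ∀ j < T, 0 < s.lamHat (j + 1) := fun j hj => h.lamHat_pos hL hσ hα0 (by omega) hj.le
  set ρ := (r * e + 1) / (e - 1) with hρ
  set B' := B / c₁ ^ r with hB'
  have hB'0 : 0 < B' := by positivity
  -- the weights in terms of the partial sums of `lamHat ^ (1 / r)`
  have hA : ∀ k ≤ T, c₁ ^ r * sumRoot s r k ^ r ≤ s.A k := by
    intro k hk
    have h1 := h.sumRoot_le hL hσ hα hr hC hk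
    have hs0 : 0 ≤ sumRoot s r k := Finset.sum_nonneg fun j hj =>
      Real.rpow_nonneg (hlH j (by have := Finset.mem_range.1 hj; omega)).le _
    rw [← hc₁] at h1
    have h2 := Real.rpow_le_rpow (by positivity) h1 hr0.le
    rwa [← Real.rpow_mul (h.A_nonneg hL hσ hα0 hk), one_div_mul_cancel hr0.ne', Real.rpow_one,
      Real.mul_rpow hc10.le hs0] at h2
  have hlamsum : ∀ j < T, s.lamHat (j + 1) ≤ sumRoot s r (j + 1) ^ r := by
    intro j hj
    have h1 : s.lamHat (j + 1) ^ (1 / r) ≤ sumRoot s r (j + 1) :=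
      Finset.single_le_sum (f := fun j => s.lamHat (j + 1) ^ (1 / r))
        (fun i hi => Real.rpow_nonneg (hlH i (by have := Finset.mem_range.1 hi; omega)).le _)
        (Finset.mem_range.2 (Nat.lt_succ_self j))
    have h2 := Real.rpow_le_rpow (Real.rpow_nonneg (hlH j hj).le _) h1 hr0.le
    rwa [← Real.rpow_mul (hlH j hj).le, one_div_mul_cancel hr0.ne', Real.rpow_one] at h2
  have hnonneg : ∀ j < T, 0 ≤ s.γ (j + 1) * s.AHat (j + 1) * s.lam (j + 1) ^ (-e) := by
    intro j hj
    have h1 := h.γ_pos hL hσ hα0 hj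
    have h2 := h.lam_pos hL hσ hj
    have h3 := h.extrapolate j hj
    have h4 := h.A_nonneg hL hσ hα0 hj.le
    have h5 : 0 < s.AHat (j + 1) := by rw [h3.AHat_eq]; linarith [h3.aHat_pos]
    positivity
  have hgood : ∑ j ∈ goodSet s T, s.A (j + 1) * s.lamHat (j + 1) ^ (-e) ≤ B :=
    (Finset.sum_le_sum fun j hj => h.le_of_mem_goodSet hL hσ hα0 he hj).trans
      ((Finset.sum_le_sum_of_subset_of_nonneg (Finset.filter_subset _ _)
        fun j hj _ => hnonneg j (Finset.mem_range.1 hj)).trans hsum)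
  have hgood' : ∑ j ∈ goodSet s T, sumRoot s r (j + 1) ^ r * s.lamHat (j + 1) ^ (-e) ≤ B' := by
    rw [hB', le_div_iff₀' (by positivity), Finset.mul_sum]
    refine (Finset.sum_le_sum fun j hj => ?_).trans hgood
    have hj' := Finset.mem_range.1 (Finset.mem_filter.1 hj).1
    rw [← mul_assoc]
    exact mul_le_mul_of_nonneg_right (hA _ hj') (Real.rpow_nonneg (hlH j hj').le _)
  have hmem0 : 0 ∈ goodSet s T := Finset.mem_filter.2 ⟨Finset.mem_range.2 hT, Or.inl rfl⟩
  have hBpow : 0 < B' ^ (-(1 / (e - 1))) := by positivity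
  have hTρ : 0 < (T : ℝ) ^ ρ := by positivity
  rw [mul_assoc]
  rcases le_or_gt ((T : ℝ) / 4) ((goodSet s T).card : ℝ) with hcard | hcard
  · have hsub : goodSet s T ⊆ Finset.range T := Finset.filter_subset _ _
    have h1 := mul_rpow_le_sum_rpow (T := T) (x := fun j => s.lamHat (j + 1) ^ (1 / r))
      (fun j hj => Real.rpow_pos_of_pos (hlH j hj) _) hr0 he hB'0
      hsub ⟨0, hmem0⟩ (by
        refine le_trans (le_of_eq (Finset.sum_congr rfl fun j hj => ?_)) hgood'
        have hj' := Finset.mem_range.1 (Finset.mem_filter.1 hj).1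
        rw [← Real.rpow_mul (hlH j hj').le]
        have : 1 / r * -(r * e) = -e := by field_simp
        rw [this]
        rfl)
    have hβ0 : 0 < 1 - 1 / e := by
      have : 1 / e < 1 := by rw [div_lt_one he0]; exact he
      linarith
    have hs0 : 0 ≤ sumRoot s r T := Finset.sum_nonneg fun j hj =>
      Real.rpow_nonneg (hlH j (Finset.mem_range.1 hj)).le _
    have h2 : (1 - 1 / e) * ((T : ℝ) / 4 * ((T : ℝ) / 4 / B') ^ (1 / (r * e))) ≤
        sumRoot s r T ^ (1 - 1 / e) := by
      refine le_trans ?_ h1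
      gcongr
    have h3 := Real.rpow_le_rpow (by positivity) h2
      (by positivity : 0 ≤ r * e / (e - 1))
    rw [← Real.rpow_mul hs0, show (1 - 1 / e) * (r * e / (e - 1)) = r by field_simp] at h3
    have h4 : ((1 - 1 / e) * ((T : ℝ) / 4 * ((T : ℝ) / 4 / B') ^ (1 / (r * e)))) ^
        (r * e / (e - 1)) =
        (1 - 1 / e) ^ (r * e / (e - 1)) * (1 / 4) ^ ρ * ((T : ℝ) ^ ρ * B' ^ (-(1 / (e - 1)))) := by
      have hT4 : (0 : ℝ) < T / 4 := by positivity
      rw [Real.mul_rpow hβ0.le (by positivity), Real.mul_rpow hT4.le (by positivity),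
        ← Real.rpow_mul (by positivity), Real.div_rpow hT4.le hB'0.le, Real.rpow_neg hB'0.le,
        show 1 / (r * e) * (r * e / (e - 1)) = 1 / (e - 1) by field_simp]
      have e1 : ((T : ℝ) / 4) ^ (r * e / (e - 1)) * ((T : ℝ) / 4) ^ (1 / (e - 1)) =
          (1 / 4) ^ ρ * (T : ℝ) ^ ρ := by
        rw [← Real.rpow_add hT4, ← add_div, ← hρ, ← Real.mul_rpow (by norm_num) hT0.le]
        ring_nf
      calc _ = (1 - 1 / e) ^ (r * e / (e - 1)) * ((((T : ℝ) / 4) ^ (r * e / (e - 1)) *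
            ((T : ℝ) / 4) ^ (1 / (e - 1))) * (B' ^ (1 / (e - 1)))⁻¹) := by ring
        _ = _ := by rw [e1]; ring
    rw [h4] at h3
    calc _ ≤ c₁ ^ r * ((1 - 1 / e) ^ (r * e / (e - 1)) * (1 / 4) ^ ρ *
          ((T : ℝ) ^ ρ * B' ^ (-(1 / (e - 1))))) := by
          gcongr
          exact min_le_left _ _
      _ ≤ c₁ ^ r * sumRoot s r T ^ r := by gcongr
      _ ≤ _ := hA T le_rfl
  · obtain ⟨k, rfl⟩ : ∃ k, T = k + 1 := ⟨T - 1, by omega⟩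
    have h1 := h.lamHat_ge hL hσ hα (by omega) le_rfl
    have hl1 := hlH 0 (by omega)
    rw [zero_add] at hl1
    have h2 : α ^ (((k + 1 : ℕ) : ℝ) / 2) ≤
        α ^ (((k + 1 : ℕ) : ℝ) - 2 * (goodSet s (k + 1)).card) :=
      Real.rpow_le_rpow_of_exponent_le hα.le (by linarith)
    -- the first iteration bounds `lamHat 1` from below
    have h3 : B' ^ (-(1 / (e - 1))) ≤ s.lamHat 1 := by
      have h4 := Finset.single_le_sum
        (f := fun j => sumRoot s r (j + 1) ^ r * s.lamHat (j + 1) ^ (-e))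
        (fun j hj => by
          have hj' := Finset.mem_range.1 (Finset.mem_filter.1 hj).1
          exact mul_nonneg ((hlH j hj').le.trans (hlamsum j hj'))
            (Real.rpow_nonneg (hlH j hj').le _)) hmem0
      have h5 := mul_le_mul_of_nonneg_right (hlamsum 0 (by omega))
        (Real.rpow_nonneg hl1.le (-e))
      have h6 : s.lamHat 1 ^ (1 - e) ≤ B' := by
        rw [sub_eq_add_neg, Real.rpow_add hl1, Real.rpow_one]
        exact h5.trans (h4.trans hgood')
      have h7 := Real.rpow_le_rpow_of_nonpos (by positivity) h6
        (by rw [neg_nonpos]; positivity : -(1 / (e - 1)) ≤ 0)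
      rwa [← Real.rpow_mul hl1.le, show (1 - e) * -(1 / (e - 1)) = 1 by field_simp; ring,
        Real.rpow_one] at h7
    have h8 : s.lamHat (k + 2) ≤ α * s.lamHat (k + 1) := by
      have hk := hlH k (by omega)
      rw [h.lamHat_succ k (by omega)]
      split_ifs
      · exact le_rfl
      · exact mul_le_mul_of_nonneg_right ((inv_le_one_of_one_le₀ hα.le).trans hα.le) hk.le
    have h9 := hlamsum k (by omega)
    have h10 : c₂ / α * (((k + 1 : ℕ) : ℝ) ^ ρ * B' ^ (-(1 / (e - 1)))) ≤
        sumRoot s r (k + 1) ^ r := by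
      rw [div_mul_eq_mul_div, div_le_iff₀ hα0]
      calc c₂ * (((k + 1 : ℕ) : ℝ) ^ ρ * B' ^ (-(1 / (e - 1))))
          = (c₂ * ((k + 1 : ℕ) : ℝ) ^ ρ) * B' ^ (-(1 / (e - 1))) := by ring
        _ ≤ α ^ (((k + 1 : ℕ) : ℝ) - 2 * (goodSet s (k + 1)).card) * s.lamHat 1 := by
            gcongr
            exact hexp.trans h2
        _ ≤ s.lamHat (k + 2) := by rw [mul_comm]; exact h1
        _ ≤ α * s.lamHat (k + 1) := h8
        _ ≤ α * sumRoot s r (k + 1) ^ r := by gcongr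
        _ = sumRoot s r (k + 1) ^ r * α := mul_comm _ _
    calc _ ≤ c₁ ^ r * (c₂ / α * (((k + 1 : ℕ) : ℝ) ^ ρ * B' ^ (-(1 / (e - 1))))) := by
          gcongr
          exact min_le_right _ _
      _ ≤ c₁ ^ r * sumRoot s r (k + 1) ^ r := by gcongr
      _ ≤ _ := hA _ le_rfl

end IsAlg2Run

/-! ### The adaptive method: rate, existence, oracle access -/

/-- The rate of the adaptive method, with a constant that depends neither on the space nor on the
function, for a regularizer whose divergence from the starting point is at most `D * R ^ r`. -/
lemma exists_alg2_rate {q : ℕ} (hq : 1 ≤ q) {ν r α D : ℝ} (hν : 0 < ν) (hr : 1 < r)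
    (hrt : r < (q : ℝ) + ν) (hα : 1 < α) (hD : 0 < D) :
    ∃ c : ℝ, 0 < c ∧ ∀ (E : Type) [NormedAddCommGroup E] [NormedSpace ℝ E],
      (∀ x : E, x ≠ 0 → DifferentiableAt ℝ (‖·‖) x) →
      ∀ (f ψ : E → ℝ) (L R : ℝ) (T : ℕ) (b : Bool) (xs x₀ : E) (s : Alg2Data E),
        ConvexOn ℝ Set.univ f → ContDiff ℝ q f → 0 < L →
        (∀ x y, ‖iteratedFDeriv ℝ q f x - iteratedFDeriv ℝ q f y‖ ≤ L * ‖x - y‖ ^ ν) →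
        (∀ x, f xs ≤ f x) → 0 < R → 1 ≤ T →
        IsInexactUniformlyConvex 0 1 r ψ → bregman ψ xs x₀ ≤ D * R ^ r →
        IsAlg2Run q ν L r (1 / 4) (1 / 4) α b ψ x₀ f T s →
        f (s.y T) - f xs ≤
          c * (L * R ^ ((q : ℝ) + ν) * (T : ℝ) ^ (-(((r + 1) * (q + ν) - r) / r))) := by
  set t := (q : ℝ) + ν with ht
  have htr : 0 < t - r := by linarith
  have hr0 : 0 < r := by linarith
  have ht0 : 0 < t := by linarith
  -- the exponent relating `lam` to the length of the proximal step
  set e := t / (t - r) with he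
  have he1 : 1 < e := by rw [he, one_lt_div htr]; linarith
  have hee : e - 1 = r / (t - r) := by rw [he]; field_simp; ring
  have hee' : 1 / (e - 1) = (t - r) / r := by rw [hee, one_div_div]
  have hρ : (r * e + 1) / (e - 1) = ((r + 1) * t - r) / r := by
    rw [hee, he]; field_simp; ring
  obtain ⟨c₂, hc₂, hexp⟩ := exists_mul_rpow_le_rpow hα ((r * e + 1) / (e - 1))
  have hC := stepConst_pos one_pos hr
  obtain ⟨c₁, hc₁⟩ : ∃ c₁, c₁ = stepConst 1 r (1 / 4) (1 / 4) ^ (1 / r) / r /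
    IsAlg2Run.rootRatio α r := ⟨_, rfl⟩
  have hc10 : 0 < c₁ := by
    have := IsAlg2Run.rootRatio_pos (α := α) (r := r) hα hr0
    rw [hc₁]; positivity
  set c₃ := c₁ ^ r * min ((1 - 1 / e) ^ (r * e / (e - 1)) *
    (1 / 4) ^ ((r * e + 1) / (e - 1))) (c₂ / α) with hc₃
  have hβ0 : 0 < 1 - 1 / e := by
    have : 1 / e < 1 := by rw [div_lt_one (by linarith)]; exact he1
    linarith
  have hc30 : 0 < c₃ := by
    have hα0 : 0 < α := by linarith
    exact mul_pos (by positivity) (lt_min (by positivity) (by positivity))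
  refine ⟨D ^ (t / r) * (8 / c₁ ^ r) ^ ((t - r) / r) * 8 / (((q - 1).factorial : ℝ) * c₃),
    by positivity, ?_⟩
  intro E _ _ hsm f ψ L R T b xs x₀ s hfc hf hL hH hmin hR hT hψ hDR h
  have hT0 : (0 : ℝ) < T := by exact_mod_cast hT
  have hlam := baseLam_pos (q := q) hL (by norm_num : (0 : ℝ) < 1 / 4)
  set l := baseLam q L (1 / 4) with hl
  have hα0 : 0 < α := by linarith
  set M := D * R ^ r with hM
  have hM0 : 0 < M := by positivity
  have hrun := h.isAccelProxRun hsm hfc hq hf hL hν hr hα0 hH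
  have hbound := hrun.bound hsm hfc (hf.differentiable (by exact_mod_cast (by omega : q ≠ 0)))
    hr one_pos hψ xs
  rw [mul_zero, add_zero] at hbound
  have hgap : 0 ≤ f (s.y T) - f xs := by linarith [hmin (s.y T)]
  have hterm : ∀ j < T, s.γ (j + 1) * s.AHat (j + 1) * s.lam (j + 1) ^ (-e) =
      8 * l ^ (-(r / (t - r))) * (s.γ (j + 1) * s.AHat (j + 1) / (8 * s.lam (j + 1)) *
        ‖s.yt (j + 1) - s.x (j + 1)‖ ^ r) := by
    intro j hj
    have hlj := h.lam_pos hL (by norm_num) hj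
    have hn := norm_pos_iff.2 (sub_ne_zero.2 (h.yt_ne j hj))
    have e1 : s.lam (j + 1) ^ (-e) = s.lam (j + 1) ^ (-(r / (t - r))) / s.lam (j + 1) := by
      rw [← Real.rpow_sub_one hlj.ne', ← hee]; ring_nf
    have e2 : s.lam (j + 1) ^ (-(r / (t - r))) =
        l ^ (-(r / (t - r))) * ‖s.yt (j + 1) - s.x (j + 1)‖ ^ r := by
      conv_lhs => rw [h.lam_succ j hj]
      rw [Real.mul_rpow hlam.le (by positivity), ← Real.rpow_mul hn.le]
      congr 2
      rw [← ht]
      field_simp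
      ring
    rw [e1, e2]
    field_simp
  have hS0 : 0 ≤ ∑ j ∈ Finset.range T, s.γ (j + 1) * s.AHat (j + 1) / (8 * s.lam (j + 1)) *
        ‖s.yt (j + 1) - s.x (j + 1)‖ ^ r :=
    Finset.sum_nonneg fun j hj => by
      have hj' := Finset.mem_range.1 hj
      have := hrun.γ_pos j hj'
      have := hrun.AHat_pos hj'
      have := hrun.lam_pos j hj'
      positivity
  have hA0 := h.A_nonneg hL (by norm_num) hα0 le_rfl
  have hsum : ∑ j ∈ Finset.range T, s.γ (j + 1) * s.AHat (j + 1) * s.lam (j + 1) ^ (-e) ≤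
      8 * l ^ (-(r / (t - r))) * M := by
    rw [Finset.sum_congr rfl fun j hj => hterm j (Finset.mem_range.1 hj), ← Finset.mul_sum]
    refine mul_le_mul_of_nonneg_left ?_ (by positivity)
    have := mul_nonneg hA0 hgap
    linarith
  have hgrow := h.le_A hL (by norm_num) hα hr hC hT he1 (by positivity) hsum hc₁ (hexp T hT)
  rw [← hc₃] at hgrow
  have hM2 : s.A T * (f (s.y T) - f xs) ≤ M := by linarith
  have hM3 := (mul_le_mul_of_nonneg_right hgrow hgap).trans hM2
  rw [hρ, hee'] at hM3
  have hpos : 0 < c₃ * ((T : ℝ) ^ (((r + 1) * t - r) / r) *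
      (8 * l ^ (-(r / (t - r))) * M / c₁ ^ r) ^ (-((t - r) / r))) := by positivity
  rw [← le_div_iff₀' hpos] at hM3
  refine hM3.trans (le_of_eq ?_)
  have e1 : (8 * l ^ (-(r / (t - r))) * M / c₁ ^ r) ^ ((t - r) / r) =
      (8 / c₁ ^ r) ^ ((t - r) / r) * l⁻¹ * M ^ ((t - r) / r) := by
    rw [show 8 * l ^ (-(r / (t - r))) * M / c₁ ^ r = 8 / c₁ ^ r * l ^ (-(r / (t - r))) * M by ring,
      Real.mul_rpow (by positivity) hM0.le, Real.mul_rpow (by positivity) (by positivity),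
      ← Real.rpow_mul hlam.le,
      show -(r / (t - r)) * ((t - r) / r) = -1 by field_simp, Real.rpow_neg_one]
  have e2 : M * M ^ ((t - r) / r) = D ^ (t / r) * R ^ t := by
    rw [← Real.rpow_one_add' hM0.le (by positivity), hM,
      show 1 + (t - r) / r = t / r by field_simp; ring, Real.mul_rpow hD.le (by positivity),
      ← Real.rpow_mul hR.le, mul_div_cancel₀ _ hr0.ne']
  have e3 : l⁻¹ = 8 * L / ((q - 1).factorial : ℝ) := by
    rw [hl]; unfold baseLam; field_simp; ring
  rw [Real.rpow_neg (by positivity), e1, Real.rpow_neg hT0.le]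
  have hT' : (T : ℝ) ^ (((r + 1) * t - r) / r) ≠ 0 := by positivity
  calc M / (c₃ * ((T : ℝ) ^ (((r + 1) * t - r) / r) *
        ((8 / c₁ ^ r) ^ ((t - r) / r) * l⁻¹ * M ^ ((t - r) / r))⁻¹))
      = (M * M ^ ((t - r) / r)) * (8 / c₁ ^ r) ^ ((t - r) / r) * l⁻¹ /
          (c₃ * (T : ℝ) ^ (((r + 1) * t - r) / r)) := by
        rw [← mul_assoc, ← div_eq_mul_inv, div_div_eq_mul_div]
        ring
    _ = _ := by
        rw [e2, e3]
        field_simp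

section Method2

variable {E : Type} [NormedAddCommGroup E] [NormedSpace ℝ E]

variable {q : ℕ} {ν L r σ σ' α : ℝ} {b : Bool} {ψ : E → ℝ} {x₀ : E} {f : E → ℝ} {K : ℕ}
  {s : Alg2Data E}

namespace IsAlg2Run

/-- The first `K` iterations only involve the data with indices up to `K`, and, if `K > 0`, the
tentative parameter prepared for iteration `K + 1`. -/
lemma congr {s' : Alg2Data E} (h : IsAlg2Run q ν L r σ σ' α b ψ x₀ f K s)
    (hx : ∀ i ≤ K, s'.x i = s.x i) (hy : ∀ i ≤ K, s'.y i = s.y i)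
    (hyt : ∀ i ≤ K, s'.yt i = s.yt i) (hz : ∀ i ≤ K, s'.z i = s.z i)
    (hv : ∀ i ≤ K, s'.v i = s.v i) (hlam : ∀ i ≤ K, s'.lam i = s.lam i)
    (hlamHat : 0 < K → ∀ i ≤ K + 1, s'.lamHat i = s.lamHat i) (ha : ∀ i ≤ K, s'.a i = s.a i)
    (haHat : ∀ i ≤ K, s'.aHat i = s.aHat i) (hA : ∀ i ≤ K, s'.A i = s.A i)
    (hAHat : ∀ i ≤ K, s'.AHat i = s.AHat i) (hγ : ∀ i ≤ K, s'.γ i = s.γ i) :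
    IsAlg2Run q ν L r σ σ' α b ψ x₀ f K s' where
  y_zero := by rw [hy 0 (by omega), h.y_zero]
  z_zero := by rw [hz 0 (by omega), h.z_zero]
  A_zero := by rw [hA 0 (by omega), h.A_zero]
  lamHat_one hK := by rw [hlamHat hK 1 (by omega), hlam 1 (by omega), h.lamHat_one hK]
  extrapolate k hk := by
    have e := h.extrapolate k hk
    have hl := hlamHat (by omega) (k + 1) (by omega)
    have h1 := hAHat (k + 1) (by omega)
    have h2 := haHat (k + 1) (by omega)
    have h3 := hA k (by omega)
    refine ⟨?_, ?_, ?_, ?_⟩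
    · rw [h1, h2, h3]; exact e.AHat_eq
    · rw [h2]; exact e.aHat_pos
    · rw [h1, h2, hl]; exact e.aHat_eq
    · rw [h1, h2, h3, hx _ (by omega), hy _ (by omega), hz _ (by omega)]; exact e.x_eq
  yt_succ k hk := by rw [hx _ (by omega), hyt _ (by omega)]; exact h.yt_succ k hk
  yt_ne k hk := by rw [hx _ (by omega), hyt _ (by omega)]; exact h.yt_ne k hk
  v_succ k hk := by rw [hv _ (by omega), hyt _ (by omega)]; exact h.v_succ k hk
  lam_succ k hk := by
    rw [hlam _ (by omega), hx _ (by omega), hyt _ (by omega)]; exact h.lam_succ k hk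
  γ_succ k hk := by
    rw [hγ _ (by omega), hlam _ (by omega), hlamHat (by omega) _ (by omega)]; exact h.γ_succ k hk
  a_succ k hk := by
    rw [ha _ (by omega), hγ _ (by omega), haHat _ (by omega)]; exact h.a_succ k hk
  A_succ k hk := by rw [hA _ (by omega), hA _ (by omega), ha _ (by omega)]; exact h.A_succ k hk
  y_succ k hk := by
    have := h.y_succ k hk
    unfold Alg2YRule at this ⊢
    rw [hy _ (by omega), hy _ (by omega), hyt _ (by omega), hγ _ (by omega), hA _ (by omega),
      hA _ (by omega), hAHat _ (by omega)]
    exact this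
  z_succ k hk w := by
    have e : ∀ w, ∑ i ∈ Finset.Icc 1 (k + 1), s'.a i * s'.v i w =
        ∑ i ∈ Finset.Icc 1 (k + 1), s.a i * s.v i w := fun w =>
      Finset.sum_congr rfl fun i hi => by
        have := (Finset.mem_Icc.1 hi).2
        rw [ha _ (by omega), hv _ (by omega)]
    rw [e, e, hz _ (by omega)]
    exact h.z_succ k hk w
  lamHat_succ k hk := by
    rw [hlamHat (by omega) _ (by omega), hlamHat (by omega) _ (by omega), hlam _ (by omega)]
    exact h.lamHat_succ k hk

end IsAlg2Run

/-- The first extrapolated point is the starting point, whatever the tentative parameter. -/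
lemma Alg2Extrapolate.x_one {C : ℝ} (h : Alg2Extrapolate C r s 0) (hA : s.A 0 = 0)
    (hz : s.z 0 = x₀) : s.x 1 = x₀ := by
  have h1 := h.AHat_eq
  have h2 := h.aHat_pos
  have h3 := h.x_eq
  rw [hA, add_zero] at h1
  rw [hA, h1, hz, div_self h2.ne', zero_div, zero_smul, one_smul] at h3
  exact h3.trans (zero_add _)

/-- For the rule that takes the better point, the values of `f` at the iterates are values at trial
points or at `x₀ = x₁`, where the oracle is queried. -/
lemma IsAlg2Run.transfer {g : E → ℝ} (h : IsAlg2Run q ν L r σ σ' α b ψ x₀ f K s)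
    (hS : SameAnswers q f g s.x s.yt K) : IsAlg2Run q ν L r σ σ' α b ψ x₀ g K s := by
  have hval : b = true → 0 < K → ∀ k ≤ K, g (s.y k) = f (s.y k) := by
    intro hb hK k hk
    induction k with
    | zero =>
      have h1 := congrArg (fun J : Jet E q => J 0 0) (hS 0 hK).1
      have h2 : g (s.x 1) = f (s.x 1) := h1
      rwa [(h.extrapolate 0 hK).x_one h.A_zero h.z_zero, ← h.y_zero] at h2
    | succ k ih =>
      have hy := h.y_succ k (by omega)
      unfold Alg2YRule at hy
      rw [if_pos hb] at hy
      rcases hy.1 with h1 | h1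
      · rw [h1]; exact (hS k (by omega)).2.1
      · rw [h1]; exact ih (by omega)
  exact
    { h with
      yt_succ := fun k hk => by rw [(hS k hk).1]; exact h.yt_succ k hk
      v_succ := fun k hk => by rw [(hS k hk).2.2]; exact h.v_succ k hk
      y_succ := fun k hk => by
        have hy := h.y_succ k hk
        unfold Alg2YRule at hy ⊢
        split_ifs at hy ⊢ with hb
        · rw [hval hb (by omega) _ (by omega), hval hb (by omega) _ (by omega), (hS k hk).2.1]
          exact hy
        · exact hy }

lemma Alg2Halts.transfer {g : E → ℝ} {T N : ℕ} {out : E}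
    (h : Alg2Halts q ν L r σ σ' α b ψ x₀ f T N s out) (hS : SameAnswers q f g s.x s.yt N) :
    Alg2Halts q ν L r σ σ' α b ψ x₀ g T N s out := by
  rcases h with ⟨rfl, hrun, hout⟩ | ⟨K, hKT, rfl, hrun, hex, hcrit, heq, hout⟩
  · exact Or.inl ⟨rfl, hrun.transfer hS, hout⟩
  · refine Or.inr ⟨K, hKT, rfl, hrun.transfer fun k hk => hS k (by omega), hex, ?_, heq, hout⟩
    rw [(hS K (by omega)).1]
    exact hcrit

/-- One more iteration can be started, and either it halts or it can be completed. -/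
lemma IsAlg2Run.exists_succ [FiniteDimensional ℝ E]
    (h : IsAlg2Run q ν L r (1 / 4) (1 / 4) α b ψ x₀ f K s)
    (hsm : ∀ x : E, x ≠ 0 → DifferentiableAt ℝ (‖·‖) x)
    (hq : 1 ≤ q) (hf : ContDiff ℝ q f) (hL : 0 < L) (hν : 0 < ν) (hα : 0 < α) (hr : 1 < r)
    (hψ : IsInexactUniformlyConvex 0 1 r ψ) :
    ∃ s' : Alg2Data E, IsAlg2Run q ν L r (1 / 4) (1 / 4) α b ψ x₀ f K s' ∧
      Alg2Extrapolate (stepConst 1 r (1 / 4) (1 / 4)) r s' K ∧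
      IsApproxCritical L ν (baseLam q L (1 / 4))
        (qOracle q f (s'.x (K + 1))) (s'.x (K + 1)) (s'.yt (K + 1)) ∧
      (s'.yt (K + 1) ≠ s'.x (K + 1) →
        IsAlg2Run q ν L r (1 / 4) (1 / 4) α b ψ x₀ f (K + 1) s') := by
  have hlam := baseLam_pos (q := q) hL (by norm_num : (0 : ℝ) < 1 / 4)
  have hC := stepConst_pos one_pos hr
  have hAK := h.A_nonneg hL (by norm_num) hα le_rfl
  -- in the first iteration the tentative parameter is only known after the Taylor step
  obtain ⟨l, aH, X, Y, hl, hlK, haH, haHe, hX, hY, hl1⟩ : ∃ (l aH : ℝ) (X Y : E), 0 < l ∧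
      (0 < K → l = s.lamHat (K + 1)) ∧ 0 < aH ∧
      aH = (stepConst 1 r (1 / 4) (1 / 4) * (aH + s.A K) ^ (r - 1) * l) ^ (1 / r) ∧
      X = (s.A K / (aH + s.A K)) • s.y K + (aH / (aH + s.A K)) • s.z K ∧
      IsApproxCritical L ν (baseLam q L (1 / 4)) (qOracle q f X) X Y ∧
      (Y ≠ X → K = 0 → l = baseLam q L (1 / 4) * ‖Y - X‖ ^ (r - ((q : ℝ) + ν))) := by
    rcases Nat.eq_zero_or_pos K with rfl | hK
    · obtain ⟨Y, hY⟩ := exists_isApproxCritical hsm hq hf hL hν hlam x₀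
      obtain ⟨l, hl, hl1⟩ : ∃ l : ℝ, 0 < l ∧
          (Y ≠ x₀ → l = baseLam q L (1 / 4) * ‖Y - x₀‖ ^ (r - ((q : ℝ) + ν))) := by
        by_cases hYx : Y = x₀
        · exact ⟨1, one_pos, fun h => absurd hYx h⟩
        · have := norm_pos_iff.2 (sub_ne_zero.2 hYx)
          exact ⟨_, by positivity, fun _ => rfl⟩
      obtain ⟨aH, haH, haHe⟩ := exists_stepSize hr hAK (mul_pos hC hl)
      have hX : x₀ = (s.A 0 / (aH + s.A 0)) • s.y 0 + (aH / (aH + s.A 0)) • s.z 0 := by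
        rw [h.A_zero, h.z_zero, add_zero, zero_div, div_self haH.ne', zero_smul, one_smul,
          zero_add]
      exact ⟨l, aH, x₀, Y, hl, fun h => absurd h (lt_irrefl 0), haH,
        by conv_lhs => rw [haHe]
           ring_nf, hX, hY, fun h1 _ => hl1 h1⟩
    · have hl := h.lamHat_pos hL (by norm_num) hα hK le_rfl
      obtain ⟨aH, haH, haHe⟩ := exists_stepSize hr hAK (mul_pos hC hl)
      obtain ⟨Y, hY⟩ := exists_isApproxCritical hsm hq hf hL hν hlam
        ((s.A K / (aH + s.A K)) • s.y K + (aH / (aH + s.A K)) • s.z K)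
      exact ⟨_, aH, _, Y, hl, fun _ => rfl, haH,
        by conv_lhs => rw [haHe]
           ring_nf, rfl, hY, fun _ h0 => absurd h0 (by omega)⟩
  set lm := baseLam q L (1 / 4) * ‖Y - X‖ ^ (r - ((q : ℝ) + ν)) with hlm
  set g := min (lm / l) 1 with hg
  set A' := g * aH + s.A K with hA'
  let y' : E := if b = true then (if f Y ≤ f (s.y K) then Y else s.y K) else
    ((1 - g) * s.A K / A') • s.y K + (g * (aH + s.A K) / A') • Y
  obtain ⟨Z, hZ⟩ := exists_minimizer_add_bregman hr hψ x₀
    ((∑ i ∈ Finset.Icc 1 K, s.a i • s.v i) + (g * aH) • fderiv ℝ f Y)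
  let s' : Alg2Data E :=
    { x := Function.update s.x (K + 1) X, y := Function.update s.y (K + 1) y'
      yt := Function.update s.yt (K + 1) Y, z := Function.update s.z (K + 1) Z
      v := Function.update s.v (K + 1) (fderiv ℝ f Y), lam := Function.update s.lam (K + 1) lm
      lamHat := Function.update (Function.update s.lamHat (K + 1) l) (K + 2)
        (if l ≤ lm then α * l else α⁻¹ * l)
      a := Function.update s.a (K + 1) (g * aH), aHat := Function.update s.aHat (K + 1) aH
      A := Function.update s.A (K + 1) A', AHat := Function.update s.AHat (K + 1) (aH + s.A K)
      γ := Function.update s.γ (K + 1) g }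
  have hne : ∀ i ≤ K, i ≠ K + 1 := fun i hi => by omega
  have ex : s'.x (K + 1) = X := Function.update_self _ _ _
  have ey : s'.y (K + 1) = y' := Function.update_self _ _ _
  have eyt : s'.yt (K + 1) = Y := Function.update_self _ _ _
  have ez : s'.z (K + 1) = Z := Function.update_self _ _ _
  have ev : s'.v (K + 1) = fderiv ℝ f Y := Function.update_self _ _ _
  have elam : s'.lam (K + 1) = lm := Function.update_self _ _ _
  have elH2 : s'.lamHat (K + 2) = if l ≤ lm then α * l else α⁻¹ * l := Function.update_self _ _ _
  have elH : s'.lamHat (K + 1) = l := by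
    have : K + 1 ≠ K + 2 := by omega
    exact (Function.update_of_ne this _ _).trans (Function.update_self _ _ _)
  have ea : s'.a (K + 1) = g * aH := Function.update_self _ _ _
  have eaH : s'.aHat (K + 1) = aH := Function.update_self _ _ _
  have eA : s'.A (K + 1) = A' := Function.update_self _ _ _
  have eAH : s'.AHat (K + 1) = aH + s.A K := Function.update_self _ _ _
  have eγ : s'.γ (K + 1) = g := Function.update_self _ _ _
  have eAK : s'.A K = s.A K := Function.update_of_ne (hne K le_rfl) _ _
  have eyK : s'.y K = s.y K := Function.update_of_ne (hne K le_rfl) _ _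
  have ezK : s'.z K = s.z K := Function.update_of_ne (hne K le_rfl) _ _
  have hc : IsAlg2Run q ν L r (1 / 4) (1 / 4) α b ψ x₀ f K s' := by
    refine h.congr (fun i hi => Function.update_of_ne (hne i hi) _ _)
      (fun i hi => Function.update_of_ne (hne i hi) _ _)
      (fun i hi => Function.update_of_ne (hne i hi) _ _)
      (fun i hi => Function.update_of_ne (hne i hi) _ _)
      (fun i hi => Function.update_of_ne (hne i hi) _ _)
      (fun i hi => Function.update_of_ne (hne i hi) _ _) (fun hK i hi => ?_)
      (fun i hi => Function.update_of_ne (hne i hi) _ _)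
      (fun i hi => Function.update_of_ne (hne i hi) _ _)
      (fun i hi => Function.update_of_ne (hne i hi) _ _)
      (fun i hi => Function.update_of_ne (hne i hi) _ _)
      (fun i hi => Function.update_of_ne (hne i hi) _ _)
    rcases eq_or_ne i (K + 1) with rfl | hi'
    · rw [elH, hlK hK]
    · have : i ≠ K + 2 := by omega
      exact (Function.update_of_ne this _ _).trans (Function.update_of_ne hi' _ _)
  have hex : Alg2Extrapolate (stepConst 1 r (1 / 4) (1 / 4)) r s' K := by
    refine ⟨?_, ?_, ?_, ?_⟩
    · rw [eAH, eaH, eAK]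
    · rw [eaH]; exact haH
    · rw [eaH, eAH, elH]; exact haHe
    · rw [ex, eAH, eaH, eAK, eyK, ezK]; exact hX
  refine ⟨s', hc, hex, by rw [ex, eyt]; exact hY, fun hYX => ?_⟩
  rw [ex, eyt] at hYX
  have split : ∀ {P : ℕ → Prop}, (∀ k < K, P k) → P K → ∀ k < K + 1, P k := by
    intro P h1 h2 k hk
    rcases Nat.lt_succ_iff_lt_or_eq.1 hk with h | rfl
    · exact h1 k h
    · exact h2
  refine ⟨hc.y_zero, hc.z_zero, hc.A_zero, fun _ => ?_, split hc.extrapolate hex,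
    split hc.yt_succ ?_, split hc.yt_ne ?_, split hc.v_succ ?_, split hc.lam_succ ?_,
    split hc.γ_succ ?_, split hc.a_succ ?_, split hc.A_succ ?_, split hc.y_succ ?_,
    split hc.z_succ ?_, split hc.lamHat_succ ?_⟩
  · rcases Nat.eq_zero_or_pos K with hK | hK
    · have e1 : s'.lamHat 1 = l := by rw [← elH, hK]
      have e2 : s'.lam 1 = lm := by rw [← elam, hK]
      rw [e1, e2]
      exact hl1 hYX hK
    · exact hc.lamHat_one hK
  · rw [ex, eyt]; exact hY
  · rw [ex, eyt]; exact hYX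
  · rw [ev, eyt]
  · rw [elam, ex, eyt]
  · rw [eγ, elam, elH]
  · rw [ea, eγ, eaH]
  · rw [eA, ea, eAK]
  · unfold Alg2YRule
    rw [ey, eyt, eyK, eγ, eA, eAK, eAH]
    by_cases hb : b = true
    · rw [if_pos hb]
      by_cases hfY : f Y ≤ f (s.y K)
      · have e : y' = Y := by simp only [y', if_pos hb, if_pos hfY]
        rw [e]
        exact ⟨Or.inl rfl, le_rfl, hfY⟩
      · have e : y' = s.y K := by simp only [y', if_pos hb, if_neg hfY]
        rw [e]
        exact ⟨Or.inr rfl, (not_le.1 hfY).le, le_rfl⟩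
    · rw [if_neg hb]
      simp only [y', if_neg hb]
  · intro w
    have e : ∀ w, ∑ i ∈ Finset.Icc 1 (K + 1), s'.a i * s'.v i w =
        ((∑ i ∈ Finset.Icc 1 K, s.a i • s.v i) + (g * aH) • fderiv ℝ f Y) w := by
      intro w
      rw [Finset.sum_Icc_succ_top (by omega), ea, ev, _root_.add_apply, _root_.sum_apply]
      refine congrArg₂ (· + ·) (Finset.sum_congr rfl fun i hi => ?_) rfl
      have hi' := (Finset.mem_Icc.1 hi).2
      rw [show s'.a i = s.a i from Function.update_of_ne (hne i hi') _ _,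
        show s'.v i = s.v i from Function.update_of_ne (hne i hi') _ _]
      rfl
    rw [e, e, ez]
    exact hZ w
  · rw [elH2, elH, elam]

lemma exists_alg2Halts [FiniteDimensional ℝ E]
    (hsm : ∀ x : E, x ≠ 0 → DifferentiableAt ℝ (‖·‖) x)
    (hq : 1 ≤ q) (hf : ContDiff ℝ q f) (hL : 0 < L) (hν : 0 < ν) (hα : 0 < α) (hr : 1 < r)
    (hψ : IsInexactUniformlyConvex 0 1 r ψ) (b : Bool) (x₀ : E) (T : ℕ) :
    ∃ N s out, Alg2Halts q ν L r (1 / 4) (1 / 4) α b ψ x₀ f T N s out := by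
  by_contra hno
  push Not at hno
  have key : ∀ K ≤ T, ∃ s, IsAlg2Run q ν L r (1 / 4) (1 / 4) α b ψ x₀ f K s := by
    intro K hK
    induction K with
    | zero =>
      exact ⟨⟨fun _ => x₀, fun _ => x₀, fun _ => x₀, fun _ => x₀, fun _ => 0, fun _ => 0,
        fun _ => 0, fun _ => 0, fun _ => 0, fun _ => 0, fun _ => 0, fun _ => 0⟩,
        { y_zero := rfl, z_zero := rfl, A_zero := rfl,
          lamHat_one := fun h => absurd h (by omega),
          extrapolate := fun k hk => absurd hk (by omega),
          yt_succ := fun k hk => absurd hk (by omega), yt_ne := fun k hk => absurd hk (by omega),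
          v_succ := fun k hk => absurd hk (by omega), lam_succ := fun k hk => absurd hk (by omega),
          γ_succ := fun k hk => absurd hk (by omega), a_succ := fun k hk => absurd hk (by omega),
          A_succ := fun k hk => absurd hk (by omega), y_succ := fun k hk => absurd hk (by omega),
          z_succ := fun k hk => absurd hk (by omega),
          lamHat_succ := fun k hk => absurd hk (by omega) }⟩
    | succ K ih =>
      obtain ⟨s, hs⟩ := ih (by omega)
      obtain ⟨s', h1, h2, h3, h4⟩ := hs.exists_succ hsm hq hf hL hν hα hr hψ
      by_cases heq : s'.yt (K + 1) = s'.x (K + 1)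
      · exact absurd (Or.inr ⟨K, by omega, rfl, h1, h2, h3, heq, rfl⟩) (hno (K + 1) s' _)
      · exact ⟨s', h4 heq⟩
  obtain ⟨s, hs⟩ := key T le_rfl
  exact hno T s _ (Or.inl ⟨rfl, hs, rfl⟩)

end Method2

end

/-! ### The convergence theorem -/

theorem mainTheorem3 (p : ℝ≥0∞) [Fact (1 ≤ p)] (hp_one : 1 < p) (hp_top : p ≠ ∞)
    (q : ℕ) (hq : 1 ≤ q) (ν : ℝ) (hν_pos : 0 < ν) (hν_le : ν ≤ 1) (α : ℝ) (hα : 1 < α)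
    (m : ℝ) (hm : m = max 2 p.toReal) :
    ∃ c : ℝ, 0 < c ∧
      ∀ (d : ℕ) (f : PiLp p (fun _ : Fin d => ℝ) → ℝ) (L : ℝ)
        (xs x₀ : PiLp p (fun _ : Fin d => ℝ)) (R : ℝ) (T : ℕ),
        ConvexOn ℝ Set.univ f → ContDiff ℝ q f → 0 < L →
        (∀ x y, ‖iteratedFDeriv ℝ q f x - iteratedFDeriv ℝ q f y‖ ≤ L * ‖x - y‖ ^ ν) →
        (∀ x, f xs ≤ f x) → 0 < R → ‖xs - x₀‖ ≤ R → 1 ≤ T →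
        ((q : ℝ) + ν ≤ m →
          (∃ δ : ℝ, 0 ≤ δ ∧
            IsInexactUniformlyConvex δ (inexactMu m (q + ν) R T) (q + ν) (pReg p.toReal x₀)) ∧
          (∃ s, IsAlg1Run q ν L (q + ν) (inexactMu m (q + ν) R T) (1 / 4) (1 / 4)
            (pReg p.toReal x₀) x₀ f T s) ∧
          (∀ s, IsAlg1Run q ν L (q + ν) (inexactMu m (q + ν) R T) (1 / 4) (1 / 4)
              (pReg p.toReal x₀) x₀ f T s →
            f (s.y T) - f xs ≤
              c * (L * R ^ ((q : ℝ) + ν) * (T : ℝ) ^ (-(((m + 1) * (q + ν) - m) / m)))) ∧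
          (∀ s K, K ≤ T →
            IsAlg1Run q ν L (q + ν) (inexactMu m (q + ν) R T) (1 / 4) (1 / 4)
              (pReg p.toReal x₀) x₀ f K s →
            (∀ k < K, IsInexactProx f (q + ν) (baseLam q L (1 / 4)) (1 / 4) (1 / 4)
              (s.x (k + 1)) (s.y (k + 1)) (s.v (k + 1))) ∧
            (∀ g, SameAnswers q f g s.x s.y K →
              IsAlg1Run q ν L (q + ν) (inexactMu m (q + ν) R T) (1 / 4) (1 / 4)
                (pReg p.toReal x₀) x₀ g K s))) ∧
        (m < (q : ℝ) + ν → ∀ b : Bool,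
          IsInexactUniformlyConvex 0 1 m (pReg p.toReal x₀) ∧
          (∃ N s out, Alg2Halts q ν L m (1 / 4) (1 / 4) α b (pReg p.toReal x₀) x₀ f T N s out) ∧
          (∀ N s out, Alg2Halts q ν L m (1 / 4) (1 / 4) α b (pReg p.toReal x₀) x₀ f T N s out →
            f out - f xs ≤
              c * (L * R ^ ((q : ℝ) + ν) * (T : ℝ) ^ (-(((m + 1) * (q + ν) - m) / m))) ∧
            (∀ g, SameAnswers q f g s.x s.yt N →
              Alg2Halts q ν L m (1 / 4) (1 / 4) α b (pReg p.toReal x₀) x₀ g T N s out)) ∧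
          (∀ s K, K ≤ T →
            IsAlg2Run q ν L m (1 / 4) (1 / 4) α b (pReg p.toReal x₀) x₀ f K s →
            ∀ k < K, IsInexactProx f m (s.lam (k + 1)) (1 / 4) (1 / 4)
              (s.x (k + 1)) (s.yt (k + 1)) (s.v (k + 1)))) := by
  have hp : 1 < p.toReal := by
    simpa using (ENNReal.toReal_lt_toReal ENNReal.one_ne_top hp_top).2 hp_one
  have hm2 : 2 ≤ m := hm ▸ le_max_left 2 p.toReal
  have hm1 : 1 < m := by linarith
  have hq1 : (1 : ℝ) ≤ q := by exact_mod_cast hq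
  have hr : 1 < (q : ℝ) + ν := by linarith
  have hq0 : ((q : ℕ) : WithTop ℕ∞) ≠ 0 := by exact_mod_cast (by omega : q ≠ 0)
  have hDpos := pRegConst_pos hp
  have hD : ∀ {d : ℕ} {xs x₀ : PiLp p (fun _ : Fin d => ℝ)} {R : ℝ}, ‖xs - x₀‖ ≤ R →
      bregman (pReg p.toReal x₀) xs x₀ ≤ pRegConst p.toReal * R ^ m := by
    intro d xs x₀ R h
    rw [bregman_pReg_center (fun x hx => PiLp.differentiableAt_norm hp x hx), ← hm]
    gcongr
  have hUC : ∀ {d : ℕ} (x₀ : PiLp p (fun _ : Fin d => ℝ)),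
      IsInexactUniformlyConvex 0 1 m (pReg p.toReal x₀) := by
    intro d x₀
    rw [hm]
    exact PiLp.isInexactUniformlyConvex_pReg hp x₀
  by_cases hrm : (q : ℝ) + ν ≤ m
  · have hC := stepConst_pos one_pos hr
    have hmr : 0 ≤ m - ((q : ℝ) + ν) := by linarith
    refine ⟨(pRegConst p.toReal + 2 * ((m - (q + ν)) / ((q + ν) * m))) *
        (8 * ((q : ℝ) + ν) ^ ((q : ℝ) + ν)) /
        (stepConst 1 (q + ν) (1 / 4) (1 / 4) * ((q - 1).factorial : ℝ)), by positivity, ?_⟩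
    intro d f L xs x₀ R T hfc hf hL hH hmin hR hx hT
    have hsm := fun x hx => PiLp.differentiableAt_norm (d := d) hp x hx
    have hT0 : (0 : ℝ) < T := by exact_mod_cast hT
    refine ⟨fun _ => ⟨⟨_, ?_, (hUC x₀).of_exponent_le (by linarith) hrm hR hT0⟩,
      exists_isAlg1Run hsm hq hf hL hν_pos (inexactMu_pos hR hT0) hm1 (hUC x₀) x₀ T,
      fun s hs => hs.rate hsm hfc hq hf hL hν_pos hH hrm (hUC x₀) hR hT hmin (hD hx),
      fun s K _ hs => ⟨fun k hk => ?_, fun g hg => hs.transfer hg⟩⟩,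
      fun h => absurd hrm (not_le.2 h)⟩
    · positivity
    · have h := hs.norm_add_le hsm hq hf hL hν_pos hH hk
      rw [hs.v_succ k hk] at h ⊢
      exact isInexactProx_of_norm_fderiv_add_le hsm hfc hr (baseLam_pos hL (by norm_num))
        (hf.differentiable hq0 _) h
  · have hrt := not_le.1 hrm
    obtain ⟨c, hc, hrate⟩ := exists_alg2_rate hq hν_pos hm1 hrt hα hDpos
    refine ⟨c, hc, ?_⟩
    intro d f L xs x₀ R T hfc hf hL hH hmin hR hx hT
    have hsm := fun x hx => PiLp.differentiableAt_norm (d := d) hp x hx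
    refine ⟨fun h => absurd h hrm, fun _ b => ⟨hUC x₀,
      exists_alg2Halts hsm hq hf hL hν_pos (by linarith) hm1 (hUC x₀) b x₀ T,
      fun N s out hs => ⟨?_, fun g hg => hs.transfer hg⟩, fun s K _ hs k hk => ?_⟩⟩
    · rcases hs with ⟨_, hrun, rfl⟩ | ⟨K, _, _, _, _, hcrit, heq, rfl⟩
      · exact hrate _ hsm f _ L R T b xs x₀ s hfc hf hL hH hmin hR hT (hUC x₀) (hD hx) hrun
      · -- a Taylor step that does not move certifies a critical point, hence a minimizer
        rw [heq] at hcrit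
        have h0 := hcrit.fderiv_eq_zero hsm hq hf hL hν_pos hH
        have h1 := hfc.add_fderiv_le (hf.differentiable hq0 (s.x (K + 1))) xs
        rw [h0, _root_.zero_apply, add_zero] at h1
        exact (sub_nonpos.2 h1).trans (by positivity)
    · have h := hs.norm_add_le hsm hq hf hL hν_pos hH hk
      rw [hs.v_succ k hk] at h ⊢
      exact isInexactProx_of_norm_fderiv_add_le hsm hfc hm1 (hs.lam_pos hL (by norm_num) hk)
        (hf.differentiable hq0 _) h
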